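/- **Setting.** Let $G$ be a compact Lie group (in particular any non-Abelian one) with Lie algebra $\mathfrak g$, let $\langle\cdot,\cdot\rangle$ be an $\mathrm{Ad}(G)$-invariant inner product on $\mathfrak g$ with orthonormal basis $\tau_a=iT^a$, and let $\rho$ be a smooth finite-dimensional matrix representation of $G$, with generators $T^a_\rho$ determined by $\rho(e^{t\tau_a})=e^{itT^a_\rho}$. Consider an oriented lattice with finite edge set $E$, without self-loops, and with a set $\mathcal B$ of global boundary vertices. Operators act on the smooth functions $C^\infty(G^E)\subset L^2(G^E)$. On the edge $e$, $U_e(h)|g\rangle=|hg\rangle$, $V_e(h)|g\rangle=|gh^{-1}\rangle$, the electric fields are given by $U_e(e^{t\tau_a})=e^{-itL^a_e}$ and $V_e(e^{t\tau_a})=e^{itR^a_e}$, and $(\mathfrak G^v_e)^a$ is $L_e^a$ if $e$ ends at $v$ and $-R_e^a$ if $e$ starts at $v$. The holonomy $\hat g_\ell$ of a path $\ell$ is the path-ordered product of the link variables, with the first edge rightmost, and $(\hat g_{\rm Adj})_\ell^{ab}=\langle\tau_a,\mathrm{Ad}(\hat g_\ell)\tau_b\rangle$. Small gauge transformations $U(h)$,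 with $h_v=1$ for $v\in\mathcal B$, map $|g_e\rangle_e$ to $|h_f g_e h_i^{-1}\rangle_e$ for every edge $e$ from $i$ to $f$. The smooth physical states $\mathcal D_{\rm phys}$ are the functions in $C^\infty(G^E)$ that are invariant under all of them. Let $\Sigma$ be a region, disjoint from $\mathcal B$, with corner $\partial\Sigma$ and interior edges $\mathring\Sigma=\Sigma\setminus\partial\Sigma$, such that edges outside $\Sigma$ meet $\Sigma$ only in corner vertices. Assume that the corner is one-dimensional: the graph $\partial\Sigma$ is a single cycle. Write $W(v)$ for the loop that runs once around the corner, in a fixed direction, starting and ending at the corner vertex $v$. Assume also that every corner vertex is joined to $\mathcal B$ by a path of edges outside $\Sigma$. An intrinsic frame $\tilde\Phi$ is a spanning tree of $\partial\Sigma$. The intrinsic relational algebra $\mathcal A^{\rm phys}_{\Sigma\setminus\tilde\Phi|\tilde\Phi}$ consists of the restrictions to $\mathcal D_{\rm phys}$ of the linear operators on $C^\infty(G^E)$ that commute with all small gauge transformations, with multiplication by smooth functions of the links in $\tilde\Phi$ and of the links outside $\Sigma$, and with the translations $U_e(h),V_e(h)$ and the electric fields of the links $e$ outside $\Sigma$.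 Let $$\mathcal A_M=\bigcap_{\tilde\Phi}\mathcal A^{\rm phys}_{\Sigma\setminus\tilde\Phi|\tilde\Phi},\qquad Z_{1d}=\sum_{v\in\partial\Sigma}\mathrm{Tr}_\rho\big(\hat g_{W(v)}T^a_\rho\big)\sum_{e\ni v,\;e\in\mathring\Sigma}(\mathfrak G^v_e)^a .$$ Here and below, repeated Lie algebra indices are summed over. The generators are 1. the Wilson loops $\mathrm{Tr}_\rho\,\hat g_\gamma$ of closed paths $\gamma$ in $\Sigma$ (including $\partial\Sigma$); 2. the dressed pairs $(\mathfrak G^v_e)^a(\hat g_{\rm Adj})^{ab}_\ell(\mathfrak G^w_{e'})^b$, where $v,w$ are vertices of $\Sigma$, $e,e'\in\mathring\Sigma$ are edges incident to $v$ and $w$ respectively, and $\ell$ is a path in $\Sigma$ from $w$ to $v$. **Claim.** (a) $Z_{1d}$ commutes with every generator on $C^\infty(G^E)$. (b) Every generator preserves $\mathcal D_{\rm phys}$, and its restriction belongs to $\mathcal A_M$. (c) $Z_{1d}$ preserves $\mathcal D_{\rm phys}$, and its restriction lies in the center of $\mathcal A_M$: it belongs to $\mathcal A_M$ and commutes with every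 element of $\mathcal A_M$. (d) For every corner vertex $v_0$ and every choice of paths $\ell_v$ in $\partial\Sigma$ from $v$ to $v_0$, $$Z_{1d}=\sum_{v\in\partial\Sigma}\mathrm{Tr}_\rho\Big(\hat g_{W(v_0)}\,(\hat g_{\rm Adj})^{ba}_{\ell_v}\,T^b_\rho\Big)\sum_{e\ni v,\;e\in\mathring\Sigma}(\mathfrak G^v_e)^a .$$ -/

import Mathlib

open scoped Manifold ContDiff

set_option linter.unusedSectionVars false
set_option linter.style.haveILetI false

namespace LGT

section Smooth

variable {EG : Type*} [NormedAddCommGroup EG] [NormedSpace ℝ EG]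
  {H : Type*} [TopologicalSpace H] (I : ModelWithCorners ℝ EG H)
  {G : Type*} [TopologicalSpace G] [ChartedSpace H G]
  {E : Type*} [Fintype E]

noncomputable abbrev configModel (E : Type*) [Fintype E] : ModelWithCorners ℝ (E → EG) (ModelPi fun _ : E => H) :=
  ModelWithCorners.pi fun _ : E => I

lemma contMDiff_link (e : E) :
    ContMDiff (configModel I E) I ∞ (fun g : E → G => g e) := by
  intro g
  rw [contMDiffAt_iff]
  refine ⟨(continuous_apply e).continuousAt, ?_⟩
  have h : ContDiffWithinAt ℝ ∞ (fun y : E → EG => y e) (Set.range (configModel I E))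
      (extChartAt (configModel I E) g g) := contDiffWithinAt_pi.1 contDiffWithinAt_id e
  refine h.congr_of_eventuallyEq ?_ ?_
  · have := extChartAt_target_mem_nhdsWithin (I := configModel I E) g
    filter_upwards [this] with y hy
    refine (extChartAt I (g e)).right_inv ?_
    have h1 := (mem_extChartAt_target (I := configModel I E) g)
    rw [extChartAt, OpenPartialHomeomorph.extend_target'] at hy ⊢
    obtain ⟨z, hz, rfl⟩ := hy
    exact ⟨z e, hz e (Set.mem_univ e), rfl⟩
  · exact congrArg (extChartAt I (g e)) ((extChartAt I (g e)).left_inv (mem_extChartAt_source _))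

lemma contMDiff_config {EM HM M : Type*} [NormedAddCommGroup EM] [NormedSpace ℝ EM]
    [TopologicalSpace HM] {J : ModelWithCorners ℝ EM HM} [TopologicalSpace M] [ChartedSpace HM M]
    {f : M → E → G} (hf : ∀ e, ContMDiff J I ∞ (fun x => f x e)) :
    ContMDiff J (configModel I E) ∞ f := by
  intro x
  rw [contMDiffAt_iff]
  refine ⟨(continuous_pi fun e => (hf e).continuous).continuousAt, ?_⟩
  refine contDiffWithinAt_pi.2 fun e => ?_
  exact (contMDiffAt_iff.1 (hf e x)).2


theorem isManifold_config [IsManifold I ∞ G] : IsManifold (configModel I E) ∞ (E → G) := by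
  refine isManifold_of_contDiffOn _ _ _ ?_
  rintro _ _ ⟨e, he, rfl⟩ ⟨e', he', rfl⟩
  refine contDiffOn_pi.2 fun i => ?_
  have h := (contDiffGroupoid ∞ I).compatible (he i (Set.mem_univ i)) (he' i (Set.mem_univ i))
  rw [contDiffGroupoid, mem_groupoid_of_pregroupoid] at h
  have h' : ContDiffOn ℝ ∞ (I ∘ ((e i).symm ≫ₕ e' i) ∘ I.symm)
      (I.symm ⁻¹' ((e i).symm ≫ₕ e' i).source ∩ Set.range I) := h.1
  have hp : ContDiff ℝ ∞ (fun x : E → EG => x i) := contDiff_apply ℝ EG i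
  refine h'.comp hp.contDiffOn ?_
  rintro x ⟨⟨hx1, hx2⟩, z, rfl⟩
  exact ⟨⟨hx1 i (Set.mem_univ i), hx2 i (Set.mem_univ i)⟩, z i, rfl⟩
variable [Group G] [LieGroup I ∞ G]
lemma contMDiff_deriv {EM HM M : Type*} [NormedAddCommGroup EM] [NormedSpace ℝ EM]
    [TopologicalSpace HM] {J : ModelWithCorners ℝ EM HM} [TopologicalSpace M] [ChartedSpace HM M] [IsManifold J 1 M]
    {F : Type*} [NormedAddCommGroup F] [NormedSpace ℝ F]
    {f : M → G → F} (hf : ContMDiff (J.prod I) 𝓘(ℝ, F) ∞ (Function.uncurry f))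
    (ξ : EG) :
    ContMDiff J 𝓘(ℝ, F) ∞ (fun m => (mfderiv I 𝓘(ℝ, F) (f m) (1 : G) ξ : F)) := by
  have : IsManifold I ∞ G := inferInstance
  have : IsManifold I 1 G := IsManifold.of_le (n := ∞) (by simp)
  intro m
  have := ContMDiffAt.mfderiv_apply (x₀ := m) (n := ∞) (m := ∞) f (fun _ => (1:G)) id (fun _ => ξ) (hf _)
    contMDiffAt_const contMDiffAt_id contMDiffAt_const (by simp)
  refine this.congr_of_eventuallyEq (Filter.Eventually.of_forall fun y => ?_)
  have e := inTangentCoordinates_eq (I := I) (I' := 𝓘(ℝ, F)) (fun _ : M => (1 : G)) (fun x => f x 1)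
    (fun x => (mfderiv I 𝓘(ℝ, F) (f x) (1 : G) : EG →L[ℝ] F)) (x₀ := m) (x := y)
    (mem_chart_source H (1 : G)) (Set.mem_univ (f y 1))
  have h2 := (tangentBundleCore I G).coordChange_self (achart H (1 : G)) (1 : G)
    (mem_chart_source H (1 : G)) ξ
  have h3 := fun v => (tangentBundleCore 𝓘(ℝ, F) F).coordChange_self (achart F (f y 1)) (f y 1)
    (mem_chart_source F (f y 1)) v
  refine Eq.trans ?_ (congrArg (fun A : EG →L[ℝ] F => A ξ) e).symm
  refine Eq.trans ?_ (h3 _).symm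
  exact congrArg (fun v : EG => (mfderiv I 𝓘(ℝ, F) (f y) (1 : G) : EG →L[ℝ] F) v) h2.symm

lemma contMDiff_deriv' {EM HM M : Type*} [NormedAddCommGroup EM] [NormedSpace ℝ EM]
    [TopologicalSpace HM] {J : ModelWithCorners ℝ EM HM} [TopologicalSpace M] [ChartedSpace HM M] [IsManifold J 1 M]
    {f : M → G → G} (hf : ContMDiff (J.prod I) I ∞ (Function.uncurry f)) (h1 : ∀ m, f m 1 = 1)
    (ξ : EG) :
    ContMDiff J 𝓘(ℝ, EG) ∞ (fun m => (mfderiv I I (f m) (1 : G) ξ : EG)) := by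
  have : IsManifold I ∞ G := inferInstance
  have : IsManifold I 1 G := IsManifold.of_le (n := ∞) (by simp)
  intro m
  have := ContMDiffAt.mfderiv_apply (x₀ := m) (n := ∞) (m := ∞) f (fun _ => (1:G)) id (fun _ => ξ) (hf _)
    contMDiffAt_const contMDiffAt_id contMDiffAt_const (by simp)
  refine this.congr_of_eventuallyEq (Filter.Eventually.of_forall fun y => ?_)
  have e := inTangentCoordinates_eq (I := I) (I' := I) (fun _ : M => (1 : G)) (fun x => f x 1)
    (fun x => (mfderiv I I (f x) (1 : G) : EG →L[ℝ] EG)) (x₀ := m) (x := y)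
    (mem_chart_source H (1 : G)) (by simp [h1])
  have h2 := fun v => (tangentBundleCore I G).coordChange_self (achart H (1 : G)) (1 : G)
    (mem_chart_source H (1 : G)) v
  refine Eq.trans ?_ (congrArg (fun A : EG →L[ℝ] EG => A ξ) e).symm
  simp only [h1]
  refine Eq.trans ?_ (h2 _).symm
  exact congrArg (fun v : EG => (mfderiv I I (f y) (1 : G) : EG →L[ℝ] EG) v) (h2 ξ).symm



/-- The derivative at the unit of a function on the group, in the direction of the Lie algebra
element `ξ`; it equals `d/dt f(exp(tξ))` at `t = 0`. -/
noncomputable def unitDeriv (f : G → ℂ) (ξ : GroupLieAlgebra I G) : ℂ :=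
  mfderiv I 𝓘(ℝ, ℂ) f 1 ξ

lemma unitDeriv_add {f f' : G → ℂ} (h : MDifferentiableAt I 𝓘(ℝ, ℂ) f 1)
    (h' : MDifferentiableAt I 𝓘(ℝ, ℂ) f' 1) (ξ : GroupLieAlgebra I G) :
    unitDeriv I (fun x => f x + f' x) ξ = unitDeriv I f ξ + unitDeriv I f' ξ :=
  congrArg (fun A : EG →L[ℝ] ℂ => A ξ) (mfderiv_add h h')

lemma unitDeriv_const_mul {f : G → ℂ} (h : MDifferentiableAt I 𝓘(ℝ, ℂ) f 1) (c : ℂ)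
    (ξ : GroupLieAlgebra I G) :
    unitDeriv I (fun x => c * f x) ξ = c * unitDeriv I f ξ := by
  have h1 := h.hasMFDerivAt
  let A : EG →L[ℝ] ℂ := mfderiv I 𝓘(ℝ, ℂ) f 1
  let B : EG →L[ℝ] ℂ := c • A
  have h2 : HasMFDerivAt I 𝓘(ℝ, ℂ) (fun x => c * f x) 1 B :=
    ⟨continuousAt_const.mul h1.1, HasFDerivWithinAt.const_mul (𝕜 := ℝ) h1.2 c⟩
  exact congrArg (fun A : EG →L[ℝ] ℂ => A ξ) h2.mfderiv

lemma contMDiff_unitDeriv {EM HM M : Type*} [NormedAddCommGroup EM] [NormedSpace ℝ EM]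
    [TopologicalSpace HM] {J : ModelWithCorners ℝ EM HM} [TopologicalSpace M] [ChartedSpace HM M]
    [IsManifold J ∞ M]
    {f : M → G → ℂ} (hf : ContMDiff (J.prod I) 𝓘(ℝ, ℂ) ∞ (Function.uncurry f))
    (ξ : GroupLieAlgebra I G) :
    ContMDiff J 𝓘(ℝ, ℂ) ∞ (fun m => unitDeriv I (f m) ξ) := by
  have : IsManifold J 1 M := IsManifold.of_le (n := ∞) (by simp)
  exact contMDiff_deriv I hf ξ

end Smooth

section Lattice

/-- An oriented lattice without self-loops, with vertices `V`, edges `E`, and a set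
`boundary` of vertices on the global boundary, where no Gauss law is imposed. -/
structure Lattice (V E : Type*) where
  src : E → V
  tgt : E → V
  src_ne_tgt : ∀ e, src e ≠ tgt e
  boundary : Set V

variable {V E : Type*} (Λ : Lattice V E)

/-- An edge together with a direction of traversal; `true` means along its orientation. -/
abbrev OrientedEdge (E : Type*) := E × Bool

namespace Lattice

/-- The vertex at which the traversal of an oriented edge starts. -/
def origin (d : OrientedEdge E) : V := if d.2 then Λ.src d.1 else Λ.tgt d.1

/-- The vertex at which the traversal of an oriented edge ends. -/
def target (d : OrientedEdge E) : V := if d.2 then Λ.tgt d.1 else Λ.src d.1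

/-- `Λ.IsPath v p w`: the list `p` of oriented edges, in the order of traversal, leads from `v`
to `w`. -/
def IsPath : V → List (OrientedEdge E) → V → Prop
  | v, [], w => v = w
  | v, d :: p, w => Λ.origin d = v ∧ IsPath (Λ.target d) p w

end Lattice

/-- All edges of the path `p` belong to `S`. -/
def PathIn (S : Set E) (p : List (OrientedEdge E)) : Prop := ∀ d ∈ p, d.1 ∈ S

/-- A region `Σ` of the lattice with its corner `∂Σ`. The corner separates the rest of the region
from the complement, and the region does not touch the global boundary. -/
structure Region (Λ : Lattice V E) where
  verts : Set V
  edges : Set E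
  cornerVerts : Set V
  cornerEdges : Set E
  src_mem : ∀ e ∈ edges, Λ.src e ∈ verts
  tgt_mem : ∀ e ∈ edges, Λ.tgt e ∈ verts
  cornerVerts_subset : cornerVerts ⊆ verts
  cornerEdges_subset : cornerEdges ⊆ edges
  corner_src_mem : ∀ e ∈ cornerEdges, Λ.src e ∈ cornerVerts
  corner_tgt_mem : ∀ e ∈ cornerEdges, Λ.tgt e ∈ cornerVerts
  src_separates : ∀ e, e ∉ edges → Λ.src e ∈ verts → Λ.src e ∈ cornerVerts
  tgt_separates : ∀ e, e ∉ edges → Λ.tgt e ∈ verts → Λ.tgt e ∈ cornerVerts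
  disjoint_boundary : Disjoint verts Λ.boundary

namespace Region

variable {Λ} (S : Region Λ)

/-- The edges of the interior `Σ̊ = Σ ∖ ∂Σ`. -/
def interiorEdges : Set E := S.edges \ S.cornerEdges

/-- The corner is one-dimensional: the graph `∂Σ` is a single cycle, and the list `W` traverses it
once, visiting every corner vertex and every corner edge exactly once. -/
structure IsCornerCycle (W : List (OrientedEdge E)) : Prop where
  closed : ∃ v, Λ.IsPath v W v
  ne_nil : W ≠ []
  nodup_verts : (W.map Λ.origin).Nodup
  nodup_edges : (W.map Prod.fst).Nodup
  verts_eq : S.cornerVerts = {v | v ∈ W.map Λ.origin}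
  edges_eq : S.cornerEdges = {e | e ∈ W.map Prod.fst}

/-- A spanning tree of the corner graph `∂Σ`: a connected spanning subgraph with one edge less than
there are vertices. Such trees are the intrinsic quantum reference frames; the choice of a root does
not influence the associated algebra. -/
structure IsSpanningTree (T : Set E) : Prop where
  subset : T ⊆ S.cornerEdges
  connected : ∀ v ∈ S.cornerVerts, ∀ w ∈ S.cornerVerts, ∃ p, Λ.IsPath v p w ∧ PathIn T p
  card : T.ncard + 1 = S.cornerVerts.ncard

/-- Every corner vertex is joined to the global boundary by a Wilson line outside the region. -/
def IsAnchored : Prop :=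
  ∀ v ∈ S.cornerVerts, ∃ b ∈ Λ.boundary, ∃ p, Λ.IsPath b p v ∧ PathIn S.edgesᶜ p

end Region

end Lattice

noncomputable section Operators

variable {EG : Type*} [NormedAddCommGroup EG] [NormedSpace ℝ EG]
  {H : Type*} [TopologicalSpace H] (I : ModelWithCorners ℝ EG H)
  (G : Type*) [TopologicalSpace G] [ChartedSpace H G] [Group G]
  {V : Type*} (E : Type*) [Fintype E]

/-- The complex smooth functions on `G^E`, a dense subspace of the kinematical Hilbert space
`L²(G^E)`, on which link variables and electric fields act. -/
def Wave : Subalgebra ℂ ((E → G) → ℂ) where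
  carrier := {ψ | ContMDiff (configModel I E) 𝓘(ℝ, ℂ) ∞ ψ}
  mul_mem' h h' := contDiff_mul.comp_contMDiff (h.prodMk_space h')
  add_mem' h h' := h.add h'
  algebraMap_mem' _ := contMDiff_const

/-- Linear operators on smooth wave functions. -/
abbrev Op := Module.End ℂ (Wave I G E)

variable {G E}

/-- Multiplication by a smooth function of the link variables. -/
def mulOp (f : Wave I G E) : Op I G E := LinearMap.mulLeft ℂ f

variable [LieGroup I ∞ G]


/-- Composition with a smooth transformation of the configurations. -/
def compOp (F : (E → G) → E → G) (hF : ∀ e, ContMDiff (configModel I E) I ∞ fun g => F g e) :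
    Op I G E where
  toFun ψ := ⟨fun g => ψ.1 (F g), ψ.2.comp (contMDiff_config I hF)⟩
  map_add' _ _ := rfl
  map_smul' _ _ := rfl

/-- Derivative along a smooth family `F x`, `x ∈ G`, of transformations of the configurations. -/
def derivOp (F : G → (E → G) → E → G)
    (hF : ∀ e, ContMDiff ((configModel I E).prod I) I ∞ fun q : (E → G) × G => F q.2 q.1 e)
    (ξ : GroupLieAlgebra I G) : Op I G E where
  toFun ψ := ⟨fun g => -Complex.I * unitDeriv I (fun x => ψ.1 (F x g)) ξ, by
    have := isManifold_config I (G := G) (E := E)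
    have h : ContMDiff ((configModel I E).prod I) 𝓘(ℝ, ℂ) ∞
        (Function.uncurry fun (g : E → G) (x : G) => ψ.1 (F x g)) :=
      ψ.2.comp (contMDiff_config I hF)
    exact contDiff_mul.comp_contMDiff (contMDiff_const.prodMk_space (contMDiff_unitDeriv I h ξ))⟩
  map_add' ψ φ := by
    have h : ∀ (ψ : Wave I G E) g, MDifferentiableAt I 𝓘(ℝ, ℂ) (fun x => ψ.1 (F x g)) 1 :=
      fun ψ g => ((ψ.2.comp (contMDiff_config I hF)).comp
        (contMDiff_const.prodMk contMDiff_id : ContMDiff I _ ∞ fun x : G => (g, x))).mdifferentiable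
          (by simp) 1
    ext g
    exact (congrArg (-Complex.I * ·) (unitDeriv_add I (h ψ g) (h φ g) ξ)).trans (mul_add _ _ _)
  map_smul' c ψ := by
    have h : ∀ (ψ : Wave I G E) g, MDifferentiableAt I 𝓘(ℝ, ℂ) (fun x => ψ.1 (F x g)) 1 :=
      fun ψ g => ((ψ.2.comp (contMDiff_config I hF)).comp
        (contMDiff_const.prodMk contMDiff_id : ContMDiff I _ ∞ fun x : G => (g, x))).mdifferentiable
          (by simp) 1
    ext g
    exact (congrArg (-Complex.I * ·) (unitDeriv_const_mul I (h ψ g) c ξ)).trans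
      (mul_left_comm _ _ _)

open scoped Classical in
lemma contMDiff_update {EM HM M : Type*} [NormedAddCommGroup EM] [NormedSpace ℝ EM]
    [TopologicalSpace HM] {J : ModelWithCorners ℝ EM HM} [TopologicalSpace M] [ChartedSpace HM M]
    {f : M → E → G} (hf : ∀ e, ContMDiff J I ∞ fun m => f m e) (e : E) {u : M → G}
    (hu : ContMDiff J I ∞ u) (e' : E) :
    ContMDiff J I ∞ fun m => Function.update (f m) e (u m) e' := by
  by_cases h : e' = e
  · subst h; simpa using hu
  · simpa [Function.update_of_ne h] using hf e'

open scoped Classical in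
/-- Left translation `U_e(h)` on the link `e`, with `U_e(h)|g⟩ = |h g⟩`. -/
def leftTranslation (e : E) (h : G) : Op I G E :=
  compOp I (fun g => Function.update g e (h⁻¹ * g e))
    (contMDiff_update I (contMDiff_link I) e (contMDiff_const.mul (contMDiff_link I e)))

open scoped Classical in
/-- Right translation `V_e(h)` on the link `e`, with `V_e(h)|g⟩ = |g h⁻¹⟩`. -/
def rightTranslation (e : E) (h : G) : Op I G E :=
  compOp I (fun g => Function.update g e (g e * h))
    (contMDiff_update I (contMDiff_link I) e ((contMDiff_link I e).mul contMDiff_const))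

open scoped Classical in
/-- The left electric field on the link `e` for the generator `T` with `ξ = iT`: the operator with
`U_e(exp(tξ)) = exp(-itL_e)`, so that `[L_e, ĝ_e] = T_ρ ĝ_e`. -/
def leftField (e : E) (ξ : GroupLieAlgebra I G) : Op I G E :=
  derivOp I (fun x g => Function.update g e (x * g e))
    (contMDiff_update I (fun e' => (contMDiff_link I e').comp contMDiff_fst) e
      (contMDiff_snd.mul ((contMDiff_link I e).comp contMDiff_fst))) ξ

open scoped Classical in
/-- The right electric field on the link `e` for the generator `T` with `ξ = iT`: the operator with
`V_e(exp(tξ)) = exp(itR_e)`, so that `[R_e, ĝ_e] = ĝ_e T_ρ`. -/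
def rightField (e : E) (ξ : GroupLieAlgebra I G) : Op I G E :=
  derivOp I (fun x g => Function.update g e (g e * x))
    (contMDiff_update I (fun e' => (contMDiff_link I e').comp contMDiff_fst) e
      (((contMDiff_link I e).comp contMDiff_fst).mul contMDiff_snd)) ξ

open scoped Classical in
/-- The electric field `𝔊^v_e`: it is `L_e` if `e` ends at `v`, and `-R_e` if `e` starts at `v`. -/
def flux (Λ : Lattice V E) (v : V) (e : E) (ξ : GroupLieAlgebra I G) : Op I G E :=
  if Λ.tgt e = v then leftField I e ξ else if Λ.src e = v then -rightField I e ξ else 0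

/-- The gauge transformation `U(h) = ∏_v U_v(h_v)`, under which `|g_e⟩` becomes
`|h_{tgt e} g_e h_{src e}⁻¹⟩`. -/
def gaugeOp (Λ : Lattice V E) (h : V → G) : Op I G E :=
  compOp I (fun g e => (h (Λ.tgt e))⁻¹ * g e * h (Λ.src e))
    fun e => (contMDiff_const.mul (contMDiff_link I e)).mul contMDiff_const

/-- Small gauge transformations are trivial on the global boundary. -/
def IsSmall (Λ : Lattice V E) (h : V → G) : Prop := ∀ v ∈ Λ.boundary, h v = 1

/-- The smooth physical states: those invariant under all small gauge transformations. -/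
def Phys (Λ : Lattice V E) : Submodule ℂ (Wave I G E) where
  carrier := {ψ | ∀ h : V → G, IsSmall Λ h → gaugeOp I Λ h ψ = ψ}
  add_mem' hψ hφ h hh := by rw [map_add, hψ h hh, hφ h hh]
  zero_mem' h _ := map_zero _
  smul_mem' c ψ hψ h hh := by rw [map_smul, hψ h hh]

/-- The group element of an oriented edge. -/
def linkVar (g : E → G) (d : OrientedEdge E) : G := if d.2 then g d.1 else (g d.1)⁻¹

/-- The holonomy along a path: the path-ordered product, with the first edge rightmost. -/
def holonomy (g : E → G) : List (OrientedEdge E) → G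
  | [] => 1
  | d :: p => holonomy g p * linkVar g d

lemma contMDiff_holonomy (p : List (OrientedEdge E)) :
    ContMDiff (configModel I E) I ∞ fun g : E → G => holonomy g p := by
  induction p with
  | nil => exact contMDiff_const
  | cons d p ih =>
    refine ih.mul ?_
    unfold linkVar
    split
    · exact contMDiff_link I d.1
    · exact (contMDiff_link I d.1).inv

variable (G) in
/-- A smooth finite-dimensional matrix representation of `G`. -/
structure SmoothRep (d : ℕ) where
  toHom : G →* Matrix (Fin d) (Fin d) ℂ
  smooth : ∀ i j, ContMDiff I 𝓘(ℝ, ℂ) ∞ fun g => toHom g i j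

/-- The generator `T_ρ` in the representation `ρ`, where `ξ = iT`: the matrix with
`ρ(exp(tξ)) = exp(itT_ρ)`. -/
def SmoothRep.generator {I : ModelWithCorners ℝ EG H} {d : ℕ} (ρ : SmoothRep I G d)
    (ξ : GroupLieAlgebra I G) : Matrix (Fin d) (Fin d) ℂ :=
  Matrix.of fun i j => -Complex.I * unitDeriv I (fun g => ρ.toHom g i j) ξ

/-- The function `Tr(ρ(g_p) A)` of the holonomy along `p`. -/
def traceFun {d : ℕ} (ρ : SmoothRep I G d) (p : List (OrientedEdge E))
    (A : Matrix (Fin d) (Fin d) ℂ) : Wave I G E :=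
  ⟨fun g => (ρ.toHom (holonomy g p) * A).trace, by
    have h : (fun g : E → G => (ρ.toHom (holonomy g p) * A).trace) =
        ∑ i, ∑ j, (fun g : E → G => ρ.toHom (holonomy g p) i j) * fun _ => A j i := by
      ext g
      simp [Matrix.trace, Matrix.mul_apply]
    rw [h]
    refine sum_mem fun i _ => sum_mem fun j _ => mul_mem ?_ contMDiff_const
    exact (ρ.smooth i j).comp (contMDiff_holonomy I p)⟩

/-- The adjoint action of `g` on the Lie algebra: the derivative at `1` of `x ↦ g x g⁻¹`. -/
def Ad (g : G) : GroupLieAlgebra I G → GroupLieAlgebra I G :=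
  (mfderiv I I (fun x : G => g * x * g⁻¹) 1 : EG →L[ℝ] EG)

variable {ι : Type*} [Fintype ι]

/-- The matrix element `(ĝ_Adj)^{ab}` of the holonomy along `p` in the adjoint representation, in
the basis `τ` of the Lie algebra: the coefficient of `τ a` in `Ad(g_p) τ b`. -/
def adjFun (τ : Module.Basis ι ℝ (GroupLieAlgebra I G)) (a b : ι) (p : List (OrientedEdge E)) :
    Wave I G E :=
  ⟨fun g => ((τ.repr (Ad I (holonomy g p) (τ b)) a : ℝ) : ℂ), by
    have := isManifold_config I (G := G) (E := E)
    have : IsManifold (configModel I E) 1 (E → G) := IsManifold.of_le (n := ∞) (by simp)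
    have : FiniteDimensional ℝ EG := Module.Finite.of_basis (M := GroupLieAlgebra I G) τ
    have hp := (contMDiff_holonomy I p).comp
      (contMDiff_fst : ContMDiff ((configModel I E).prod I) (configModel I E) ∞
        (Prod.fst : (E → G) × G → E → G))
    have h := contMDiff_deriv' I (J := configModel I E)
      (f := fun (g : E → G) (x : G) => holonomy g p * x * (holonomy g p)⁻¹)
      ((hp.mul contMDiff_snd).mul hp.inv) (fun g => by simp) (τ b)
    let l : EG →ₗ[ℝ] ℝ := τ.coord a
    have hl : ContDiff ℝ ∞ fun v : EG => ((l v : ℝ) : ℂ) :=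
      Complex.ofRealCLM.contDiff.comp l.toContinuousLinearMap.contDiff
    exact hl.comp_contMDiff h⟩

/-- The Wilson loop `Tr_ρ ĝ_p`. -/
def wilsonLoop {d : ℕ} (ρ : SmoothRep I G d) (p : List (OrientedEdge E)) : Op I G E :=
  mulOp I (traceFun I ρ p 1)

/-- The dressed pair of electric fields `(𝔊^v_e)^a (ĝ_Adj)_p^{ab} (𝔊^w_{e'})^b`, where the Wilson
line `p` leads from `w` to `v`. -/
def dressedPair (Λ : Lattice V E) (τ : Module.Basis ι ℝ (GroupLieAlgebra I G)) (v : V) (e : E)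
    (p : List (OrientedEdge E)) (w : V) (e' : E) : Op I G E :=
  ∑ a, ∑ b, flux I Λ v e (τ a) * mulOp I (adjFun I τ a b p) * flux I Λ w e' (τ b)

variable {Λ : Lattice V E} (S : Region Λ)

/-- The generators: Wilson loops supported on the region, and pairs of electric fields on interior
edges dressed by Wilson lines supported on the region. -/
def magneticGenerators {d : ℕ} (ρ : SmoothRep I G d)
    (τ : Module.Basis ι ℝ (GroupLieAlgebra I G)) : Set (Op I G E) :=
  {O | ∃ v ∈ S.verts, ∃ p, Λ.IsPath v p v ∧ PathIn S.edges p ∧ O = wilsonLoop I ρ p} ∪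
  {O | ∃ v ∈ S.verts, ∃ w ∈ S.verts, ∃ e ∈ S.interiorEdges, ∃ e' ∈ S.interiorEdges,
    (Λ.tgt e = v ∨ Λ.src e = v) ∧ (Λ.tgt e' = w ∨ Λ.src e' = w) ∧
    ∃ p, Λ.IsPath w p v ∧ PathIn S.edges p ∧ O = dressedPair I Λ τ v e p w e'}

open scoped Classical in
/-- The flux `∑_e 𝔊^v_e` into the vertex `v`, summed over the interior edges of the region. -/
def interiorFlux (v : V) (ξ : GroupLieAlgebra I G) : Op I G E :=
  ∑ e : E, if e ∈ S.interiorEdges then flux I Λ v e ξ else 0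

/-- The electric central element `Z_{1d}`. The corner loop based at the start `v` of the `i`-th
edge of `W` is `W(v) = W.rotate i`. -/
def electricCenter {d : ℕ} (ρ : SmoothRep I G d) (τ : Module.Basis ι ℝ (GroupLieAlgebra I G))
    (W : List (OrientedEdge E)) : Op I G E :=
  ∑ i : Fin W.length, ∑ a,
    mulOp I (traceFun I ρ (W.rotate i) (ρ.generator (τ a))) *
      interiorFlux I S (Λ.origin W[i]) (τ a)

/-- The same operator written with the corner loop based at one vertex `v₀`, the start of the `j`-th
edge of `W`, and adjoint parallel transporters along paths `p i` to `v₀`: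
`∑_v Tr_ρ(ĝ_{W(v₀)} (ĝ_Adj(v₀,v))^{ab} T^b) ∑_e (𝔊^v_e)^a`. -/
def electricCenterBased {d : ℕ} (ρ : SmoothRep I G d)
    (τ : Module.Basis ι ℝ (GroupLieAlgebra I G)) (W : List (OrientedEdge E)) (j : Fin W.length)
    (p : Fin W.length → List (OrientedEdge E)) : Op I G E :=
  ∑ i : Fin W.length, ∑ a,
    mulOp I (∑ b, traceFun I ρ (W.rotate j) (ρ.generator (τ b)) * adjFun I τ b a (p i)) *
      interiorFlux I S (Λ.origin W[i]) (τ a)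

/-- `f` is a function of the links in `F` only. -/
def DependsOn (F : Set E) (f : Wave I G E) : Prop :=
  ∀ g g' : E → G, (∀ e ∈ F, g e = g' e) → f.1 g = f.1 g'

/-- The relational observables describing `Σ ∖ T` relative to the intrinsic frame given by the
tree `T`, on kinematical states. They are the gauge-invariant operators that depend on the frame
only through its orientation, i.e. that commute with functions of the frame links, and that act
trivially on the links outside the region, i.e. that commute with all functions, translations and
electric fields of those links. At the level of bounded operators on `L²(G^E)` this is the invariant
part of `L^∞(G^T) ⊗ B(L²(G^{Σ∖T})) ⊗ 1`, whose elements are precisely the operators obtained by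
averaging `|g⟩⟨g|_T ⊗ f` over the gauge group. -/
def intrinsicKin (T : Set E) : Subalgebra ℂ (Op I G E) :=
  Subalgebra.centralizer ℂ
    ({O | ∃ f, DependsOn I (T ∪ S.edgesᶜ) f ∧ O = mulOp I f} ∪
     {O | ∃ e ∉ S.edges, (∃ h, O = leftTranslation I e h ∨ O = rightTranslation I e h) ∨
        ∃ ξ, O = leftField I e ξ ∨ O = rightField I e ξ} ∪
     {O | ∃ h, IsSmall Λ h ∧ O = gaugeOp I Λ h})

/-- The operator `O'` on physical states is the restriction of the kinematical operator `O`. -/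
def IsRestriction (O' : Module.End ℂ (Phys I (G := G) Λ)) (O : Op I G E) : Prop :=
  ∀ ψ : Phys I (G := G) Λ, ((O' ψ : Phys I (G := G) Λ) : Wave I G E) = O ψ

/-- The intrinsic relational algebra of the region on physical states, relative to the intrinsic
frame given by the tree `T`. -/
def intrinsicPhys (T : Set E) : Subalgebra ℂ (Module.End ℂ (Phys I (G := G) Λ)) where
  carrier := {O' | ∃ O ∈ intrinsicKin I S T, IsRestriction I O' O}
  mul_mem' := by
    rintro A' B' ⟨A, hA, hA'⟩ ⟨B, hB, hB'⟩
    refine ⟨A * B, mul_mem hA hB, fun ψ => ?_⟩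
    rw [Module.End.mul_apply, hA', hB', Module.End.mul_apply]
  add_mem' := by
    rintro A' B' ⟨A, hA, hA'⟩ ⟨B, hB, hB'⟩
    refine ⟨A + B, add_mem hA hB, fun ψ => ?_⟩
    rw [LinearMap.add_apply, Submodule.coe_add, hA', hB', LinearMap.add_apply]
  algebraMap_mem' c := ⟨algebraMap ℂ _ c, Subalgebra.algebraMap_mem _ c, fun _ => rfl⟩

/-- The magnetic center algebra `𝒜_M`: the intersection of all intrinsic relational algebras. -/
def magneticAlgebra : Subalgebra ℂ (Module.End ℂ (Phys I (G := G) Λ)) :=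
  ⨅ T : {T : Set E // S.IsSpanningTree T}, intrinsicPhys I S T.1

end Operators

end LGT

/-! Write `Z` for the electric center and `X_v^a = Tr_ρ(ĝ_{W(v)} T^a)`. Moving the base point of the
corner loop across a corner link conjugates its holonomy by that link. Hence `X` is a Lie algebra
valued field on the corner that is gauge covariant and covariantly constant along the corner
(`isCornerField`). These two properties, together with the dependence of `X` on corner links alone,
are all that parts (a) and (b) need from `X`; comparing base points along a path gives (d).

For (a), `Z = ∑_v X_v^a ∑_e (𝔊^v_e)^a` is a derivation acting as an infinitesimal gauge
transformation with parameter `X`. On the holonomy of a path in the region from `v` to `w` it gives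
`X_w r(g_p) - r(g_p) X_v` (`centerOp_holEntry`). On interior links this is the action of the
electric fields; on corner links `Z` acts trivially and the right side vanishes because `X` is
covariantly constant. Interior electric fields rotate in the adjoint representation
(`centerOp_mul_flux`). Thus closed traces are invariant, and so are dressed pairs, since the adjoint
generators are antisymmetric in an orthonormal basis (`commute_sum_sum`).

For (b), the generators and `Z` are built from electric fields of interior links and functions of
links of the region. They therefore commute with functions of all corner links and with everything
outside, whichever tree is the frame, and they are gauge invariant (`exists_restriction`).

For the centrality in (c), the Gauss law trades the interior flux at each corner vertex for minus
the corner and outer fluxes. The two ends of each corner link cancel because `X` is covariantly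
constant, so on physical states `Z = -∑_v X_v^a (outer flux)_v^a` (`centerOp_apply_phys`).
Transporting both factors to the global boundary along an outer path makes each invariant under
small gauge transformations (`sum_dressed`). The dressed flux lives on outer links, so it commutes
with every intrinsic algebra.

The dressed loop uses the whole cycle and is a function of no single tree. It factors, however, into
two boundary-to-boundary Wilson lines, one through a single corner link and one through the others,
each supported on a spanning tree and outer links. An element of `𝒜_M` is the restriction of a
kinematical operator commuting with the first line, and of a possibly different one commuting with
the second. The comparison must therefore be made on physical states (`commutesOnPhys_dressedLoop`),
and this is where the intersection over frames enters. -/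

namespace LGT

/-! ### Calculus of derivatives at the unit of the group -/

section UnitDerivative

variable {EG : Type*} [NormedAddCommGroup EG] [NormedSpace ℝ EG]
  {H : Type*} [TopologicalSpace H] (I : ModelWithCorners ℝ EG H)
  {G : Type*} [TopologicalSpace G] [ChartedSpace H G] [Group G] [LieGroup I ∞ G]

lemma unitDeriv_vec_add (f : G → ℂ) (ξ η : GroupLieAlgebra I G) :
    unitDeriv I f (ξ + η) = unitDeriv I f ξ + unitDeriv I f η :=
  map_add (mfderiv I 𝓘(ℝ, ℂ) f 1 : EG →L[ℝ] ℂ) _ _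

lemma unitDeriv_vec_smul (f : G → ℂ) (c : ℝ) (ξ : GroupLieAlgebra I G) :
    unitDeriv I f (c • ξ) = c * unitDeriv I f ξ :=
  (map_smul (mfderiv I 𝓘(ℝ, ℂ) f 1 : EG →L[ℝ] ℂ) c ξ).trans (Complex.real_smul)

/-- The derivative at the unit, as a linear map of the direction. -/
noncomputable def unitDerivLin (f : G → ℂ) : GroupLieAlgebra I G →ₗ[ℝ] ℂ where
  toFun := unitDeriv I f
  map_add' := unitDeriv_vec_add I f
  map_smul' c ξ := (unitDeriv_vec_smul I f c ξ).trans Complex.real_smul.symm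

lemma unitDeriv_eq_sum {ι : Type*} [Fintype ι] (τ : Module.Basis ι ℝ (GroupLieAlgebra I G))
    (f : G → ℂ) (ξ : GroupLieAlgebra I G) :
    unitDeriv I f ξ = ∑ a, ((τ.repr ξ a : ℝ) : ℂ) * unitDeriv I f (τ a) := by
  have h := congrArg (unitDerivLin I f) (τ.sum_repr ξ)
  rw [map_sum] at h
  refine h.symm.trans (Finset.sum_congr rfl fun a _ => ?_)
  exact unitDeriv_vec_smul I f _ _

lemma unitDeriv_const (c : ℂ) (ξ : GroupLieAlgebra I G) :
    unitDeriv I (fun _ : G => c) ξ = 0 := by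
  have h : (mfderiv I 𝓘(ℝ, ℂ) (fun _ : G => c) 1 : EG →L[ℝ] ℂ) = 0 := mfderiv_const
  exact congrArg (fun A : EG →L[ℝ] ℂ => A ξ) h

lemma unitDeriv_sum {κ : Type*} (s : Finset κ) {f : κ → G → ℂ}
    (hf : ∀ k, ContMDiff I 𝓘(ℝ, ℂ) ∞ (f k)) (ξ : GroupLieAlgebra I G) :
    unitDeriv I (fun x => ∑ k ∈ s, f k x) ξ = ∑ k ∈ s, unitDeriv I (f k) ξ := by
  classical
  induction s using Finset.induction_on with
  | empty => simpa using unitDeriv_const I 0 ξ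
  | insert k s hk ih =>
    simp only [Finset.sum_insert hk]
    rw [← ih]
    refine unitDeriv_add I ((hf k).mdifferentiable (by simp) 1) ?_ ξ
    have : ContMDiff I 𝓘(ℝ, ℂ) ∞ fun x => ∑ k ∈ s, f k x := contMDiff_finsetSum fun k _ => hf k
    exact this.mdifferentiable (by simp) 1

/-- Chain rule: `Ad` is the derivative of conjugation at `1`. The transformation laws of generators
and electric fields all come from this exchange. -/
lemma unitDeriv_conj {f : G → ℂ} (hf : ContMDiff I 𝓘(ℝ, ℂ) ∞ f) (k : G)
    (ξ : GroupLieAlgebra I G) :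
    unitDeriv I (fun x => f (k * x * k⁻¹)) ξ = unitDeriv I f (Ad I k ξ) := by
  have hc : ContMDiff I I ∞ fun x : G => k * x * k⁻¹ :=
    (contMDiff_const.mul contMDiff_id).mul contMDiff_const
  have h := mfderiv_comp_apply_of_eq (I := I) (I' := I) (I'' := 𝓘(ℝ, ℂ)) (x := (1 : G)) (y := 1)
    (g := f) (f := fun x : G => k * x * k⁻¹)
    (hf.mdifferentiable (by simp) 1) (hc.mdifferentiable (by simp) 1) (by simp) ξ
  exact h

lemma Ad_mul (k l : G) (ξ : GroupLieAlgebra I G) : Ad I (k * l) ξ = Ad I k (Ad I l ξ) := by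
  have hc : ∀ k : G, ContMDiff I I ∞ fun x : G => k * x * k⁻¹ := fun k =>
    (contMDiff_const.mul contMDiff_id).mul contMDiff_const
  have h := mfderiv_comp_apply_of_eq (I := I) (I' := I) (I'' := I) (x := (1 : G)) (y := 1)
    (g := fun x : G => k * x * k⁻¹) (f := fun x : G => l * x * l⁻¹)
    ((hc k).mdifferentiable (by simp) 1) ((hc l).mdifferentiable (by simp) 1) (by simp) ξ
  refine Eq.trans ?_ h
  have e : (fun x : G => k * l * x * (k * l)⁻¹) =
      (fun x : G => k * x * k⁻¹) ∘ fun x : G => l * x * l⁻¹ := by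
    funext x; simp [mul_assoc]
  unfold Ad
  rw [e]
  rfl

lemma Ad_one (ξ : GroupLieAlgebra I G) : Ad I 1 ξ = ξ := by
  have e : (fun x : G => 1 * x * 1⁻¹) = id := by funext x; simp
  unfold Ad
  rw [e]
  exact congrArg (fun A : EG →L[ℝ] EG => A ξ) (mfderiv_id (I := I) (x := (1 : G)))

lemma Ad_add (k : G) (ξ η : GroupLieAlgebra I G) : Ad I k (ξ + η) = Ad I k ξ + Ad I k η :=
  map_add (mfderiv I I (fun x : G => k * x * k⁻¹) 1 : EG →L[ℝ] EG) _ _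

lemma Ad_smul (k : G) (c : ℝ) (ξ : GroupLieAlgebra I G) : Ad I k (c • ξ) = c • Ad I k ξ :=
  map_smul (mfderiv I I (fun x : G => k * x * k⁻¹) 1 : EG →L[ℝ] EG) _ _

/-- Chain rule through `x ↦ (x, x)`. The Leibniz rule, the derivative of the inverse, and the
additivity of the fluxes into a vertex are all instances. -/
lemma unitDeriv_diag {h : G → G → ℂ}
    (hh : ContMDiff (I.prod I) 𝓘(ℝ, ℂ) ∞ (Function.uncurry h)) (ξ : GroupLieAlgebra I G) :
    unitDeriv I (fun x => h x x) ξ =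
      unitDeriv I (fun x => h x 1) ξ + unitDeriv I (fun x => h 1 x) ξ := by
  have hd : MDifferentiableAt (I.prod I) 𝓘(ℝ, ℂ) (Function.uncurry h) ((1 : G), (1 : G)) :=
    hh.mdifferentiable (by simp) _
  have h1 := mfderiv_comp_apply (I := I) (I' := I.prod I) (I'' := 𝓘(ℝ, ℂ)) (x := (1 : G))
    (g := Function.uncurry h) (f := fun x : G => (x, x)) hd
    (mdifferentiableAt_id.prodMk mdifferentiableAt_id) ξ
  have h2 : mfderiv I (I.prod I) (fun x : G => (x, x)) 1 ξ = ((ξ, ξ) : EG × EG) := by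
    have h3 := mfderiv_prodMk (I := I) (I' := I) (x := (1 : G)) mdifferentiableAt_id
      mdifferentiableAt_id
    refine (congrArg (fun A : EG →L[ℝ] EG × EG => A ξ) h3).trans ?_
    exact congrArg (fun A : EG →L[ℝ] EG => (A ξ, A ξ)) (mfderiv_id (I := I) (x := (1 : G)))
  have h4 := mfderiv_prod_eq_add_apply (v := ((ξ, ξ) : EG × EG)) hd
  refine h1.trans ((congrArg (mfderiv (I.prod I) 𝓘(ℝ, ℂ) (Function.uncurry h)
    ((1 : G), (1 : G)) : EG × EG →L[ℝ] ℂ) h2).trans h4)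

lemma unitDeriv_mul {f f' : G → ℂ} (hf : ContMDiff I 𝓘(ℝ, ℂ) ∞ f)
    (hf' : ContMDiff I 𝓘(ℝ, ℂ) ∞ f') (ξ : GroupLieAlgebra I G) :
    unitDeriv I (fun x => f x * f' x) ξ = unitDeriv I f ξ * f' 1 + f 1 * unitDeriv I f' ξ := by
  have hs : ContMDiff (I.prod I) 𝓘(ℝ, ℂ) ∞ (Function.uncurry fun x y => f x * f' y) :=
    contDiff_mul.comp_contMDiff
      ((hf.comp contMDiff_fst).prodMk_space (hf'.comp contMDiff_snd))
  rw [unitDeriv_diag I hs ξ]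
  simp only [mul_comm _ (f' 1)]
  rw [unitDeriv_const_mul I (hf.mdifferentiable (by simp) 1),
    unitDeriv_const_mul I (hf'.mdifferentiable (by simp) 1)]

/-- The function `f (x * y⁻¹)` is constant on the diagonal, so its two partial derivatives at the
unit are opposite. -/
lemma unitDeriv_inv {f : G → ℂ} (hf : ContMDiff I 𝓘(ℝ, ℂ) ∞ f) (ξ : GroupLieAlgebra I G) :
    unitDeriv I (fun x => f x⁻¹) ξ = -unitDeriv I f ξ := by
  have hs : ContMDiff (I.prod I) 𝓘(ℝ, ℂ) ∞ (Function.uncurry fun x y : G => f (x * y⁻¹)) :=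
    hf.comp (contMDiff_fst.mul contMDiff_snd.inv)
  have h := unitDeriv_diag I hs ξ
  simp only [mul_inv_cancel, inv_one, mul_one, one_mul] at h
  rw [unitDeriv_const] at h
  linear_combination -h

lemma unitDeriv_eq_fderiv [I.Boundaryless] {f : G → ℂ} (hf : ContMDiff I 𝓘(ℝ, ℂ) ∞ f)
    (ξ : GroupLieAlgebra I G) :
    unitDeriv I f ξ = fderiv ℝ (fun u : EG => f ((extChartAt I (1 : G)).symm u))
      (extChartAt I (1 : G) 1) ξ := by
  have h := (hf.mdifferentiable (by simp) 1).mfderiv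
  have h' : (mfderiv I 𝓘(ℝ, ℂ) f 1 : EG →L[ℝ] ℂ) =
      fderiv ℝ (fun u : EG => f ((extChartAt I (1 : G)).symm u)) (extChartAt I (1 : G) 1) := by
    refine h.trans ?_
    rw [I.range_eq_univ, fderivWithin_univ]
    rfl
  exact congrArg (fun A : EG →L[ℝ] ℂ => A ξ) h'

/-- Mixed derivatives at the unit commute. -/
lemma unitDeriv_swap [I.Boundaryless] {f : G → G → ℂ}
    (hf : ContMDiff (I.prod I) 𝓘(ℝ, ℂ) ∞ (Function.uncurry f)) (ξ η : GroupLieAlgebra I G) :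
    unitDeriv I (fun x => unitDeriv I (f x) η) ξ =
      unitDeriv I (fun y => unitDeriv I (fun x => f x y) ξ) η := by
  set φ := (extChartAt I (1 : G)) with hφ
  set o : EG := φ 1 with ho
  -- `K` is `f` read in the chart at `1` in both variables, so that the symmetry of the ordinary
  -- second derivative of `K` at `(o, o)` gives the claim.
  let K : EG × EG → ℂ := fun q => f (φ.symm q.1) (φ.symm q.2)
  have ht : φ.target ∈ nhds o := extChartAt_target_mem_nhds (I := I) (1 : G)
  have hto : IsOpen φ.target := isOpen_extChartAt_target (I := I) (1 : G)
  have hsym : ContMDiffOn 𝓘(ℝ, EG) I ∞ φ.symm φ.target := contMDiffOn_extChartAt_symm (1 : G)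
  have hK : ContDiffOn ℝ ∞ K (φ.target ×ˢ φ.target) := by
    rw [← contMDiffOn_iff_contDiffOn]
    have h1 : ContMDiffOn 𝓘(ℝ, EG × EG) I ∞ (fun q : EG × EG => φ.symm q.1)
        (φ.target ×ˢ φ.target) :=
      hsym.comp (contDiff_fst.contMDiff.contMDiffOn) fun q hq => hq.1
    have h2 : ContMDiffOn 𝓘(ℝ, EG × EG) I ∞ (fun q : EG × EG => φ.symm q.2)
        (φ.target ×ˢ φ.target) :=
      hsym.comp (contDiff_snd.contMDiff.contMDiffOn) fun q hq => hq.2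
    exact hf.comp_contMDiffOn (h1.prodMk h2)
  have hat : ∀ u ∈ φ.target, ∀ v ∈ φ.target, ContDiffAt ℝ ∞ K (u, v) := fun u hu v hv =>
    hK.contDiffAt ((hto.prod hto).mem_nhds ⟨hu, hv⟩)
  have hot : o ∈ φ.target := mem_of_mem_nhds ht
  have hx : ∀ x, ContMDiff I 𝓘(ℝ, ℂ) ∞ (f x) := fun x =>
    hf.comp (contMDiff_const.prodMk contMDiff_id)
  have hy : ∀ y, ContMDiff I 𝓘(ℝ, ℂ) ∞ fun x => f x y := fun y =>
    hf.comp (contMDiff_id.prodMk contMDiff_const)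
  have hxy : ContMDiff I 𝓘(ℝ, ℂ) ∞ fun x => unitDeriv I (f x) η := contMDiff_unitDeriv I hf η
  have hyx : ContMDiff I 𝓘(ℝ, ℂ) ∞ fun y => unitDeriv I (fun x => f x y) ξ :=
    contMDiff_unitDeriv I (f := fun y x => f x y)
      (hf.comp (contMDiff_snd.prodMk contMDiff_fst)) ξ
  have hsymm : φ.symm o = 1 := extChartAt_to_inv (I := I) (1 : G)
  have h2 : (1 : WithTop ℕ∞) + 1 ≤ ∞ := by
    rw [one_add_one_eq_two]; exact WithTop.coe_le_coe.2 le_top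
  have hfst : ∀ u v : EG, HasFDerivAt (fun u : EG => (u, v))
      ((ContinuousLinearMap.id ℝ EG).prod 0) u := fun u v =>
    (hasFDerivAt_id u).prodMk (hasFDerivAt_const v u)
  have hsnd : ∀ u v : EG, HasFDerivAt (fun v : EG => (u, v))
      ((0 : EG →L[ℝ] EG).prod (ContinuousLinearMap.id ℝ EG)) v := fun u v =>
    (hasFDerivAt_const u v).prodMk (hasFDerivAt_id v)
  have hK2 : DifferentiableAt ℝ (fderiv ℝ K) (o, o) :=
    ((hat o hot o hot).fderiv_right (m := 1) h2).differentiableAt (by simp)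
  -- The inner derivative agrees with a partial derivative of `K` only on the chart target, a
  -- neighbourhood of `o`, which is enough to differentiate once more at `o`.
  have e1 : (fun u => unitDeriv I (f (φ.symm u)) η) =ᶠ[nhds o]
      fun u => fderiv ℝ K (u, o) (0, η) := by
    filter_upwards [ht] with u hu
    rw [unitDeriv_eq_fderiv I (hx _)]
    have hd := ((hat u hu o hot).differentiableAt (by simp)).hasFDerivAt
    have := HasFDerivAt.comp (f := fun v : EG => (u, v)) o hd (hsnd u o)
    exact congrArg (fun A : EG →L[ℝ] ℂ => A η) this.fderiv
  have e2 : (fun v => unitDeriv I (fun x => f x (φ.symm v)) ξ) =ᶠ[nhds o]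
      fun v => fderiv ℝ K (o, v) (ξ, 0) := by
    filter_upwards [ht] with v hv
    rw [unitDeriv_eq_fderiv I (hy _)]
    have hd := ((hat o hot v hv).differentiableAt (by simp)).hasFDerivAt
    have := HasFDerivAt.comp (f := fun u : EG => (u, v)) o hd (hfst o v)
    exact congrArg (fun A : EG →L[ℝ] ℂ => A ξ) this.fderiv
  rw [unitDeriv_eq_fderiv I hxy, unitDeriv_eq_fderiv I hyx, ← hφ, ← ho, e1.fderiv_eq,
    e2.fderiv_eq]
  let ξ' : EG := ξ
  let η' : EG := η
  have d1 := ((ContinuousLinearMap.apply ℝ ℂ ((0 : EG), η')).hasFDerivAt).comp o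
    (HasFDerivAt.comp (f := fun u : EG => (u, o)) o hK2.hasFDerivAt (hfst o o))
  have d2 := ((ContinuousLinearMap.apply ℝ ℂ (ξ', (0 : EG))).hasFDerivAt).comp o
    (HasFDerivAt.comp (f := fun v : EG => (o, v)) o hK2.hasFDerivAt (hsnd o o))
  have h2' : minSmoothness ℝ 2 ≤ ∞ := by
    rw [minSmoothness_of_isRCLikeNormedField]; exact WithTop.coe_le_coe.2 le_top
  have hs := (hat o hot o hot).isSymmSndFDerivAt h2' (ξ', (0 : EG)) ((0 : EG), η')
  exact (congrArg (fun A : EG →L[ℝ] ℂ => A ξ) d1.fderiv).trans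
    (hs.trans (congrArg (fun A : EG →L[ℝ] ℂ => A η) d2.fderiv).symm)

end UnitDerivative

/-! ### Multiplication, composition and derivative operators, and when they commute -/

section OperatorCalculus

variable {EG : Type*} [NormedAddCommGroup EG] [NormedSpace ℝ EG]
  {H : Type*} [TopologicalSpace H] (I : ModelWithCorners ℝ EG H)
  {G : Type*} [TopologicalSpace G] [ChartedSpace H G] [Group G]
  {V : Type*} {E : Type*} [Fintype E]

lemma Op.ext_apply {A B : Op I G E} (h : ∀ ψ g, (A ψ).1 g = (B ψ).1 g) : A = B :=
  LinearMap.ext fun ψ => Subtype.ext (funext (h ψ))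

@[simp] lemma mulOp_apply (f ψ : Wave I G E) : mulOp I f ψ = f * ψ := rfl

lemma Wave.sum_val {κ : Type*} (s : Finset κ) (f : κ → Wave I G E) (g : E → G) :
    (∑ k ∈ s, f k).1 g = ∑ k ∈ s, (f k).1 g := by
  have h := map_sum (Wave I G E).val f s
  exact (congrFun h g).trans (Finset.sum_apply g s _)

lemma mulOp_mul (f f' : Wave I G E) : mulOp I (f * f') = mulOp I f * mulOp I f' :=
  LinearMap.ext fun ψ => mul_assoc f f' ψ

lemma mulOp_add (f f' : Wave I G E) : mulOp I (f + f') = mulOp I f + mulOp I f' :=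
  LinearMap.ext fun ψ => add_mul f f' ψ

lemma mulOp_zero : mulOp I (0 : Wave I G E) = 0 :=
  LinearMap.ext fun ψ => zero_mul ψ

lemma mulOp_smul (c : ℂ) (f : Wave I G E) : mulOp I (c • f) = c • mulOp I f :=
  LinearMap.ext fun ψ => smul_mul_assoc c f ψ

lemma mulOp_sum {κ : Type*} (s : Finset κ) (f : κ → Wave I G E) :
    mulOp I (∑ k ∈ s, f k) = ∑ k ∈ s, mulOp I (f k) := by
  refine LinearMap.ext fun ψ => ?_
  rw [LinearMap.sum_apply]
  exact Finset.sum_mul s f ψ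

lemma commute_mulOp (f f' : Wave I G E) : Commute (mulOp I f) (mulOp I f') := by
  rw [Commute, SemiconjBy, ← mulOp_mul, ← mulOp_mul, mul_comm]

variable [LieGroup I ∞ G]

section Deriv

variable {F F' : G → (E → G) → E → G}

lemma derivOp_apply
    (hF : ∀ e, ContMDiff ((configModel I E).prod I) I ∞ fun q : (E → G) × G => F q.2 q.1 e)
    (ξ : GroupLieAlgebra I G) (ψ : Wave I G E) (g : E → G) :
    (derivOp I F hF ξ ψ).1 g = -Complex.I * unitDeriv I (fun x => ψ.1 (F x g)) ξ := rfl

lemma contMDiff_joint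
    (hF : ∀ e, ContMDiff ((configModel I E).prod I) I ∞ fun q : (E → G) × G => F q.2 q.1 e)
    (ψ : Wave I G E) :
    ContMDiff ((configModel I E).prod I) 𝓘(ℝ, ℂ) ∞
      (fun q : (E → G) × G => ψ.1 (F q.2 q.1)) :=
  ψ.2.comp (contMDiff_config I hF)

lemma contMDiff_orbit
    (hF : ∀ e, ContMDiff ((configModel I E).prod I) I ∞ fun q : (E → G) × G => F q.2 q.1 e)
    (ψ : Wave I G E) (g : E → G) :
    ContMDiff I 𝓘(ℝ, ℂ) ∞ fun x => ψ.1 (F x g) :=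
  (contMDiff_joint I hF ψ).comp (contMDiff_const.prodMk contMDiff_id)

lemma contMDiff_orbit_pair
    (hF : ∀ e, ContMDiff ((configModel I E).prod I) I ∞ fun q : (E → G) × G => F q.2 q.1 e)
    (hF' : ∀ e, ContMDiff ((configModel I E).prod I) I ∞ fun q : (E → G) × G => F' q.2 q.1 e)
    (ψ : Wave I G E) (g : E → G) :
    ContMDiff (I.prod I) 𝓘(ℝ, ℂ) ∞ (Function.uncurry fun x y => ψ.1 (F' y (F x g))) := by
  have h : ContMDiff (I.prod I) (configModel I E) ∞ fun q : G × G => F q.1 g :=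
    (contMDiff_config I hF).comp (contMDiff_const.prodMk contMDiff_fst)
  exact (contMDiff_joint I hF' ψ).comp (h.prodMk contMDiff_snd)

lemma derivOp_mul
    (hF : ∀ e, ContMDiff ((configModel I E).prod I) I ∞ fun q : (E → G) × G => F q.2 q.1 e)
    (h1 : ∀ g, F 1 g = g) (ξ : GroupLieAlgebra I G) (f ψ : Wave I G E) :
    derivOp I F hF ξ (f * ψ) = derivOp I F hF ξ f * ψ + f * derivOp I F hF ξ ψ := by
  refine Subtype.ext (funext fun g => ?_)
  have h := unitDeriv_mul I (contMDiff_orbit I hF f g) (contMDiff_orbit I hF ψ g) ξ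
  rw [h1] at h
  change -Complex.I * unitDeriv I (fun x => f.1 (F x g) * ψ.1 (F x g)) ξ =
    -Complex.I * unitDeriv I (fun x => f.1 (F x g)) ξ * ψ.1 g +
      f.1 g * (-Complex.I * unitDeriv I (fun x => ψ.1 (F x g)) ξ)
  rw [h]
  ring

lemma derivOp_eq_zero
    (hF : ∀ e, ContMDiff ((configModel I E).prod I) I ∞ fun q : (E → G) × G => F q.2 q.1 e)
    {f : Wave I G E} (hf : ∀ x g, f.1 (F x g) = f.1 g)
    (ξ : GroupLieAlgebra I G) : derivOp I F hF ξ f = 0 := by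
  refine Subtype.ext (funext fun g => ?_)
  change -Complex.I * unitDeriv I (fun x => f.1 (F x g)) ξ = 0
  simp only [hf, unitDeriv_const, mul_zero]

lemma commute_derivOp_mulOp
    (hF : ∀ e, ContMDiff ((configModel I E).prod I) I ∞ fun q : (E → G) × G => F q.2 q.1 e)
    {f : Wave I G E} (hf : ∀ x g, f.1 (F x g) = f.1 g)
    (ξ : GroupLieAlgebra I G) : Commute (derivOp I F hF ξ) (mulOp I f) := by
  refine Op.ext_apply I fun ψ g => ?_
  change -Complex.I * unitDeriv I (fun x => f.1 (F x g) * ψ.1 (F x g)) ξ =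
    f.1 g * (-Complex.I * unitDeriv I (fun x => ψ.1 (F x g)) ξ)
  simp only [hf]
  rw [unitDeriv_const_mul I ((contMDiff_orbit I hF ψ g).mdifferentiable (by simp) 1)]
  ring

lemma commute_derivOp_compOp
    (hF : ∀ e, ContMDiff ((configModel I E).prod I) I ∞ fun q : (E → G) × G => F q.2 q.1 e)
    {K : (E → G) → E → G}
    (hK : ∀ e, ContMDiff (configModel I E) I ∞ fun g => K g e)
    (h : ∀ x g, F x (K g) = K (F x g)) (ξ : GroupLieAlgebra I G) :
    Commute (derivOp I F hF ξ) (compOp I K hK) := by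
  refine Op.ext_apply I fun ψ g => ?_
  change -Complex.I * unitDeriv I (fun x => ψ.1 (K (F x g))) ξ =
    -Complex.I * unitDeriv I (fun x => ψ.1 (F x (K g))) ξ
  simp only [h]

/-- When the transformations commute, both products are iterated derivatives of a single function of
`(x, y)`, taken in the two orders. -/
lemma commute_derivOp_derivOp
    (hF : ∀ e, ContMDiff ((configModel I E).prod I) I ∞ fun q : (E → G) × G => F q.2 q.1 e)
    (hF' : ∀ e, ContMDiff ((configModel I E).prod I) I ∞ fun q : (E → G) × G => F' q.2 q.1 e)
    [I.Boundaryless] (h : ∀ x y g, F x (F' y g) = F' y (F x g))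
    (ξ η : GroupLieAlgebra I G) :
    Commute (derivOp I F hF ξ) (derivOp I F' hF' η) := by
  have hmul : ∀ (D : G → G → ℂ) (hD : ContMDiff (I.prod I) 𝓘(ℝ, ℂ) ∞ (Function.uncurry D))
      (ξ η : GroupLieAlgebra I G),
      unitDeriv I (fun x => -Complex.I * unitDeriv I (D x) η) ξ =
        -Complex.I * unitDeriv I (fun x => unitDeriv I (D x) η) ξ := fun D hD ξ η =>
    unitDeriv_const_mul I ((contMDiff_unitDeriv I hD η).mdifferentiable (by simp) 1) _ ξ
  refine Op.ext_apply I fun ψ g => ?_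
  change -Complex.I * unitDeriv I (fun x => -Complex.I *
      unitDeriv I (fun y => ψ.1 (F' y (F x g))) η) ξ =
    -Complex.I * unitDeriv I (fun y => -Complex.I *
      unitDeriv I (fun x => ψ.1 (F x (F' y g))) ξ) η
  rw [hmul _ (contMDiff_orbit_pair I hF hF' ψ g), hmul _ (contMDiff_orbit_pair I hF' hF ψ g),
    unitDeriv_swap I (contMDiff_orbit_pair I hF hF' ψ g)]
  simp only [h]

end Deriv

lemma commute_compOp_mulOp {f : Wave I G E} {K : (E → G) → E → G}
    (hK : ∀ e, ContMDiff (configModel I E) I ∞ fun g => K g e) (hf : ∀ g, f.1 (K g) = f.1 g) :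
    Commute (compOp I K hK) (mulOp I f) := by
  refine Op.ext_apply I fun ψ g => ?_
  change f.1 (K g) * ψ.1 (K g) = f.1 g * ψ.1 (K g)
  rw [hf]

end OperatorCalculus

/-! ### Generators of matrix representations and the adjoint representation -/

section MatrixRepresentations

variable {EG : Type*} [NormedAddCommGroup EG] [NormedSpace ℝ EG]
  {H : Type*} [TopologicalSpace H] (I : ModelWithCorners ℝ EG H)
  {G : Type*} [TopologicalSpace G] [ChartedSpace H G] [Group G] [LieGroup I ∞ G]
  {V : Type*} {E : Type*} [Fintype E] {κ : Type*} [Fintype κ] [DecidableEq κ]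

/-- The generator of a matrix representation indexed by an arbitrary finite type. -/
noncomputable def matGen (r : G →* Matrix κ κ ℂ) (ξ : GroupLieAlgebra I G) : Matrix κ κ ℂ :=
  Matrix.of fun i j => -Complex.I * unitDeriv I (fun g => r g i j) ξ

lemma unitDeriv_rep (r : G →* Matrix κ κ ℂ) (ξ : GroupLieAlgebra I G) (i j : κ) :
    unitDeriv I (fun g => r g i j) ξ = Complex.I * matGen I r ξ i j := by
  simp [matGen, ← mul_assoc]

variable {r : G →* Matrix κ κ ℂ}

lemma contMDiff_rep_mul
    (hr : ∀ i j, ContMDiff I 𝓘(ℝ, ℂ) ∞ fun g => r g i j)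
    (A B : Matrix κ κ ℂ) (i j : κ) :
    ContMDiff I 𝓘(ℝ, ℂ) ∞ fun g => (A * r g * B) i j := by
  have h : ∀ g, (A * r g * B) i j = ∑ k, ∑ l, A i l * r g l k * B k j := fun g => by
    simp only [Matrix.mul_apply, Finset.sum_mul]
  simp only [h]
  exact contMDiff_finsetSum fun k _ => contMDiff_finsetSum fun l _ =>
    contDiff_mul.comp_contMDiff ((contDiff_mul.comp_contMDiff
      (contMDiff_const.prodMk_space (hr l k))).prodMk_space contMDiff_const)

lemma unitDeriv_rep_mul
    (hr : ∀ i j, ContMDiff I 𝓘(ℝ, ℂ) ∞ fun g => r g i j)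
    (A B : Matrix κ κ ℂ) (ξ : GroupLieAlgebra I G) (i j : κ) :
    unitDeriv I (fun g => (A * r g * B) i j) ξ =
      Complex.I * (A * matGen I r ξ * B) i j := by
  have h : ∀ M : Matrix κ κ ℂ, (A * M * B) i j = ∑ k, ∑ l, (A i l * B k j) * M l k := fun M => by
    simp only [Matrix.mul_apply, Finset.sum_mul]
    exact Finset.sum_congr rfl fun k _ => Finset.sum_congr rfl fun l _ => by ring
  have hs : ∀ k l, ContMDiff I 𝓘(ℝ, ℂ) ∞ fun g => (A i l * B k j) * r g l k := fun k l =>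
    contDiff_mul.comp_contMDiff (contMDiff_const.prodMk_space (hr l k))
  simp only [h]
  rw [unitDeriv_sum I _ fun k => contMDiff_finsetSum fun l _ => hs k l, Finset.mul_sum]
  refine Finset.sum_congr rfl fun k _ => ?_
  rw [unitDeriv_sum I _ (hs k), Finset.mul_sum]
  refine Finset.sum_congr rfl fun l _ => ?_
  rw [unitDeriv_const_mul I ((hr l k).mdifferentiable (by simp) 1), unitDeriv_rep]
  ring

/-- Differentiate `r (k x k⁻¹) = r k * r x * r k⁻¹` at `x = 1` in both ways. -/
lemma matGen_Ad
    (hr : ∀ i j, ContMDiff I 𝓘(ℝ, ℂ) ∞ fun g => r g i j)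
    (k : G) (ξ : GroupLieAlgebra I G) :
    matGen I r (Ad I k ξ) = r k * matGen I r ξ * r k⁻¹ := by
  ext i j
  have h1 := unitDeriv_conj I (hr i j) k ξ
  have h2 := unitDeriv_rep_mul I hr (r k) (r k⁻¹) ξ i j
  simp only [map_mul] at h1
  rw [h2, unitDeriv_rep] at h1
  exact (mul_left_cancel₀ Complex.I_ne_zero h1).symm

lemma matGen_eq_sum {ι : Type*} [Fintype ι] (τ : Module.Basis ι ℝ (GroupLieAlgebra I G))
    (ξ : GroupLieAlgebra I G) :
    matGen I r ξ = ∑ a, ((τ.repr ξ a : ℝ) : ℂ) • matGen I r (τ a) := by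
  ext i j
  simp only [Matrix.sum_apply, Matrix.smul_apply, matGen, Matrix.of_apply, smul_eq_mul]
  rw [unitDeriv_eq_sum I τ, Finset.mul_sum]
  exact Finset.sum_congr rfl fun a _ => by ring

/-- A matrix element of the holonomy along a path. -/
noncomputable def holEntry (hr : ∀ i j, ContMDiff I 𝓘(ℝ, ℂ) ∞ fun g => r g i j)
    (p : List (OrientedEdge E)) (i j : κ) : Wave I G E :=
  ⟨fun g => r (holonomy g p) i j, (hr i j).comp (contMDiff_holonomy I p)⟩

variable {ι : Type*} [Fintype ι] [DecidableEq ι] (τ : Module.Basis ι ℝ (GroupLieAlgebra I G))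

/-- The adjoint representation as a matrix representation in the basis `τ`. -/
noncomputable def adHom : G →* Matrix ι ι ℂ where
  toFun k := Matrix.of fun a b => ((τ.repr (Ad I k (τ b)) a : ℝ) : ℂ)
  map_one' := by
    ext a b
    simp only [Matrix.of_apply, Ad_one, Module.Basis.repr_self, Finsupp.single_apply,
      Matrix.one_apply, eq_comm (a := b)]
    split_ifs <;> simp
  map_mul' k l := by
    ext a b
    simp only [Matrix.mul_apply, Matrix.of_apply]
    rw [Ad_mul]
    let A : GroupLieAlgebra I G →ₗ[ℝ] GroupLieAlgebra I G :=
      { toFun := Ad I k, map_add' := Ad_add I k, map_smul' := Ad_smul I k }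
    have h : Ad I k (Ad I l (τ b)) = ∑ c, τ.repr (Ad I l (τ b)) c • Ad I k (τ c) := by
      have h1 := congrArg A (τ.sum_repr (Ad I l (τ b)))
      rw [map_sum] at h1
      exact h1.symm.trans (Finset.sum_congr rfl fun c _ => map_smul A _ _)
    rw [h, map_sum, Finsupp.finsetSum_apply, Complex.ofReal_sum]
    refine Finset.sum_congr rfl fun c _ => ?_
    rw [map_smul, Finsupp.smul_apply, smul_eq_mul, Complex.ofReal_mul, mul_comm]

lemma adHom_apply (k : G) (a b : ι) :
    adHom I τ k a b = ((τ.repr (Ad I k (τ b)) a : ℝ) : ℂ) := rfl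

lemma contMDiff_adHom (a b : ι) : ContMDiff I 𝓘(ℝ, ℂ) ∞ fun k => adHom I τ k a b := by
  have : IsManifold I 1 G := IsManifold.of_le (n := ∞) (by simp)
  have : FiniteDimensional ℝ EG := Module.Finite.of_basis (M := GroupLieAlgebra I G) τ
  have h := contMDiff_deriv' I (J := I) (f := fun (k x : G) => k * x * k⁻¹)
    ((contMDiff_fst.mul contMDiff_snd).mul contMDiff_fst.inv) (fun k => by simp) (τ b)
  let l : EG →ₗ[ℝ] ℝ := τ.coord a
  have hl : ContDiff ℝ ∞ fun v : EG => ((l v : ℝ) : ℂ) :=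
    Complex.ofRealCLM.contDiff.comp l.toContinuousLinearMap.contDiff
  exact hl.comp_contMDiff h

lemma matGen_Ad_basis (k : G) (a : ι) :
    matGen I r (Ad I k (τ a)) = ∑ b, adHom I τ k b a • matGen I r (τ b) :=
  matGen_eq_sum I τ _

/-- The adjoint representation is orthogonal in an orthonormal basis. -/
lemma adHom_inv
    {κ' : LinearMap.BilinForm ℝ (GroupLieAlgebra I G)}
    (hκ : ∀ (g : G) (ξ η : GroupLieAlgebra I G), κ' (Ad I g ξ) (Ad I g η) = κ' ξ η)
    (hτ : ∀ a b, κ' (τ a) (τ b) = if a = b then 1 else 0)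
    (k : G) (a b : ι) : adHom I τ k⁻¹ a b = adHom I τ k b a := by
  -- Orthonormality turns coordinates into pairings with basis vectors. It is recorded separately
  -- for each slot of the form, without appeal to its symmetry.
  have hrepr : ∀ (ξ : GroupLieAlgebra I G) c, κ' (τ c) ξ = τ.repr ξ c := fun ξ c => by
    have h := congrArg (κ' (τ c)) (τ.sum_repr ξ)
    rw [← h, map_sum]
    simp only [map_smul, hτ, smul_eq_mul, mul_ite, mul_one, mul_zero]
    simp
  have hrepr' : ∀ (ξ : GroupLieAlgebra I G) c, κ' ξ (τ c) = τ.repr ξ c := fun ξ c => by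
    have h := congrArg (fun v => κ' v (τ c)) (τ.sum_repr ξ)
    rw [← h, map_sum]
    simp only [LinearMap.sum_apply, map_smul, LinearMap.smul_apply, hτ, smul_eq_mul, mul_ite,
      mul_one, mul_zero]
    simp
  rw [adHom_apply, adHom_apply, ← hrepr, ← hrepr', ← hκ k, ← Ad_mul, mul_inv_cancel, Ad_one]

/-- The derivative at the unit of the orthogonality relation `Ad(x⁻¹) = Ad(x)ᵀ`. -/
lemma matGen_adHom_antisymm
    {κ' : LinearMap.BilinForm ℝ (GroupLieAlgebra I G)}
    (hκ : ∀ (g : G) (ξ η : GroupLieAlgebra I G), κ' (Ad I g ξ) (Ad I g η) = κ' ξ η)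
    (hτ : ∀ a b, κ' (τ a) (τ b) = if a = b then 1 else 0)
    (ξ : GroupLieAlgebra I G) (a b : ι) :
    matGen I (adHom I τ) ξ a b = -matGen I (adHom I τ) ξ b a := by
  have h := unitDeriv_inv I (contMDiff_adHom I τ a b) ξ
  simp only [adHom_inv I τ hκ hτ] at h
  simp only [matGen, Matrix.of_apply]
  rw [h]
  ring

end MatrixRepresentations

/-! ### Electric fields: algebra, gauge covariance and the Gauss law -/

section Flux

variable {EG : Type*} [NormedAddCommGroup EG] [NormedSpace ℝ EG]
  {H : Type*} [TopologicalSpace H] (I : ModelWithCorners ℝ EG H)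
  {G : Type*} [TopologicalSpace G] [ChartedSpace H G] [Group G]
  {V : Type*} {E : Type*} [Fintype E] (Λ : Lattice V E)

open scoped Classical in
/-- The action of the group at the vertex `v` on the single link `e`. -/
noncomputable def fluxAct (v : V) (e : E) (x : G) (g : E → G) : E → G :=
  Function.update g e
    (if Λ.tgt e = v then x * g e else if Λ.src e = v then g e * x⁻¹ else g e)

lemma fluxAct_of_ne {v : V} {e e' : E} (h : e' ≠ e) (x : G) (g : E → G) :
    fluxAct Λ v e x g e' = g e' := by
  classical
  exact Function.update_of_ne h _ _

open scoped Classical in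
lemma fluxAct_self (v : V) (e : E) (x : G) (g : E → G) :
    fluxAct Λ v e x g e =
      if Λ.tgt e = v then x * g e else if Λ.src e = v then g e * x⁻¹ else g e := by
  simp [fluxAct]

lemma fluxAct_one (v : V) (e : E) (g : E → G) : fluxAct Λ v e 1 g = g := by
  funext e'
  by_cases h : e' = e
  · subst h; simp [fluxAct_self]
  · exact fluxAct_of_ne Λ h _ _

lemma fluxAct_mul (v : V) (e : E) (x y : G) (g : E → G) :
    fluxAct Λ v e (x * y) g = fluxAct Λ v e x (fluxAct Λ v e y g) := by
  funext e'
  by_cases h : e' = e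
  · subst h
    simp only [fluxAct_self]
    split_ifs <;> simp [mul_assoc]
  · simp only [fluxAct_of_ne Λ h]

/-- Different links are independent, and at the two ends of one link the actions are left and right
multiplication, which commute. -/
lemma fluxAct_comm {v w : V} {e e' : E} (h : ¬(v = w ∧ e = e')) (x y : G) (g : E → G) :
    fluxAct Λ v e x (fluxAct Λ w e' y g) = fluxAct Λ w e' y (fluxAct Λ v e x g) := by
  funext e''
  by_cases h1 : e'' = e
  · subst h1
    by_cases h2 : e'' = e'
    · subst h2
      simp only [fluxAct_self]
      split_ifs <;> simp_all [mul_assoc]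
    · simp only [fluxAct_self, fluxAct_of_ne Λ h2]
  · by_cases h2 : e'' = e'
    · subst h2
      simp only [fluxAct_self, fluxAct_of_ne Λ h1]
    · simp only [fluxAct_of_ne Λ h1, fluxAct_of_ne Λ h2]

variable [LieGroup I ∞ G]

lemma contMDiff_fluxAct (v : V) (e e' : E) :
    ContMDiff ((configModel I E).prod I) I ∞
      fun q : (E → G) × G => fluxAct Λ v e q.2 q.1 e' := by
  have hg : ∀ e, ContMDiff ((configModel I E).prod I) I ∞ fun q : (E → G) × G => q.1 e :=
    fun e => (contMDiff_link I e).comp contMDiff_fst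
  refine contMDiff_update I hg e ?_ e'
  split_ifs
  · exact contMDiff_snd.mul (hg e)
  · exact (hg e).mul contMDiff_snd.inv
  · exact hg e

/-- The sign of `-R_e` is absorbed by letting `x` act by `x⁻¹` from the right at the source. Both
ends then carry a left action, and later arguments need not distinguish them. -/
lemma flux_eq_derivOp (v : V) (e : E) (ξ : GroupLieAlgebra I G) :
    flux I Λ v e ξ = derivOp I (fluxAct Λ v e) (contMDiff_fluxAct I Λ v e) ξ := by
  classical
  refine Op.ext_apply I fun ψ g => ?_
  rw [derivOp_apply, flux]
  unfold fluxAct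
  split_ifs with h1 h2
  · rfl
  · have hs : ContMDiff I 𝓘(ℝ, ℂ) ∞ fun x => ψ.1 (Function.update g e (g e * x)) :=
      ψ.2.comp (contMDiff_config I (contMDiff_update I (f := fun _ : G => g)
        (fun _ => contMDiff_const) e (contMDiff_const.mul contMDiff_id)))
    have h := unitDeriv_inv I hs ξ
    rw [h]
    change -(-Complex.I * unitDeriv I (fun x => ψ.1 (Function.update g e (g e * x))) ξ) = _
    ring
  · rw [unitDeriv_const, mul_zero]
    rfl

lemma flux_val (v : V) (e : E) (ξ : GroupLieAlgebra I G) (ψ : Wave I G E) (g : E → G) :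
    (flux I Λ v e ξ ψ).1 g = -Complex.I * unitDeriv I (fun x => ψ.1 (fluxAct Λ v e x g)) ξ := by
  rw [flux_eq_derivOp, derivOp_apply]

lemma flux_eq_sum {ι : Type*} [Fintype ι] (τ : Module.Basis ι ℝ (GroupLieAlgebra I G)) (v : V)
    (e : E) (ξ : GroupLieAlgebra I G) :
    flux I Λ v e ξ = ∑ a, ((τ.repr ξ a : ℝ) : ℂ) • flux I Λ v e (τ a) := by
  refine Op.ext_apply I fun ψ g => ?_
  rw [LinearMap.sum_apply, Wave.sum_val, flux_val, unitDeriv_eq_sum I τ, Finset.mul_sum]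
  refine Finset.sum_congr rfl fun a _ => ?_
  change _ = ((τ.repr ξ a : ℝ) : ℂ) * (flux I Λ v e (τ a) ψ).1 g
  rw [flux_val]
  ring

lemma flux_mul (v : V) (e : E) (ξ : GroupLieAlgebra I G) (f ψ : Wave I G E) :
    flux I Λ v e ξ (f * ψ) = flux I Λ v e ξ f * ψ + f * flux I Λ v e ξ ψ := by
  rw [flux_eq_derivOp, derivOp_mul I _ (fluxAct_one Λ v e)]

lemma flux_eq_zero {F : Set E} {f : Wave I G E} (hf : DependsOn I F f) {e : E} (he : e ∉ F)
    (v : V) (ξ : GroupLieAlgebra I G) : flux I Λ v e ξ f = 0 := by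
  rw [flux_eq_derivOp]
  refine derivOp_eq_zero I _ (fun x g => hf _ _ fun e' he' => ?_) ξ
  exact fluxAct_of_ne Λ (fun h : e' = e => he (h ▸ he')) x g

lemma commute_flux_mulOp {F : Set E} {f : Wave I G E} (hf : DependsOn I F f) {e : E}
    (he : e ∉ F) (v : V) (ξ : GroupLieAlgebra I G) :
    Commute (flux I Λ v e ξ) (mulOp I f) := by
  rw [flux_eq_derivOp]
  refine commute_derivOp_mulOp I _ (fun x g => hf _ _ fun e' he' => ?_) ξ
  exact fluxAct_of_ne Λ (fun h : e' = e => he (h ▸ he')) x g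

lemma flux_of_not_mem {v : V} {e : E} (h1 : Λ.tgt e ≠ v) (h2 : Λ.src e ≠ v)
    (ξ : GroupLieAlgebra I G) : flux I (G := G) Λ v e ξ = 0 := by
  simp [flux, h1, h2]

lemma commute_flux_flux [I.Boundaryless] {v w : V} {e e' : E} (h : ¬(v = w ∧ e = e'))
    (ξ η : GroupLieAlgebra I G) :
    Commute (flux I Λ v e ξ) (flux I Λ w e' η) := by
  rw [flux_eq_derivOp, flux_eq_derivOp]
  exact commute_derivOp_derivOp I _ _ (fluxAct_comm Λ h) ξ η

/-- The electric fields at one end of a link represent the Lie algebra. -/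
lemma flux_mul_flux [I.Boundaryless] {ι : Type*} [Fintype ι] [DecidableEq ι]
    (τ : Module.Basis ι ℝ (GroupLieAlgebra I G))
    {κ' : LinearMap.BilinForm ℝ (GroupLieAlgebra I G)}
    (hκ : ∀ (g : G) (ξ η : GroupLieAlgebra I G), κ' (Ad I g ξ) (Ad I g η) = κ' ξ η)
    (hτ : ∀ a b, κ' (τ a) (τ b) = if a = b then 1 else 0)
    (v : V) (e : E) (ξ : GroupLieAlgebra I G) (a : ι) :
    flux I Λ v e ξ * flux I Λ v e (τ a) = flux I Λ v e (τ a) * flux I Λ v e ξ +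
      ∑ k, matGen I (adHom I τ) ξ a k • flux I Λ v e (τ k) := by
  refine Op.ext_apply I fun ψ g => ?_
  -- Both products of fluxes are to be expressed through derivatives of this one function, in which
  -- `y` acts first and `x` second.
  let D : G → G → ℂ := fun x y => ψ.1 (fluxAct Λ v e x (fluxAct Λ v e y g))
  have hD : ContMDiff (I.prod I) 𝓘(ℝ, ℂ) ∞ (Function.uncurry D) :=
    (contMDiff_orbit_pair I (contMDiff_fluxAct I Λ v e) (contMDiff_fluxAct I Λ v e) ψ g).comp
      (contMDiff_snd.prodMk contMDiff_fst)
  have hD1 : ∀ x, ContMDiff I 𝓘(ℝ, ℂ) ∞ (D x) := fun x =>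
    hD.comp (contMDiff_const.prodMk contMDiff_id)
  have hDs : ∀ η, ContMDiff I 𝓘(ℝ, ℂ) ∞ fun x => unitDeriv I (D x) η := fun η =>
    contMDiff_unitDeriv I hD η
  have hA : ∀ k, ContMDiff I 𝓘(ℝ, ℂ) ∞ fun x => adHom I τ x⁻¹ k a := fun k =>
    (contMDiff_adHom I τ k a).comp (contMDiff_id.inv)
  -- Here the order is `y x = x (x⁻¹ y x)`, so restoring the order of `D` costs the adjoint action
  -- of `x⁻¹`. Its derivative at `x = 1` will be the commutator.
  have e1 : ∀ x, unitDeriv I (fun y => ψ.1 (fluxAct Λ v e y (fluxAct Λ v e x g))) (τ a) =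
      ∑ k, adHom I τ x⁻¹ k a * unitDeriv I (D x) (τ k) := fun x => by
    have h := unitDeriv_conj I (hD1 x) x⁻¹ (τ a)
    refine Eq.trans ?_ (h.trans (unitDeriv_eq_sum I τ _ _))
    congr 1
    funext y
    simp only [D, ← fluxAct_mul]
    group
  have e2 : ((flux I Λ v e ξ * flux I Λ v e (τ a)) ψ).1 g =
      -unitDeriv I (fun x => ∑ k, adHom I τ x⁻¹ k a * unitDeriv I (D x) (τ k)) ξ := by
    rw [Module.End.mul_apply, flux_val]
    simp only [flux_val, e1]
    rw [unitDeriv_const_mul I, ← mul_assoc]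
    · simp
    · have : ContMDiff I 𝓘(ℝ, ℂ) ∞
          fun x => ∑ k, adHom I τ x⁻¹ k a * unitDeriv I (D x) (τ k) :=
        contMDiff_finsetSum fun k _ =>
          contDiff_mul.comp_contMDiff ((hA k).prodMk_space (hDs (τ k)))
      exact this.mdifferentiable (by simp) 1
  -- The reversed product already has the group order of `D`; only the two differentiations have to
  -- be exchanged.
  have e3 : ((flux I Λ v e (τ a) * flux I Λ v e ξ) ψ).1 g =
      -unitDeriv I (fun x => unitDeriv I (D x) (τ a)) ξ := by
    rw [Module.End.mul_apply, flux_val]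
    simp only [flux_val]
    rw [unitDeriv_const_mul I, ← mul_assoc, unitDeriv_swap I hD]
    · simp [D]
    · have := contMDiff_unitDeriv I (f := fun y x => D x y)
        (hD.comp (contMDiff_snd.prodMk contMDiff_fst)) ξ
      exact this.mdifferentiable (by simp) 1
  -- Leibniz: differentiating the adjoint factor gives the structure constants, with antisymmetry
  -- undoing the sign of the inverse. Evaluating it at the unit gives the Kronecker delta, which
  -- selects the reversed product.
  have e4 : ∀ k, unitDeriv I (fun x => adHom I τ x⁻¹ k a * unitDeriv I (D x) (τ k)) ξ =
      -(matGen I (adHom I τ) ξ a k * (flux I Λ v e (τ k) ψ).1 g) +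
        (if k = a then 1 else 0) * unitDeriv I (fun x => unitDeriv I (D x) (τ k)) ξ := by
    intro k
    rw [unitDeriv_mul I (hA k) (hDs (τ k)), unitDeriv_inv I (contMDiff_adHom I τ k a), flux_val,
      matGen_adHom_antisymm I τ hκ hτ ξ a k]
    simp only [inv_one, map_one, Matrix.one_apply, unitDeriv_rep, D, fluxAct_one]
    ring
  have hAD : ∀ k, ContMDiff I 𝓘(ℝ, ℂ) ∞
      fun x => adHom I τ x⁻¹ k a * unitDeriv I (D x) (τ k) := fun k =>
    contDiff_mul.comp_contMDiff ((hA k).prodMk_space (hDs (τ k)))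
  rw [e2, unitDeriv_sum I _ hAD]
  simp only [e4, Finset.sum_add_distrib, ite_mul, one_mul, zero_mul, Finset.sum_ite_eq',
    Finset.mem_univ, if_true]
  rw [LinearMap.add_apply, LinearMap.sum_apply]
  change _ = ((flux I Λ v e (τ a) * flux I Λ v e ξ) ψ).1 g +
    (∑ k, (matGen I (adHom I τ) ξ a k • flux I Λ v e (τ k)) ψ).1 g
  rw [e3, Wave.sum_val, Finset.sum_neg_distrib, neg_add_rev, neg_neg]
  rfl

/-- The transformation of the configurations underlying a gauge transformation. -/
def gaugeAct (h : V → G) (g : E → G) : E → G :=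
  fun e => (h (Λ.tgt e))⁻¹ * g e * h (Λ.src e)

lemma gaugeOp_val (h : V → G) (ψ : Wave I G E) (g : E → G) :
    (gaugeOp I Λ h ψ).1 g = ψ.1 (gaugeAct Λ h g) := rfl

lemma gaugeOp_mul_mulOp (h : V → G) (f : Wave I G E) :
    gaugeOp I Λ h * mulOp I f = mulOp I (gaugeOp I Λ h f) * gaugeOp I Λ h := rfl

/-- At either end the factor of `h v` stands between `x` and the link variable, and moving `x` past
it conjugates `x`. -/
lemma fluxAct_gaugeAct (h : V → G) (v : V) (e : E) (x : G) (g : E → G) :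
    fluxAct Λ v e x (gaugeAct Λ h g) =
      gaugeAct Λ h (fluxAct Λ v e (h v * x * (h v)⁻¹) g) := by
  funext e'
  by_cases he : e' = e
  · subst he
    simp only [gaugeAct, fluxAct_self]
    split_ifs with h1 h2
    · subst h1; simp [mul_assoc]
    · subst h2; simp [mul_assoc]
    · rfl
  · simp only [gaugeAct, fluxAct_of_ne Λ he]

lemma gaugeOp_mul_flux (h : V → G) (v : V) (e : E) (ξ : GroupLieAlgebra I G) :
    gaugeOp I Λ h * flux I Λ v e ξ = flux I Λ v e (Ad I (h v) ξ) * gaugeOp I Λ h := by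
  refine Op.ext_apply I fun ψ g => ?_
  rw [Module.End.mul_apply, Module.End.mul_apply, gaugeOp_val, flux_val, flux_val]
  simp only [fluxAct_gaugeAct]
  exact congrArg (-Complex.I * ·) (unitDeriv_conj I
    (contMDiff_orbit I (contMDiff_fluxAct I Λ v e) (gaugeOp I Λ h ψ) g) (h v) ξ)

lemma gaugeOp_mul_flux_basis {ι : Type*} [Fintype ι] [DecidableEq ι]
    (τ : Module.Basis ι ℝ (GroupLieAlgebra I G)) (h : V → G) (v : V) (e : E) (a : ι) :
    gaugeOp I Λ h * flux I Λ v e (τ a) =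
      ∑ b, adHom I τ (h v) b a • (flux I Λ v e (τ b) * gaugeOp I Λ h) := by
  rw [gaugeOp_mul_flux, flux_eq_sum I Λ τ, Finset.sum_mul]
  simp only [smul_mul_assoc]
  rfl

/-- The fluxes into the two ends of a link are related by the adjoint action of the link. -/
lemma flux_tgt_val {ι : Type*} [Fintype ι] [DecidableEq ι]
    (τ : Module.Basis ι ℝ (GroupLieAlgebra I G)) (e : E) (a : ι) (ψ : Wave I G E) (g : E → G) :
    (flux I Λ (Λ.tgt e) e (τ a) ψ).1 g =
      -∑ b, adHom I τ (g e)⁻¹ b a * (flux I Λ (Λ.src e) e (τ b) ψ).1 g := by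
  have hs := contMDiff_orbit I (contMDiff_fluxAct I Λ (Λ.src e) e) ψ g
  have hsi : ContMDiff I 𝓘(ℝ, ℂ) ∞ fun x => ψ.1 (fluxAct Λ (Λ.src e) e x⁻¹ g) :=
    hs.comp contMDiff_id.inv
  -- From `x g = g (g⁻¹ x g)`: acting by `x` at the target is acting at the source by the inverse of
  -- `g⁻¹ x g`.
  have h : ∀ x, fluxAct Λ (Λ.tgt e) e x g =
      fluxAct Λ (Λ.src e) e ((g e)⁻¹ * x * (g e)⁻¹⁻¹)⁻¹ g := fun x => by
    funext e'
    by_cases he : e' = e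
    · subst he
      have := Λ.src_ne_tgt e'
      simp only [fluxAct_self, if_true, this.symm, if_false]
      group
    · simp only [fluxAct_of_ne Λ he]
  rw [flux_val]
  simp only [h]
  rw [unitDeriv_conj I hsi (g e)⁻¹ (τ a), unitDeriv_inv I hs, unitDeriv_eq_sum I τ]
  simp only [flux_val, mul_neg, Finset.mul_sum]
  congr 1
  refine Finset.sum_congr rfl fun b _ => ?_
  rw [adHom_apply]
  ring

open scoped Classical in
/-- The Gauss law: the total flux into an inner vertex vanishes on physical states. -/
lemma sum_flux_eq_zero {ψ : Wave I G E} (hψ : ψ ∈ Phys I Λ) {v : V} (hv : v ∉ Λ.boundary)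
    (ξ : GroupLieAlgebra I G) : ∑ e, flux I Λ v e ξ ψ = 0 := by
  -- The simultaneous action at `v` on the links in `s` interpolates between the identity and a
  -- gauge transformation at `v`. Induction on `s` adds one flux at a time.
  let A : Finset E → G → (E → G) → E → G := fun s x g e => if e ∈ s then fluxAct Λ v e x g e else g e
  have hA : ∀ s e, ContMDiff ((configModel I E).prod I) I ∞
      fun q : (E → G) × G => A s q.2 q.1 e := fun s e => by
    by_cases h : e ∈ s
    · simp only [A, h, if_true]
      exact contMDiff_fluxAct I Λ v e e
    · simp only [A, h, if_false]
      exact (contMDiff_link I e).comp contMDiff_fst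
  have key : ∀ s g, -Complex.I * unitDeriv I (fun x => ψ.1 (A s x g)) ξ =
      ∑ e ∈ s, (flux I Λ v e ξ ψ).1 g := by
    intro s g
    induction s using Finset.induction_on with
    | empty =>
      simp only [A, Finset.notMem_empty, if_false, Finset.sum_empty]
      rw [unitDeriv_const, mul_zero]
    | insert e s he ih =>
      have h1 : ∀ x, A (insert e s) x g = fluxAct Λ v e x (A s x g) := fun x => by
        funext e'
        by_cases h : e' = e
        · subst h; simp [A, fluxAct_self, he]
        · simp [A, fluxAct_of_ne Λ h, h]
      have h2 := unitDeriv_diag I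
        (contMDiff_orbit_pair I (contMDiff_fluxAct I Λ v e) (hA s) ψ g) ξ
      have h3 := unitDeriv_diag I
        (contMDiff_orbit_pair I (hA s) (contMDiff_fluxAct I Λ v e) ψ g) ξ
      have h4 : A s 1 g = g := by
        funext e'
        simp [A, fluxAct_one]
      simp only [h4, fluxAct_one] at h3
      rw [Finset.sum_insert he, ← ih, flux_val]
      simp only [h1]
      rw [h3]
      ring
  refine Subtype.ext (funext fun g => ?_)
  rw [Wave.sum_val, ← key]
  have hinv : ∀ x, ψ.1 (A Finset.univ x g) = ψ.1 g := fun x => by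
    -- The inverse appears because gauge transformations act on wave functions through the inverse
    -- transformation of the configuration. The choice is small because `v` is off the boundary.
    let h : V → G := Function.update 1 v x⁻¹
    have hh : IsSmall Λ h := fun w hw => by
      have : w ≠ v := fun e => hv (e ▸ hw)
      simp [h, this]
    have h1 := congrFun (congrArg Subtype.val (hψ h hh)) g
    rw [gaugeOp_val] at h1
    rw [← h1]
    refine congrArg ψ.1 (funext fun e => ?_)
    have hne := Λ.src_ne_tgt e
    simp only [A, Finset.mem_univ, if_true, gaugeAct, fluxAct_self]
    split_ifs with h2 h3
    · have : Λ.src e ≠ v := h2 ▸ hne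
      simp [h, h2, this]
    · simp [h, h2, h3]
    · simp [h, h2, h3]
  simp only [hinv, unitDeriv_const, mul_zero]
  rfl

end Flux

/-! ### Paths, reversal and holonomies -/

section Paths

variable {V E : Type*} {Λ : Lattice V E}

/-- The oriented edge traversed in the opposite direction. -/
def flipEdge (d : OrientedEdge E) : OrientedEdge E := (d.1, !d.2)

/-- The path traversed backwards. -/
def revPath (p : List (OrientedEdge E)) : List (OrientedEdge E) := (p.map flipEdge).reverse

lemma origin_flipEdge (d : OrientedEdge E) : Λ.origin (flipEdge d) = Λ.target d := by
  rcases d with ⟨e, _ | _⟩ <;> rfl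

lemma target_flipEdge (d : OrientedEdge E) : Λ.target (flipEdge d) = Λ.origin d := by
  rcases d with ⟨e, _ | _⟩ <;> rfl

lemma target_ne_origin (d : OrientedEdge E) : Λ.target d ≠ Λ.origin d := by
  rcases d with ⟨e, _ | _⟩
  · exact Λ.src_ne_tgt e
  · exact (Λ.src_ne_tgt e).symm

lemma isPath_append {v w : V} {p q : List (OrientedEdge E)} :
    Λ.IsPath v (p ++ q) w ↔ ∃ u, Λ.IsPath v p u ∧ Λ.IsPath u q w := by
  induction p generalizing v with
  | nil => simp [Lattice.IsPath]
  | cons d p ih => simp [Lattice.IsPath, ih, and_assoc]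

lemma isPath_singleton {v w : V} {d : OrientedEdge E} :
    Λ.IsPath v [d] w ↔ Λ.origin d = v ∧ Λ.target d = w := Iff.rfl

lemma revPath_cons (d : OrientedEdge E) (p : List (OrientedEdge E)) :
    revPath (d :: p) = revPath p ++ [flipEdge d] := by simp [revPath]

lemma isPath_revPath {v w : V} {p : List (OrientedEdge E)} (h : Λ.IsPath v p w) :
    Λ.IsPath w (revPath p) v := by
  induction p generalizing v with
  | nil => exact Eq.symm h
  | cons d p ih =>
    rw [revPath_cons, isPath_append]
    exact ⟨_, ih h.2, isPath_singleton.2 ⟨origin_flipEdge d, (target_flipEdge d).trans h.1⟩⟩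

lemma PathIn.append {F : Set E} {p q : List (OrientedEdge E)} (hp : PathIn F p)
    (hq : PathIn F q) : PathIn F (p ++ q) := fun d hd =>
  (List.mem_append.1 hd).elim (hp d) (hq d)

lemma PathIn.mono {F F' : Set E} (h : F ⊆ F') {p : List (OrientedEdge E)} (hp : PathIn F p) :
    PathIn F' p := fun d hd => h (hp d hd)

lemma PathIn.revPath {F : Set E} {p : List (OrientedEdge E)} (hp : PathIn F p) :
    PathIn F (revPath p) := fun d hd => by
  obtain ⟨d', hd', rfl⟩ := List.mem_map.1 (List.mem_reverse.1 hd)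
  exact hp d' hd'

section Holonomy

variable {G : Type*} [Group G]

lemma linkVar_flipEdge (g : E → G) (d : OrientedEdge E) :
    linkVar g (flipEdge d) = (linkVar g d)⁻¹ := by
  rcases d with ⟨e, _ | _⟩ <;> simp [linkVar, flipEdge]

lemma holonomy_append (g : E → G) (p q : List (OrientedEdge E)) :
    holonomy g (p ++ q) = holonomy g q * holonomy g p := by
  induction p with
  | nil => simp [holonomy]
  | cons d p ih => simp [holonomy, ih, mul_assoc]

lemma holonomy_singleton (g : E → G) (d : OrientedEdge E) : holonomy g [d] = linkVar g d := by
  simp [holonomy]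

lemma holonomy_revPath (g : E → G) (p : List (OrientedEdge E)) :
    holonomy g (revPath p) = (holonomy g p)⁻¹ := by
  induction p with
  | nil => simp [revPath, holonomy]
  | cons d p ih =>
    rw [revPath_cons, holonomy_append, holonomy_singleton, linkVar_flipEdge, ih, holonomy,
      mul_inv_rev]

lemma holonomy_congr {F : Set E} {p : List (OrientedEdge E)} (hp : PathIn F p) {g g' : E → G}
    (h : ∀ e ∈ F, g e = g' e) : holonomy g p = holonomy g' p := by
  induction p with
  | nil => rfl
  | cons d p ih =>
    rw [holonomy, holonomy, ih fun d' hd' => hp d' (List.mem_cons_of_mem _ hd'), linkVar, linkVar,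
      h d.1 (hp d List.mem_cons_self)]

lemma holonomy_gaugeAct (h : V → G) (g : E → G) {v w : V} {p : List (OrientedEdge E)}
    (hp : Λ.IsPath v p w) :
    holonomy (gaugeAct Λ h g) p = (h w)⁻¹ * holonomy g p * h v := by
  induction p generalizing v with
  | nil => cases hp; simp [holonomy]
  | cons d p ih =>
    obtain ⟨rfl, hp⟩ := hp
    rw [holonomy, holonomy, ih hp]
    rcases d with ⟨e, _ | _⟩ <;> simp [linkVar, gaugeAct, Lattice.origin, Lattice.target, mul_assoc]

end Holonomy

end Paths

/-! ### The corner cycle, its base points and its spanning trees -/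

section Corner

variable {V E : Type*} {Λ : Lattice V E}

lemma isPath_rotate {v : V} {W : List (OrientedEdge E)} (h : Λ.IsPath v W v) (k : ℕ) :
    ∃ u, Λ.IsPath u (W.rotate k) u := by
  induction k with
  | zero => exact ⟨v, by simpa using h⟩
  | succ k ih =>
    obtain ⟨u, hu⟩ := ih
    rw [← List.rotate_rotate]
    generalize W.rotate k = U at hu
    cases U with
    | nil => exact ⟨u, by simpa using hu⟩
    | cons d p =>
      refine ⟨Λ.target d, ?_⟩
      rw [List.rotate_cons_succ, List.rotate_zero, isPath_append]
      exact ⟨u, hu.2, isPath_singleton.2 ⟨hu.1, rfl⟩⟩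

lemma rotate_eq_cons {α : Type*} (W : List α) {k : ℕ} (hk : k < W.length) :
    ∃ p, W.rotate k = W[k] :: p := by
  rw [List.rotate_eq_drop_append_take hk.le, List.drop_eq_getElem_cons hk]
  exact ⟨_, rfl⟩

open scoped Classical in
/-- The closed path obtained by rotating `W` so that it starts at `v`. -/
noncomputable def loopAt (Λ : Lattice V E) (W : List (OrientedEdge E)) (v : V) :
    List (OrientedEdge E) :=
  W.rotate ((W.map Λ.origin).idxOf v)

lemma Region.target_mem_cornerVerts (S : Region Λ) {d : OrientedEdge E}
    (hd : d.1 ∈ S.cornerEdges) : Λ.target d ∈ S.cornerVerts := by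
  rcases d with ⟨e, _ | _⟩
  · exact S.corner_src_mem e hd
  · exact S.corner_tgt_mem e hd

lemma Region.origin_mem_cornerVerts (S : Region Λ) {d : OrientedEdge E}
    (hd : d.1 ∈ S.cornerEdges) : Λ.origin d ∈ S.cornerVerts := by
  rcases d with ⟨e, _ | _⟩
  · exact S.corner_tgt_mem e hd
  · exact S.corner_src_mem e hd

namespace Region.IsCornerCycle

variable {S : Region Λ} {W : List (OrientedEdge E)}

lemma loopAt_origin (hW : S.IsCornerCycle W) {k : ℕ} (hk : k < W.length) :
    loopAt Λ W (Λ.origin W[k]) = W.rotate k := by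
  classical
  have h : (W.map Λ.origin)[k]'(by simpa using hk) = Λ.origin W[k] := by simp
  unfold loopAt
  rw [← h, hW.nodup_verts.idxOf_getElem]

lemma mem_cornerVerts_iff (hW : S.IsCornerCycle W) {v : V} :
    v ∈ S.cornerVerts ↔ ∃ (k : ℕ) (hk : k < W.length), Λ.origin W[k] = v := by
  rw [hW.verts_eq, Set.mem_ofPred_eq, List.mem_map]
  constructor
  · rintro ⟨d, hd, rfl⟩
    obtain ⟨k, hk, rfl⟩ := List.getElem_of_mem hd
    exact ⟨k, hk, rfl⟩
  · rintro ⟨k, hk, rfl⟩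
    exact ⟨_, List.getElem_mem hk, rfl⟩

lemma mem_cornerEdges_iff (hW : S.IsCornerCycle W) {e : E} :
    e ∈ S.cornerEdges ↔ ∃ (k : ℕ) (hk : k < W.length), W[k].1 = e := by
  rw [hW.edges_eq, Set.mem_ofPred_eq, List.mem_map]
  constructor
  · rintro ⟨d, hd, rfl⟩
    obtain ⟨k, hk, rfl⟩ := List.getElem_of_mem hd
    exact ⟨k, hk, rfl⟩
  · rintro ⟨k, hk, rfl⟩
    exact ⟨_, List.getElem_mem hk, rfl⟩

lemma isPath_rotate_origin (hW : S.IsCornerCycle W) {k : ℕ} (hk : k < W.length) :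
    Λ.IsPath (Λ.origin W[k]) (W.rotate k) (Λ.origin W[k]) := by
  obtain ⟨v, hv⟩ := hW.closed
  obtain ⟨u, hu⟩ := isPath_rotate hv k
  obtain ⟨p, hp⟩ := rotate_eq_cons W hk
  have : Λ.origin W[k] = u := by
    rw [hp] at hu
    exact hu.1
  rwa [this]

/-- The corner loop starting with a given edge, and the loop starting after this edge. -/
lemma exists_cons (hW : S.IsCornerCycle W) {k : ℕ} (hk : k < W.length) :
    ∃ p, loopAt Λ W (Λ.origin W[k]) = W[k] :: p ∧
      loopAt Λ W (Λ.target W[k]) = p ++ [W[k]] ∧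
      Λ.IsPath (Λ.target W[k]) p (Λ.origin W[k]) ∧ (W[k] :: p).Perm W := by
  obtain ⟨p, hp⟩ := rotate_eq_cons W hk
  have h1 := hW.isPath_rotate_origin hk
  rw [hp] at h1
  -- The next index is cyclic: after the last edge the loop restarts at index `0`.
  have hm : (k + 1) % W.length < W.length := Nat.mod_lt _ (by omega)
  have h2 : W.rotate ((k + 1) % W.length) = p ++ [W[k]] := by
    rw [List.rotate_mod, ← List.rotate_rotate, hp, List.rotate_cons_succ, List.rotate_zero]
  have h3 := hW.isPath_rotate_origin hm
  have h4 : Λ.origin W[(k + 1) % W.length] = Λ.target W[k] := by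
    rw [h2, isPath_append] at h3
    obtain ⟨u, h3, h3'⟩ := h3
    exact h3'.2.symm
  refine ⟨p, by rw [hW.loopAt_origin hk, hp], by rw [← h4, hW.loopAt_origin hm, h2], h1.2, ?_⟩
  rw [← hp]
  exact List.rotate_perm W k

lemma pathIn_loopAt (hW : S.IsCornerCycle W) (v : V) : PathIn S.cornerEdges (loopAt Λ W v) := by
  intro d hd
  rw [hW.edges_eq]
  exact List.mem_map_of_mem ((List.rotate_perm _ _).mem_iff.1 hd)

lemma isPath_loopAt (hW : S.IsCornerCycle W) {v : V} (hv : v ∈ S.cornerVerts) :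
    Λ.IsPath v (loopAt Λ W v) v := by
  obtain ⟨k, hk, rfl⟩ := hW.mem_cornerVerts_iff.1 hv
  rw [hW.loopAt_origin hk]
  exact hW.isPath_rotate_origin hk

section Holonomy

variable {G : Type*} [Group G]

/-- The loops based at the two ends of a corner edge differ by moving that edge from the front to
the back of the list, which conjugates the holonomy. This is the covariant constancy of the corner
holonomy. -/
lemma holonomy_loopAt_step (hW : S.IsCornerCycle W) (g : E → G) {d : OrientedEdge E}
    (hd : d.1 ∈ S.cornerEdges) :
    holonomy g (loopAt Λ W (Λ.target d)) =
      linkVar g d * holonomy g (loopAt Λ W (Λ.origin d)) * (linkVar g d)⁻¹ := by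
  obtain ⟨k, hk, hkd⟩ := hW.mem_cornerEdges_iff.1 hd
  have key : holonomy g (loopAt Λ W (Λ.target W[k])) =
      linkVar g W[k] * holonomy g (loopAt Λ W (Λ.origin W[k])) * (linkVar g W[k])⁻¹ := by
    obtain ⟨p, h1, h2, -, -⟩ := hW.exists_cons hk
    rw [h1, h2, holonomy_append, holonomy_singleton, holonomy]
    group
  -- Since `d` may run against the cycle, the relation for the edge of `W` is also used in its
  -- inverted form.
  have hd' : d = W[k] ∨ d = flipEdge W[k] := by
    rcases d with ⟨e, b⟩
    generalize W[k] = d' at hkd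
    rcases d' with ⟨e', b'⟩
    cases hkd
    cases b <;> cases b' <;> simp [flipEdge]
  rcases hd' with rfl | rfl
  · exact key
  · rw [origin_flipEdge, target_flipEdge, linkVar_flipEdge, key]
    group

lemma holonomy_loopAt_path (hW : S.IsCornerCycle W) (g : E → G) {v w : V}
    {p : List (OrientedEdge E)} (hp : Λ.IsPath v p w) (hpc : PathIn S.cornerEdges p) :
    holonomy g (loopAt Λ W w) =
      holonomy g p * holonomy g (loopAt Λ W v) * (holonomy g p)⁻¹ := by
  induction p generalizing v with
  | nil => cases hp; simp [holonomy]
  | cons d p ih =>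
    obtain ⟨rfl, hp⟩ := hp
    rw [ih hp fun d' hd' => hpc d' (List.mem_cons_of_mem _ hd'),
      hW.holonomy_loopAt_step g (hpc d List.mem_cons_self), holonomy]
    group

end Holonomy

/-- Removing one edge from the corner cycle leaves a spanning tree. -/
lemma isSpanningTree_diff (hW : S.IsCornerCycle W) {e : E} (he : e ∈ S.cornerEdges) :
    S.IsSpanningTree (S.cornerEdges \ {e}) := by
  classical
  set T := S.cornerEdges \ {e} with hT
  -- A cycle has as many edges as vertices, so deleting one edge leaves exactly the number required
  -- of a tree.
  have hE : S.cornerEdges.ncard = W.length := by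
    have : S.cornerEdges = ((W.map Prod.fst).toFinset : Set E) := by
      rw [hW.edges_eq]; ext; simp
    rw [this, Set.ncard_coe_finset, List.toFinset_card_of_nodup hW.nodup_edges, List.length_map]
  have hV : S.cornerVerts.ncard = W.length := by
    have : S.cornerVerts = ((W.map Λ.origin).toFinset : Set V) := by
      rw [hW.verts_eq]; ext; simp
    rw [this, Set.ncard_coe_finset, List.toFinset_card_of_nodup hW.nodup_verts, List.length_map]
  refine ⟨Set.sdiff_subset, ?_, ?_⟩
  · obtain ⟨k, hk, rfl⟩ := hW.mem_cornerEdges_iff.1 he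
    obtain ⟨p, -, -, hp, hperm⟩ := hW.exists_cons hk
    have hnd : ((W[k] :: p).map Prod.fst).Nodup := (hperm.map Prod.fst).nodup_iff.2 hW.nodup_edges
    have hpT : PathIn T p := fun d hd => by
      refine ⟨?_, fun h => ?_⟩
      · rw [hW.edges_eq]
        exact List.mem_map_of_mem (hperm.mem_iff.1 (List.mem_cons_of_mem _ hd))
      · rw [List.map_cons, List.nodup_cons] at hnd
        refine hnd.1 (List.mem_map.2 ⟨d, hd, h⟩)
    -- Prefixes of the remaining open path `p` reach every vertex that it visits; its endpoint is
    -- the origin of the deleted edge.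
    have hreach : ∀ (q : List (OrientedEdge E)) (a b : V), Λ.IsPath a q b → PathIn T q →
        ∀ d ∈ q, ∃ q', Λ.IsPath a q' (Λ.origin d) ∧ PathIn T q' := by
      intro q a b hq hqT d hd
      obtain ⟨q1, q2, rfl⟩ := List.append_of_mem hd
      obtain ⟨u, hu, hu'⟩ := isPath_append.1 hq
      rw [hu'.1]
      exact ⟨q1, hu, fun d' hd' => hqT d' (List.mem_append_left _ hd')⟩
    have hfrom : ∀ v ∈ S.cornerVerts, ∃ q, Λ.IsPath (Λ.target W[k]) q v ∧ PathIn T q := by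
      intro v hv
      rw [hW.verts_eq, Set.mem_ofPred_eq, List.mem_map] at hv
      obtain ⟨d, hd, rfl⟩ := hv
      rcases List.mem_cons.1 (hperm.mem_iff.2 hd) with rfl | hd
      · exact ⟨p, hp, hpT⟩
      · exact hreach p _ _ hp hpT d hd
    intro v hv w hw
    obtain ⟨q, hq, hqT⟩ := hfrom v hv
    obtain ⟨q', hq', hqT'⟩ := hfrom w hw
    exact ⟨revPath q ++ q', isPath_append.2 ⟨_, isPath_revPath hq, hq'⟩, hqT.revPath.append hqT'⟩
  · have hpos : 0 < W.length := List.length_pos_of_ne_nil hW.ne_nil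
    rw [hT, Set.ncard_sdiff_singleton_of_mem he, hE, hV]
    omega

end Region.IsCornerCycle

end Corner

/-! ### Invariant contractions in a noncommutative ring -/

section Algebra

variable {R : Type*} [Ring R] {ι : Type*} [Fintype ι]

/-- Dual changes of basis cancel in a contraction. -/
lemma sum_mul_dual [Algebra ℂ R] [DecidableEq ι] {α β : Matrix ι ι ℂ} (h : α * β = 1)
    (A N : ι → R) :
    ∑ a, (∑ b, α b a • A b) * (∑ c, β a c • N c) = ∑ a, A a * N a := by
  have h1 : ∀ b c, ∑ a, α b a * β a c = if b = c then 1 else 0 := fun b c => by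
    rw [← Matrix.mul_apply, h, Matrix.one_apply]
  calc ∑ a, (∑ b, α b a • A b) * (∑ c, β a c • N c)
      = ∑ a, ∑ b, ∑ c, (α b a * β a c) • (A b * N c) := by
        refine Finset.sum_congr rfl fun a _ => ?_
        rw [Finset.sum_mul]
        refine Finset.sum_congr rfl fun b _ => ?_
        rw [Finset.mul_sum]
        exact Finset.sum_congr rfl fun c _ => smul_mul_smul_comm _ _ _ _
    _ = ∑ b, ∑ c, (∑ a, α b a * β a c) • (A b * N c) := by
        rw [Finset.sum_comm]
        refine Finset.sum_congr rfl fun b _ => ?_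
        rw [Finset.sum_comm]
        exact Finset.sum_congr rfl fun c _ => (Finset.sum_smul).symm
    _ = ∑ a, A a * N a := by
        simp [h1]

/-- A covariant derivation commutes with an invariant contraction. -/
lemma commute_sum_sum {Z : R} {A B : ι → R} {m t s : ι → ι → R}
    (hA : ∀ a, Z * A a = A a * Z + ∑ k, t a k * A k)
    (hm : ∀ a b, Z * m a b + ∑ k, m a k * s k b = m a b * Z + ∑ k, t a k * m k b)
    (hB : ∀ b, Z * B b = B b * Z + ∑ k, s b k * B k)
    (ht : ∀ a k c, A c * t a k = t a k * A c) (hanti : ∀ a k, t a k + t k a = 0) :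
    Commute Z (∑ a, ∑ b, A a * m a b * B b) := by
  let Q : ι → R := fun a => ∑ b, m a b * B b
  have hP : ∑ a, ∑ b, A a * m a b * B b = ∑ a, A a * Q a := by
    simp only [Q, Finset.mul_sum, mul_assoc]
  -- Contracting `b` cancels the `s` terms from the two factors, so `Q` rotates with `t` alone, like
  -- a vector at the other end of the path.
  have hQ : ∀ a, Z * Q a = Q a * Z + ∑ k, t a k * Q k := by
    intro a
    have h1 : ∀ b, Z * (m a b * B b) = m a b * B b * Z + m a b * ∑ k, s b k * B k +
        (∑ k, t a k * m k b) * B b - (∑ k, m a k * s k b) * B b := fun b => by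
      rw [← mul_assoc, eq_sub_of_add_eq (hm a b), sub_mul, add_mul, mul_assoc (m a b) Z, hB]
      noncomm_ring
    have h2 : ∑ b, m a b * ∑ k, s b k * B k = ∑ b, (∑ k, m a k * s k b) * B b := by
      simp only [Finset.mul_sum, Finset.sum_mul, mul_assoc]
      exact Finset.sum_comm
    have h3 : ∑ b, (∑ k, t a k * m k b) * B b = ∑ k, t a k * Q k := by
      simp only [Q, Finset.mul_sum, Finset.sum_mul, mul_assoc]
      exact Finset.sum_comm
    simp only [Q, Finset.mul_sum (f := fun b => m a b * B b), h1, Finset.sum_sub_distrib,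
      Finset.sum_add_distrib]
    rw [h2, h3, Finset.sum_mul]
    simp only [Q]
    abel
  clear_value Q
  rw [hP, Commute, SemiconjBy, Finset.mul_sum, Finset.sum_mul]
  have h1 : ∀ a, Z * (A a * Q a) =
      A a * Q a * Z + (∑ k, t a k * (A a * Q k) + ∑ k, t a k * (A k * Q a)) := fun a => by
    rw [← mul_assoc, hA, add_mul, mul_assoc (A a) Z, hQ, mul_add, Finset.mul_sum, Finset.sum_mul]
    have hAQ : ∀ k, A a * (t a k * Q k) = t a k * (A a * Q k) := fun k => by
      rw [← mul_assoc, ht, mul_assoc]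
    simp only [hAQ, mul_assoc]
    abel
  -- Exchange the names of the summation indices and use the antisymmetry of `t`.
  have h2 : ∑ a, ∑ k, t a k * (A a * Q k) = -∑ a, ∑ k, t a k * (A k * Q a) := by
    rw [Finset.sum_comm, ← Finset.sum_neg_distrib]
    refine Finset.sum_congr rfl fun a _ => ?_
    rw [← Finset.sum_neg_distrib]
    refine Finset.sum_congr rfl fun k _ => ?_
    rw [eq_neg_of_add_eq_zero_left (hanti k a), neg_mul]
  simp only [h1, Finset.sum_add_distrib]
  rw [h2]
  abel

end Algebra

/-! ### The derivation generated by a covariantly constant corner field -/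

section CornerField

variable {EG : Type*} [NormedAddCommGroup EG] [NormedSpace ℝ EG]
  {H : Type*} [TopologicalSpace H] (I : ModelWithCorners ℝ EG H)
  {G : Type*} [TopologicalSpace G] [ChartedSpace H G] [Group G]
  {V : Type*} {E : Type*} [Fintype E] {Λ : Lattice V E} (S : Region Λ)
  {ι : Type*} [Fintype ι] [DecidableEq ι]

lemma DependsOn.mono {F F' : Set E} (h : F ⊆ F') {f : Wave I G E} (hf : DependsOn I F f) :
    DependsOn I F' f := fun g g' hg => hf g g' fun e he => hg e (h he)

lemma DependsOn.sum {κ : Type*} {F : Set E} (s : Finset κ) {f : κ → Wave I G E}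
    (hf : ∀ k, DependsOn I F (f k)) : DependsOn I F (∑ k ∈ s, f k) := fun g g' hg => by
  rw [Wave.sum_val, Wave.sum_val]
  exact Finset.sum_congr rfl fun k _ => hf k g g' hg

lemma DependsOn.smul {F : Set E} (c : ℂ) {f : Wave I G E} (hf : DependsOn I F f) :
    DependsOn I F (c • f) := fun g g' hg => congrArg (c * ·) (hf g g' hg)

variable [LieGroup I ∞ G]

lemma dependsOn_holEntry {κ : Type*} [Fintype κ] [DecidableEq κ] {r : G →* Matrix κ κ ℂ}
    (hr : ∀ i j, ContMDiff I 𝓘(ℝ, ℂ) ∞ fun g => r g i j) {F : Set E}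
    {p : List (OrientedEdge E)} (hp : PathIn F p) (i j : κ) :
    DependsOn I F (holEntry I hr p i j) := fun g g' hg => by
  change r (holonomy g p) i j = r (holonomy g' p) i j
  rw [holonomy_congr hp hg]

lemma dependsOn_traceFun {d : ℕ} (ρ : SmoothRep I G d) {F : Set E}
    {p : List (OrientedEdge E)} (hp : PathIn F p) (A : Matrix (Fin d) (Fin d) ℂ) :
    DependsOn I F (traceFun I ρ p A) := fun g g' hg => by
  change (ρ.toHom (holonomy g p) * A).trace = (ρ.toHom (holonomy g' p) * A).trace
  rw [holonomy_congr hp hg]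

variable (τ : Module.Basis ι ℝ (GroupLieAlgebra I G))

/-- A function of the corner links with values in the Lie algebra at each corner vertex,
covariantly constant along the corner and gauge covariant. -/
structure IsCornerField (X : V → ι → Wave I G E) : Prop where
  depends : ∀ v a, DependsOn I S.cornerEdges (X v a)
  eq_zero : ∀ v, v ∉ S.cornerVerts → ∀ a, X v a = 0
  transport : ∀ d : OrientedEdge E, d.1 ∈ S.cornerEdges → ∀ a g,
    (X (Λ.target d) a).1 g =
      ∑ b, adHom I τ (linkVar g d) a b * (X (Λ.origin d) b).1 g
  gauge : ∀ (h : V → G) v a,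
    gaugeOp I Λ h (X v a) = ∑ b, adHom I τ (h v)⁻¹ a b • X v b

/-- The operator `∑_v X_v^a ∑_e (𝔊^v_e)^a`, summed over the vertices in `C` and over the interior
edges of the region. -/
noncomputable def centerOp (C : Finset V) (X : V → ι → Wave I G E) : Op I G E :=
  ∑ v ∈ C, ∑ a, mulOp I (X v a) * interiorFlux I S v (τ a)

lemma interiorFlux_mul (v : V) (ξ : GroupLieAlgebra I G) (f ψ : Wave I G E) :
    interiorFlux I S v ξ (f * ψ) = interiorFlux I S v ξ f * ψ + f * interiorFlux I S v ξ ψ := by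
  simp only [interiorFlux, LinearMap.sum_apply, Finset.sum_mul, Finset.mul_sum,
    ← Finset.sum_add_distrib]
  refine Finset.sum_congr rfl fun e _ => ?_
  split_ifs
  · exact flux_mul I Λ v e ξ f ψ
  · simp

lemma interiorFlux_eq_zero {F : Set E} (hF : Disjoint F S.interiorEdges) {f : Wave I G E}
    (hf : DependsOn I F f) (v : V) (ξ : GroupLieAlgebra I G) : interiorFlux I S v ξ f = 0 := by
  rw [interiorFlux, LinearMap.sum_apply]
  refine Finset.sum_eq_zero fun e _ => ?_
  split_ifs with he
  · exact flux_eq_zero I Λ hf (fun h => Set.disjoint_left.1 hF h he) v ξ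
  · rfl

lemma centerOp_apply (C : Finset V) (X : V → ι → Wave I G E) (ψ : Wave I G E) :
    centerOp I S τ C X ψ = ∑ v ∈ C, ∑ a, X v a * interiorFlux I S v (τ a) ψ := by
  simp only [centerOp, LinearMap.sum_apply]
  rfl

lemma centerOp_mul (C : Finset V) (X : V → ι → Wave I G E) (f ψ : Wave I G E) :
    centerOp I S τ C X (f * ψ) = centerOp I S τ C X f * ψ + f * centerOp I S τ C X ψ := by
  simp only [centerOp_apply, interiorFlux_mul, Finset.sum_mul, Finset.mul_sum,
    ← Finset.sum_add_distrib]
  refine Finset.sum_congr rfl fun v _ => Finset.sum_congr rfl fun a _ => ?_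
  ring

lemma centerOp_mul_mulOp (C : Finset V) (X : V → ι → Wave I G E) (f : Wave I G E) :
    centerOp I S τ C X * mulOp I f =
      mulOp I f * centerOp I S τ C X + mulOp I (centerOp I S τ C X f) := by
  refine LinearMap.ext fun ψ => ?_
  change centerOp I S τ C X (f * ψ) = f * centerOp I S τ C X ψ + centerOp I S τ C X f * ψ
  rw [centerOp_mul, add_comm]

lemma centerOp_eq_zero (C : Finset V) (X : V → ι → Wave I G E) {F : Set E}
    (hF : Disjoint F S.interiorEdges) {f : Wave I G E} (hf : DependsOn I F f) :
    centerOp I S τ C X f = 0 := by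
  simp [centerOp_apply, interiorFlux_eq_zero I S hF hf]

/-- In the sum over interior edges only the term with the same link fails to commute, and that only
at the same end. -/
lemma interiorFlux_mul_flux [I.Boundaryless] {κ' : LinearMap.BilinForm ℝ (GroupLieAlgebra I G)}
    (hκ : ∀ (g : G) (ξ η : GroupLieAlgebra I G), κ' (Ad I g ξ) (Ad I g η) = κ' ξ η)
    (hτ : ∀ a b, κ' (τ a) (τ b) = if a = b then 1 else 0)
    (v u : V) {e : E} (he : e ∈ S.interiorEdges)
    (ξ : GroupLieAlgebra I G) (a : ι) [Decidable (v = u)] :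
    interiorFlux I S v ξ * flux I Λ u e (τ a) = flux I Λ u e (τ a) * interiorFlux I S v ξ +
      if v = u then ∑ k, matGen I (adHom I τ) ξ a k • flux I Λ u e (τ k) else 0 := by
  classical
  have h : ∀ e', (if e' ∈ S.interiorEdges then flux I Λ v e' ξ else 0) * flux I Λ u e (τ a) =
      flux I Λ u e (τ a) * (if e' ∈ S.interiorEdges then flux I Λ v e' ξ else 0) +
        if e' = e then (if v = u then ∑ k, matGen I (adHom I τ) ξ a k • flux I Λ u e (τ k) else 0)
        else 0 := by
    intro e'
    by_cases h1 : e' = e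
    · subst h1
      rw [if_pos he, if_pos rfl]
      by_cases h2 : v = u
      · subst h2
        rw [if_pos rfl, flux_mul_flux I Λ τ hκ hτ]
      · rw [if_neg h2, add_zero]
        exact commute_flux_flux I Λ (fun h => h2 h.1) _ _
    · rw [if_neg h1, add_zero]
      split_ifs
      · exact commute_flux_flux I Λ (fun h => h1 h.2) _ _
      · simp
  rw [interiorFlux, Finset.sum_mul, Finset.mul_sum]
  simp only [h, Finset.sum_add_distrib]
  simp

/-- The matrix `∑_a X_v^a T_r^a`. -/
noncomputable def fieldMat {κ : Type*} [Fintype κ] [DecidableEq κ] (r : G →* Matrix κ κ ℂ)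
    (X : V → ι → Wave I G E) (v : V) (i j : κ) : Wave I G E :=
  ∑ a, matGen I r (τ a) i j • X v a

/-- The field depends on corner links only, so it passes through interior electric fields and just
the Lie algebra commutator at `u` survives. Away from the corner `X u` vanishes, so the formula
holds at every vertex. -/
lemma centerOp_mul_flux [I.Boundaryless] {C : Finset V} (hC : ∀ v, v ∈ C ↔ v ∈ S.cornerVerts)
    {X : V → ι → Wave I G E} (hX : IsCornerField I S τ X)
    {κ' : LinearMap.BilinForm ℝ (GroupLieAlgebra I G)}
    (hκ : ∀ (g : G) (ξ η : GroupLieAlgebra I G), κ' (Ad I g ξ) (Ad I g η) = κ' ξ η)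
    (hτ : ∀ a b, κ' (τ a) (τ b) = if a = b then 1 else 0)
    (u : V) {e : E} (he : e ∈ S.interiorEdges) (a : ι) :
    centerOp I S τ C X * flux I Λ u e (τ a) = flux I Λ u e (τ a) * centerOp I S τ C X +
      ∑ k, mulOp I (fieldMat I τ (adHom I τ) X u a k) * flux I Λ u e (τ k) := by
  classical
  have hcomm : ∀ v c, mulOp I (X v c) * flux I Λ u e (τ a) =
      flux I Λ u e (τ a) * mulOp I (X v c) := fun v c =>
    (commute_flux_mulOp I Λ (hX.depends v c) he.2 u (τ a)).symm
  have h1 : ∀ v c, mulOp I (X v c) * interiorFlux I S v (τ c) * flux I Λ u e (τ a) =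
      flux I Λ u e (τ a) * (mulOp I (X v c) * interiorFlux I S v (τ c)) +
        if v = u then ∑ k, matGen I (adHom I τ) (τ c) a k •
          (mulOp I (X u c) * flux I Λ u e (τ k)) else 0 := by
    intro v c
    rw [mul_assoc, interiorFlux_mul_flux I S τ hκ hτ v u he, mul_add, ← mul_assoc, hcomm, mul_assoc]
    congr 1
    split_ifs with h
    · subst h
      rw [Finset.mul_sum]
      exact Finset.sum_congr rfl fun k _ => mul_smul_comm _ _ _
    · simp
  rw [centerOp, Finset.sum_mul, Finset.mul_sum]
  simp only [Finset.sum_mul, Finset.mul_sum, h1, Finset.sum_add_distrib]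
  congr 1
  have h2 : ∑ v ∈ C, ∑ c, (if v = u then ∑ k, matGen I (adHom I τ) (τ c) a k •
      (mulOp I (X u c) * flux I Λ u e (τ k)) else 0) =
      ∑ c, ∑ k, matGen I (adHom I τ) (τ c) a k • (mulOp I (X u c) * flux I Λ u e (τ k)) := by
    by_cases hu : u ∈ C
    · rw [Finset.sum_eq_single_of_mem u hu fun v _ hv => by simp [hv]]
      simp
    · rw [Finset.sum_eq_zero fun v hv => ?_]
      · simp [hX.eq_zero u (fun h => hu ((hC u).2 h)), mulOp_zero]
      · have : v ≠ u := fun h => hu (h ▸ hv)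
        simp [this]
  rw [h2, Finset.sum_comm]
  refine Finset.sum_congr rfl fun k _ => ?_
  simp only [fieldMat, mulOp_sum, mulOp_smul, Finset.sum_mul, smul_mul_assoc]

section Holonomy

variable {κ : Type*} [Fintype κ] [DecidableEq κ] {r : G →* Matrix κ κ ℂ}

lemma fieldMat_val (X : V → ι → Wave I G E) (v : V) (g : E → G) :
    (Matrix.of fun i j => (fieldMat I τ r X v i j).1 g) =
      ∑ a, (X v a).1 g • matGen I r (τ a) := by
  ext i j
  rw [Matrix.of_apply, fieldMat, Wave.sum_val, Matrix.sum_apply]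
  refine Finset.sum_congr rfl fun a _ => ?_
  exact mul_comm _ _

/-- Covariant constancy written in the representation `r`: rotating components by `Ad` is
conjugating the matrix by `r`. -/
lemma fieldMat_transport (hr : ∀ i j, ContMDiff I 𝓘(ℝ, ℂ) ∞ fun g => r g i j)
    {X : V → ι → Wave I G E} (hX : IsCornerField I S τ X) {d : OrientedEdge E}
    (hd : d.1 ∈ S.cornerEdges) (g : E → G) :
    (∑ a, (X (Λ.target d) a).1 g • matGen I r (τ a)) * r (linkVar g d) =
      r (linkVar g d) * ∑ a, (X (Λ.origin d) a).1 g • matGen I r (τ a) := by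
  have h : ∑ a, (X (Λ.target d) a).1 g • matGen I r (τ a) =
      ∑ b, (X (Λ.origin d) b).1 g • matGen I r (Ad I (linkVar g d) (τ b)) := by
    simp only [hX.transport d hd, matGen_Ad_basis, Finset.sum_smul, Finset.smul_sum, smul_smul]
    rw [Finset.sum_comm]
    exact Finset.sum_congr rfl fun b _ => Finset.sum_congr rfl fun a _ => by rw [mul_comm]
  rw [h, Finset.sum_mul, Finset.mul_sum]
  refine Finset.sum_congr rfl fun b _ => ?_
  rw [matGen_Ad I hr, smul_mul_assoc, mul_assoc, ← map_mul, inv_mul_cancel, map_one, mul_one,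
    mul_smul_comm]

-- An electric field inserts a generator on the left at the end of a traversal and on the right,
-- with a minus sign, at its start. In this form the result does not depend on the orientation of
-- the link. The factors `Complex.I` combine through `I * I = -1`.
open scoped Classical in
lemma flux_holEntry_singleton (hr : ∀ i j, ContMDiff I 𝓘(ℝ, ℂ) ∞ fun g => r g i j) (v : V)
    (d : OrientedEdge E) (ξ : GroupLieAlgebra I G) (g : E → G) (i j : κ) :
    (flux I Λ v d.1 ξ (holEntry I hr [d] i j)).1 g =
      (if Λ.target d = v then (matGen I r ξ * r (linkVar g d)) i j else 0) -
        if Λ.origin d = v then (r (linkVar g d) * matGen I r ξ) i j else 0 := by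
  have hval : ∀ g : E → G, (holEntry I hr [d] i j).1 g = r (linkVar g d) i j := fun g => by
    change r (holonomy g [d]) i j = _
    rw [holonomy_singleton]
  have hL : ∀ A : Matrix κ κ ℂ, unitDeriv I (fun x => (r x * A) i j) ξ =
      Complex.I * (matGen I r ξ * A) i j :=
    fun A => by simpa using unitDeriv_rep_mul I hr 1 A ξ i j
  have hR : ∀ A : Matrix κ κ ℂ, unitDeriv I (fun x => (A * r x) i j) ξ =
      Complex.I * (A * matGen I r ξ) i j :=
    fun A => by simpa using unitDeriv_rep_mul I hr A 1 ξ i j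
  have hR' : ∀ A : Matrix κ κ ℂ, unitDeriv I (fun x => (A * r x⁻¹) i j) ξ =
      -(Complex.I * (A * matGen I r ξ) i j) := fun A => by
    rw [← hR]
    exact unitDeriv_inv I (f := fun x => (A * r x) i j)
      (by simpa using contMDiff_rep_mul I hr A 1 i j) ξ
  rw [flux_val]
  simp only [hval]
  have hne := Λ.src_ne_tgt d.1
  rcases d with ⟨e, _ | _⟩ <;>
    simp only [linkVar, Lattice.origin, Lattice.target, fluxAct_self, if_true, Bool.false_eq_true,
      if_false] at hne ⊢ <;>
    by_cases h1 : Λ.tgt e = v <;> by_cases h2 : Λ.src e = v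
  · exact absurd (h2.trans h1.symm) hne
  · simp only [h1, h2, if_true, if_false, mul_inv_rev, map_mul, hR']
    linear_combination ((r (g e)⁻¹ * matGen I r ξ) i j) * Complex.I_mul_I
  · simp only [h1, h2, if_true, if_false, mul_inv_rev, inv_inv, map_mul, hL]
    linear_combination -((matGen I r ξ * r (g e)⁻¹) i j) * Complex.I_mul_I
  · simp only [h1, h2, if_false, unitDeriv_const, mul_zero, sub_zero]
  · exact absurd (h2.trans h1.symm) hne
  · simp only [h1, h2, if_true, if_false, map_mul, hL]
    linear_combination -((matGen I r ξ * r (g e)) i j) * Complex.I_mul_I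
  · simp only [h1, h2, if_true, if_false, map_mul, hR']
    linear_combination ((r (g e) * matGen I r ξ) i j) * Complex.I_mul_I
  · simp only [h1, h2, if_false, unitDeriv_const, mul_zero, sub_zero]

/-- On an interior link only its own flux acts, at its two ends. On a corner link both sides vanish:
the left because no interior link is involved, the right by covariant constancy. -/
lemma centerOp_holEntry_singleton (hr : ∀ i j, ContMDiff I 𝓘(ℝ, ℂ) ∞ fun g => r g i j)
    {C : Finset V} (hC : ∀ v, v ∈ C ↔ v ∈ S.cornerVerts)
    {X : V → ι → Wave I G E} (hX : IsCornerField I S τ X) {d : OrientedEdge E}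
    (hd : d.1 ∈ S.edges) (g : E → G) (i j : κ) :
    (centerOp I S τ C X (holEntry I hr [d] i j)).1 g =
      ((∑ a, (X (Λ.target d) a).1 g • matGen I r (τ a)) * r (linkVar g d) -
        r (linkVar g d) * ∑ a, (X (Λ.origin d) a).1 g • matGen I r (τ a)) i j := by
  classical
  have hp : PathIn {d.1} [d] := fun d' hd' => by
    rw [List.mem_singleton.1 hd']; rfl
  have hdep := dependsOn_holEntry I hr hp i j
  by_cases hc : d.1 ∈ S.cornerEdges
  · rw [fieldMat_transport I S τ hr hX hc, sub_self,
      centerOp_eq_zero I S τ C X (Set.disjoint_left.2 ?_) hdep]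
    · rfl
    · rintro e rfl he
      exact he.2 hc
  have hint : d.1 ∈ S.interiorEdges := ⟨hd, hc⟩
  have hflux : ∀ v a, interiorFlux I S v (τ a) (holEntry I hr [d] i j) =
      flux I Λ v d.1 (τ a) (holEntry I hr [d] i j) := fun v a => by
    rw [interiorFlux, LinearMap.sum_apply, Finset.sum_eq_single d.1, if_pos hint]
    · intro e _ he
      split_ifs
      · exact flux_eq_zero I Λ hdep he v _
      · rfl
    · simp
  -- The vertex `u` may lie off the corner; then both sides are zero because `X u` is.
  have hpick : ∀ (u : V) (Y : ι → ℂ), ∑ v ∈ C, ∑ a, (X v a).1 g * (if u = v then Y a else 0) =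
      ∑ a, (X u a).1 g * Y a := by
    intro u Y
    by_cases hu : u ∈ C
    · rw [Finset.sum_eq_single_of_mem u hu fun v _ hv => by simp [hv.symm]]
      simp
    · rw [Finset.sum_eq_zero fun v hv => ?_]
      · simp [hX.eq_zero u (fun h => hu ((hC u).2 h))]
      · have : u ≠ v := fun h => hu (h ▸ hv)
        simp [this]
  rw [centerOp_apply, Wave.sum_val]
  have h1 : ∀ v, (∑ a, X v a * interiorFlux I S v (τ a) (holEntry I hr [d] i j)).1 g =
      ∑ a, (X v a).1 g * (if Λ.target d = v then (matGen I r (τ a) * r (linkVar g d)) i j else 0) -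
      ∑ a, (X v a).1 g *
        (if Λ.origin d = v then (r (linkVar g d) * matGen I r (τ a)) i j else 0) := by
    intro v
    rw [Wave.sum_val, ← Finset.sum_sub_distrib]
    refine Finset.sum_congr rfl fun a _ => ?_
    rw [← mul_sub, ← flux_holEntry_singleton I hr, ← hflux]
    rfl
  simp only [h1, Finset.sum_sub_distrib]
  rw [hpick _ fun a => (matGen I r (τ a) * r (linkVar g d)) i j,
    hpick _ fun a => (r (linkVar g d) * matGen I r (τ a)) i j]
  simp only [Finset.sum_mul, Finset.mul_sum, Matrix.sub_apply, Matrix.sum_apply,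
    smul_mul_assoc, mul_smul_comm, Matrix.smul_apply, smul_eq_mul]

/-- By the Leibniz rule along the path the insertions at intermediate vertices telescope, and only
those at the endpoints remain. -/
lemma centerOp_holEntry (hr : ∀ i j, ContMDiff I 𝓘(ℝ, ℂ) ∞ fun g => r g i j)
    {C : Finset V} (hC : ∀ v, v ∈ C ↔ v ∈ S.cornerVerts)
    {X : V → ι → Wave I G E} (hX : IsCornerField I S τ X) {v w : V}
    {p : List (OrientedEdge E)} (hp : Λ.IsPath v p w) (hpS : PathIn S.edges p) (g : E → G)
    (i j : κ) :
    (centerOp I S τ C X (holEntry I hr p i j)).1 g =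
      ((∑ a, (X w a).1 g • matGen I r (τ a)) * r (holonomy g p) -
        r (holonomy g p) * ∑ a, (X v a).1 g • matGen I r (τ a)) i j := by
  induction p generalizing v i j with
  | nil =>
    cases hp
    have h0 : DependsOn I ∅ (holEntry I hr ([] : List (OrientedEdge E)) i j) := fun _ _ _ => rfl
    rw [centerOp_eq_zero I S τ C X (Set.empty_disjoint _) h0]
    simp [holonomy]
  | cons d p ih =>
    obtain ⟨rfl, hp⟩ := hp
    have h1 : holEntry I hr (d :: p) i j =
        ∑ k, holEntry I hr p i k * holEntry I hr [d] k j := by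
      refine Subtype.ext (funext fun g => ?_)
      rw [Wave.sum_val]
      change r (holonomy g p * linkVar g d) i j =
        ∑ k, r (holonomy g p) i k * r (holonomy g [d]) k j
      rw [map_mul, Matrix.mul_apply, holonomy_singleton]
    have h2 : ∀ k, (centerOp I S τ C X (holEntry I hr p i k * holEntry I hr [d] k j)).1 g =
        (centerOp I S τ C X (holEntry I hr p i k)).1 g * r (linkVar g d) k j +
          r (holonomy g p) i k * (centerOp I S τ C X (holEntry I hr [d] k j)).1 g := by
      intro k
      rw [centerOp_mul, ← holonomy_singleton g d]
      rfl
    rw [h1, map_sum, Wave.sum_val]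
    simp only [h2, ih hp fun d' hd' => hpS d' (List.mem_cons_of_mem _ hd'),
      centerOp_holEntry_singleton I S τ hr hC hX (hpS d List.mem_cons_self)]
    rw [Finset.sum_add_distrib, ← Matrix.mul_apply, ← Matrix.mul_apply, ← Matrix.add_apply,
      holonomy, map_mul]
    refine congrFun (congrFun ?_ i) j
    noncomm_ring

end Holonomy

lemma adHom_mul_transpose {κ' : LinearMap.BilinForm ℝ (GroupLieAlgebra I G)}
    (hκ : ∀ (g : G) (ξ η : GroupLieAlgebra I G), κ' (Ad I g ξ) (Ad I g η) = κ' ξ η)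
    (hτ : ∀ a b, κ' (τ a) (τ b) = if a = b then 1 else 0) (k : G) :
    adHom I τ k * (adHom I τ k).transpose = 1 := by
  have h : (adHom I τ k).transpose = adHom I τ k⁻¹ := by
    ext a b
    rw [Matrix.transpose_apply, adHom_inv I τ hκ hτ]
  rw [h, ← map_mul, mul_inv_cancel, map_one]

lemma gaugeOp_mul_interiorFlux (h : V → G) (v : V) (a : ι) :
    gaugeOp I Λ h * interiorFlux I S v (τ a) =
      (∑ b, adHom I τ (h v) b a • interiorFlux I S v (τ b)) * gaugeOp I Λ h := by
  simp only [interiorFlux, Finset.mul_sum, Finset.smul_sum]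
  rw [Finset.sum_comm, Finset.sum_mul]
  refine Finset.sum_congr rfl fun e _ => ?_
  split_ifs
  · rw [gaugeOp_mul_flux_basis, Finset.sum_mul]
    exact Finset.sum_congr rfl fun b _ => (smul_mul_assoc _ _ _).symm
  · simp

/-- The field rotates by `Ad (h v)⁻¹`, which is the transpose of `Ad (h v)` by orthogonality. The
rotation of the flux at the same vertex therefore cancels it in the contraction. No smallness of `h`
is needed. -/
lemma commute_gaugeOp_centerOp (C : Finset V)
    {X : V → ι → Wave I G E} (hX : IsCornerField I S τ X)
    {κ' : LinearMap.BilinForm ℝ (GroupLieAlgebra I G)}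
    (hκ : ∀ (g : G) (ξ η : GroupLieAlgebra I G), κ' (Ad I g ξ) (Ad I g η) = κ' ξ η)
    (hτ : ∀ a b, κ' (τ a) (τ b) = if a = b then 1 else 0) (h : V → G) :
    Commute (centerOp I S τ C X) (gaugeOp I Λ h) := by
  rw [Commute, SemiconjBy, centerOp, Finset.sum_mul, Finset.mul_sum]
  refine Finset.sum_congr rfl fun v _ => ?_
  rw [Finset.sum_mul, Finset.mul_sum]
  simp only [← mul_assoc, gaugeOp_mul_mulOp]
  simp only [mul_assoc, gaugeOp_mul_interiorFlux, hX.gauge, mulOp_sum, mulOp_smul]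
  simp only [← mul_assoc]
  rw [← Finset.sum_mul, ← Finset.sum_mul]
  congr 1
  have := sum_mul_dual (adHom_mul_transpose I τ hκ hτ (h v)) (fun a => mulOp I (X v a))
    fun a => interiorFlux I S v (τ a)
  simp only [Matrix.transpose_apply] at this
  simp only [adHom_inv I τ hκ hτ]
  exact this.symm

end CornerField

/-! ### The corner holonomy as a corner field, and the generators -/

section Generators

variable {EG : Type*} [NormedAddCommGroup EG] [NormedSpace ℝ EG]
  {H : Type*} [TopologicalSpace H] (I : ModelWithCorners ℝ EG H)
  {G : Type*} [TopologicalSpace G] [ChartedSpace H G] [Group G] [LieGroup I ∞ G]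
  {V : Type*} {E : Type*} [Fintype E] {Λ : Lattice V E} (S : Region Λ)
  {ι : Type*} [Fintype ι] [DecidableEq ι] (τ : Module.Basis ι ℝ (GroupLieAlgebra I G))
  {d : ℕ} (ρ : SmoothRep I G d)

lemma generator_eq (ξ : GroupLieAlgebra I G) : ρ.generator ξ = matGen I ρ.toHom ξ := rfl

/-- Cyclicity of the trace moves the conjugation from the group element to the generator, where it
becomes `Ad k`. -/
lemma trace_conj_generator (k x : G) (a : ι) :
    (ρ.toHom (k⁻¹ * x * k) * ρ.generator (τ a)).trace =
      ∑ b, adHom I τ k b a * (ρ.toHom x * ρ.generator (τ b)).trace := by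
  have h : ∑ b, adHom I τ k b a * (ρ.toHom x * ρ.generator (τ b)).trace =
      (ρ.toHom x * ρ.generator (Ad I k (τ a))).trace := by
    simp only [generator_eq, matGen_Ad_basis, Finset.mul_sum, Matrix.trace_sum, mul_smul_comm,
      Matrix.trace_smul, smul_eq_mul]
  rw [h, generator_eq, generator_eq, matGen_Ad I ρ.smooth, map_mul, map_mul, mul_assoc,
    Matrix.trace_mul_comm, ← mul_assoc, Matrix.trace_mul_comm]

variable {κ' : LinearMap.BilinForm ℝ (GroupLieAlgebra I G)}

lemma trace_conj_generator'
    (hκ : ∀ (g : G) (ξ η : GroupLieAlgebra I G), κ' (Ad I g ξ) (Ad I g η) = κ' ξ η)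
    (hτ : ∀ a b, κ' (τ a) (τ b) = if a = b then 1 else 0) (k x : G) (a : ι) :
    (ρ.toHom (k * x * k⁻¹) * ρ.generator (τ a)).trace =
      ∑ b, adHom I τ k a b * (ρ.toHom x * ρ.generator (τ b)).trace := by
  have h := trace_conj_generator I τ ρ k⁻¹ x a
  rw [inv_inv] at h
  simpa only [adHom_inv I τ hκ hτ] using h

open scoped Classical in
/-- The Lie algebra valued function `Tr_ρ(ĝ_{W(v)} T^a)` on the corner. -/
noncomputable def cornerField (W : List (OrientedEdge E)) (v : V) (a : ι) : Wave I G E :=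
  if v ∈ S.cornerVerts then traceFun I ρ (loopAt Λ W v) (ρ.generator (τ a)) else 0

lemma cornerField_val {W : List (OrientedEdge E)} {v : V} (hv : v ∈ S.cornerVerts) (a : ι)
    (g : E → G) : (cornerField I S τ ρ W v a).1 g =
      (ρ.toHom (holonomy g (loopAt Λ W v)) * ρ.generator (τ a)).trace := by
  rw [cornerField, if_pos hv]
  rfl

lemma isCornerField
    (hκ : ∀ (g : G) (ξ η : GroupLieAlgebra I G), κ' (Ad I g ξ) (Ad I g η) = κ' ξ η)
    (hτ : ∀ a b, κ' (τ a) (τ b) = if a = b then 1 else 0)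
    {W : List (OrientedEdge E)} (hW : S.IsCornerCycle W) :
    IsCornerField I S τ (cornerField I S τ ρ W) where
  depends v a := by
    unfold cornerField
    split_ifs
    · exact dependsOn_traceFun I ρ (hW.pathIn_loopAt v) _
    · exact fun _ _ _ => rfl
  eq_zero v hv a := if_neg hv
  transport e he a g := by
    simp only [cornerField_val I S τ ρ (S.target_mem_cornerVerts he),
      cornerField_val I S τ ρ (S.origin_mem_cornerVerts he)]
    rw [hW.holonomy_loopAt_step g he, trace_conj_generator' I τ ρ hκ hτ]
  gauge h v a := by
    by_cases hv : v ∈ S.cornerVerts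
    · refine Subtype.ext (funext fun g => ?_)
      -- The two uses of `inv_inv` bring the conjugated holonomy to the form `k * x * k⁻¹` with `k =
      -- (h v)⁻¹`.
      rw [Wave.sum_val, gaugeOp_val, cornerField_val I S τ ρ hv,
        holonomy_gaugeAct h g (hW.isPath_loopAt hv), ← inv_inv (h v), inv_inv (h v)⁻¹,
        trace_conj_generator' I τ ρ hκ hτ]
      refine Finset.sum_congr rfl fun b _ => ?_
      rw [← cornerField_val I S τ ρ hv]
      rfl
    · simp [cornerField, hv]

open scoped Classical in
/-- The corner vertices as a finite set. -/
noncomputable def cornerFinset (Λ : Lattice V E) (W : List (OrientedEdge E)) : Finset V :=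
  Finset.univ.image fun i : Fin W.length => Λ.origin W[i]

lemma mem_cornerFinset {W : List (OrientedEdge E)} (hW : S.IsCornerCycle W) (v : V) :
    v ∈ cornerFinset Λ W ↔ v ∈ S.cornerVerts := by
  classical
  rw [hW.mem_cornerVerts_iff, cornerFinset, Finset.mem_image]
  exact ⟨fun ⟨i, _, h⟩ => ⟨i.1, i.2, h⟩, fun ⟨k, hk, h⟩ => ⟨⟨k, hk⟩, Finset.mem_univ _, h⟩⟩

/-- The cycle visits each corner vertex once, so a sum over positions in `W` is a sum over vertices.
-/
lemma electricCenter_eq {W : List (OrientedEdge E)} (hW : S.IsCornerCycle W) :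
    electricCenter I S ρ τ W = centerOp I S τ (cornerFinset Λ W) (cornerField I S τ ρ W) := by
  classical
  have hinj : Function.Injective fun i : Fin W.length => Λ.origin W[i] := by
    intro i j hij
    refine Fin.ext ((hW.nodup_verts.getElem_inj_iff (i := i.1) (hi := by simp) (j := j.1)
      (hj := by simp)).1 ?_)
    simpa using hij
  rw [centerOp, cornerFinset, Finset.sum_image hinj.injOn]
  refine Finset.sum_congr rfl fun i _ => Finset.sum_congr rfl fun a _ => ?_
  have hv : Λ.origin W[i] ∈ S.cornerVerts := hW.mem_cornerVerts_iff.2 ⟨i.1, i.2, rfl⟩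
  rw [cornerField, if_pos hv]
  have h := hW.loopAt_origin i.2
  rw [Fin.getElem_fin, h]

/-- Coefficients are compared one by one: the loop at each vertex is the loop at the fixed base
point conjugated by the inverse of the connecting holonomy, and the conjugation becomes an adjoint
matrix on the generator. -/
lemma electricCenter_eq_based {W : List (OrientedEdge E)} (hW : S.IsCornerCycle W)
    (j : Fin W.length) (p : Fin W.length → List (OrientedEdge E))
    (hp : ∀ i, Λ.IsPath (Λ.origin W[i]) (p i) (Λ.origin W[j]) ∧ PathIn S.cornerEdges (p i)) :
    electricCenter I S ρ τ W = electricCenterBased I S ρ τ W j p := by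
  refine Finset.sum_congr rfl fun i _ => Finset.sum_congr rfl fun a _ => ?_
  congr 2
  refine Subtype.ext (funext fun g => ?_)
  rw [Wave.sum_val]
  have h := hW.holonomy_loopAt_path g (hp i).1 (hp i).2
  rw [Fin.getElem_fin, Fin.getElem_fin, hW.loopAt_origin i.2, hW.loopAt_origin j.2] at h
  have h' : holonomy g (W.rotate i) =
      (holonomy g (p i))⁻¹ * holonomy g (W.rotate j) * holonomy g (p i) := by
    rw [h]; group
  change (ρ.toHom (holonomy g (W.rotate i)) * ρ.generator (τ a)).trace = _
  rw [h', trace_conj_generator I τ ρ]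
  exact Finset.sum_congr rfl fun b _ => mul_comm _ _

/-- For a closed path the two endpoint insertions are the same matrix and cancel under the trace. -/
lemma centerOp_commute_wilsonLoop {C : Finset V} (hC : ∀ v, v ∈ C ↔ v ∈ S.cornerVerts)
    {X : V → ι → Wave I G E} (hX : IsCornerField I S τ X) {v : V} {p : List (OrientedEdge E)}
    (hp : Λ.IsPath v p v) (hpS : PathIn S.edges p) :
    Commute (centerOp I S τ C X) (wilsonLoop I ρ p) := by
  have h : centerOp I S τ C X (traceFun I ρ p 1) = 0 := by
    have h1 : traceFun I ρ p 1 = ∑ i, holEntry I ρ.smooth p i i := by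
      refine Subtype.ext (funext fun g => ?_)
      rw [Wave.sum_val]
      change (ρ.toHom (holonomy g p) * 1).trace = _
      rw [mul_one]
      rfl
    refine Subtype.ext (funext fun g => ?_)
    rw [h1, map_sum, Wave.sum_val]
    simp only [centerOp_holEntry I S τ ρ.smooth hC hX hp hpS]
    change Matrix.trace _ = 0
    rw [Matrix.trace_sub, Matrix.trace_mul_comm, sub_self]
  rw [Commute, SemiconjBy, wilsonLoop, centerOp_mul_mulOp, h, mulOp_zero, add_zero]

/-- The general contraction lemma applies, with the adjoint field matrix at `v` in the role of `t`
and the one at `w` in the role of `s`. -/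
lemma centerOp_commute_dressedPair [I.Boundaryless]
    (hκ : ∀ (g : G) (ξ η : GroupLieAlgebra I G), κ' (Ad I g ξ) (Ad I g η) = κ' ξ η)
    (hτ : ∀ a b, κ' (τ a) (τ b) = if a = b then 1 else 0)
    {C : Finset V} (hC : ∀ v, v ∈ C ↔ v ∈ S.cornerVerts)
    {X : V → ι → Wave I G E} (hX : IsCornerField I S τ X) {v w : V} {e e' : E}
    (he : e ∈ S.interiorEdges) (he' : e' ∈ S.interiorEdges) {p : List (OrientedEdge E)}
    (hp : Λ.IsPath w p v) (hpS : PathIn S.edges p) :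
    Commute (centerOp I S τ C X) (dressedPair I Λ τ v e p w e') := by
  have hdep : ∀ u a k, DependsOn I S.cornerEdges (fieldMat I τ (adHom I τ) X u a k) :=
    fun u a k => DependsOn.sum I _ fun c => DependsOn.smul I _ (hX.depends u c)
  have hm : ∀ a b, centerOp I S τ C X * mulOp I (adjFun I τ a b p) +
      ∑ k, mulOp I (adjFun I τ a k p) * mulOp I (fieldMat I τ (adHom I τ) X w k b) =
      mulOp I (adjFun I τ a b p) * centerOp I S τ C X +
        ∑ k, mulOp I (fieldMat I τ (adHom I τ) X v a k) * mulOp I (adjFun I τ k b p) := by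
    intro a b
    rw [centerOp_mul_mulOp, add_assoc]
    congr 1
    simp only [← mulOp_mul, ← mulOp_sum, ← mulOp_add]
    congr 1
    refine Subtype.ext (funext fun g => ?_)
    -- The adjoint Wilson line is a holonomy entry in the representation `adHom`, so the general
    -- holonomy formula applies to it.
    change (centerOp I S τ C X (holEntry I (contMDiff_adHom I τ) p a b)).1 g +
      (∑ k, adjFun I τ a k p * fieldMat I τ (adHom I τ) X w k b).1 g = _
    rw [centerOp_holEntry I S τ (contMDiff_adHom I τ) hC hX hp hpS, Wave.sum_val, Wave.sum_val,
      ← fieldMat_val, ← fieldMat_val, Matrix.sub_apply, Matrix.mul_apply, Matrix.mul_apply]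
    exact sub_add_cancel _ _
  have hanti : ∀ a k, mulOp I (fieldMat I τ (adHom I τ) X v a k) +
      mulOp I (fieldMat I τ (adHom I τ) X v k a) = 0 := by
    intro a k
    rw [← mulOp_add, ← mulOp_zero]
    congr 1
    rw [fieldMat, fieldMat, ← Finset.sum_add_distrib]
    refine Finset.sum_eq_zero fun c _ => ?_
    rw [← add_smul, matGen_adHom_antisymm I τ hκ hτ, neg_add_cancel, zero_smul]
  have ht : ∀ a k c, flux I Λ v e (τ c) * mulOp I (fieldMat I τ (adHom I τ) X v a k) =
      mulOp I (fieldMat I τ (adHom I τ) X v a k) * flux I Λ v e (τ c) := fun a k c =>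
    commute_flux_mulOp I Λ (hdep v a k) he.2 v (τ c)
  have hA := centerOp_mul_flux I S τ hC hX hκ hτ v he
  have hB := centerOp_mul_flux I S τ hC hX hκ hτ w he'
  exact commute_sum_sum (R := Op I G E) hA hm hB ht hanti

/-! ### Operators localized in the region, for every frame at once -/

section Locality

/-- The operators that act on the interior links only, possibly depending on the corner links as
parameters. -/
noncomputable def interiorAlgebra : Subalgebra ℂ (Op I G E) :=
  Subalgebra.centralizer ℂ
    ({O | ∃ f, DependsOn I (S.cornerEdges ∪ S.edgesᶜ) f ∧ O = mulOp I f} ∪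
     {O | ∃ e ∉ S.edges, (∃ h, O = leftTranslation I e h ∨ O = rightTranslation I e h) ∨
        ∃ ξ, O = leftField I e ξ ∨ O = rightField I e ξ})

/-- A spanning tree consists of corner links, so commuting with functions of all corner links covers
every frame. -/
lemma mem_intrinsicKin {O : Op I G E} (hO : O ∈ interiorAlgebra I S)
    (hg : ∀ h, Commute O (gaugeOp I Λ h)) {T : Set E} (hT : S.IsSpanningTree T) :
    O ∈ intrinsicKin I S T := by
  rw [interiorAlgebra, Subalgebra.mem_centralizer_iff] at hO
  rw [intrinsicKin, Subalgebra.mem_centralizer_iff]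
  rintro K ((⟨f, hf, rfl⟩ | hK) | ⟨h, -, rfl⟩)
  · exact hO _ (Or.inl ⟨f, hf.mono I (Set.union_subset_union_left _ hT.subset), rfl⟩)
  · exact hO _ (Or.inr hK)
  · exact (hg h).symm

lemma leftField_eq_flux (e : E) (ξ : GroupLieAlgebra I G) :
    leftField I e ξ = flux I Λ (Λ.tgt e) e ξ := by
  rw [flux, if_pos rfl]

lemma rightField_eq_flux (e : E) (ξ : GroupLieAlgebra I G) :
    rightField I e ξ = (-1 : ℂ) • flux I Λ (Λ.src e) e ξ := by
  rw [flux, if_neg (Λ.src_ne_tgt e).symm, if_pos rfl]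
  refine LinearMap.ext fun ψ => ?_
  change _ = (-1 : ℂ) • -(rightField I e ξ ψ)
  rw [neg_one_smul, neg_neg]

open scoped Classical in
lemma fluxAct_update {e e' : E} (h : e ≠ e') (v : V) (u : G → G) (x : G) (g : E → G) :
    fluxAct Λ v e x (Function.update g e' (u (g e'))) =
      Function.update (fluxAct Λ v e x g) e' (u (fluxAct Λ v e x g e')) := by
  funext e''
  by_cases h1 : e'' = e
  · subst h1
    simp [fluxAct_self, Function.update_of_ne h]
  · rw [fluxAct_of_ne Λ h1, fluxAct_of_ne Λ h.symm]
    by_cases h2 : e'' = e'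
    · subst h2; simp
    · rw [Function.update_of_ne h2, Function.update_of_ne h2, fluxAct_of_ne Λ h1]

lemma flux_mem_interiorAlgebra [I.Boundaryless] {e : E} (he : e ∈ S.interiorEdges) (v : V)
    (ξ : GroupLieAlgebra I G) : flux I Λ v e ξ ∈ interiorAlgebra I S := by
  classical
  rw [interiorAlgebra, Subalgebra.mem_centralizer_iff]
  rintro K (⟨f, hf, rfl⟩ | ⟨e', he', h⟩)
  · refine (commute_flux_mulOp I Λ hf ?_ v ξ).symm
    rintro (h | h)
    · exact he.2 h
    · exact h he.1
  have hne : e ≠ e' := fun h => he' (h ▸ he.1)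
  rcases h with ⟨h, rfl | rfl⟩ | ⟨η, rfl | rfl⟩
  · rw [flux_eq_derivOp]
    exact (commute_derivOp_compOp I _ _ (fluxAct_update hne v fun y => h⁻¹ * y) ξ).symm
  · rw [flux_eq_derivOp]
    exact (commute_derivOp_compOp I _ _ (fluxAct_update hne v fun y => y * h) ξ).symm
  · rw [leftField_eq_flux I (Λ := Λ)]
    exact commute_flux_flux I Λ (fun h => hne h.2.symm) _ _
  · rw [rightField_eq_flux I (Λ := Λ)]
    exact (commute_flux_flux I Λ (fun h => hne h.2.symm) _ _).smul_left _

lemma mulOp_mem_interiorAlgebra {f : Wave I G E} (hf : DependsOn I S.edges f) :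
    mulOp I f ∈ interiorAlgebra I S := by
  rw [interiorAlgebra, Subalgebra.mem_centralizer_iff]
  rintro K (⟨f', -, rfl⟩ | ⟨e', he', h⟩)
  · exact commute_mulOp I f' f
  -- Stated for an arbitrary decidability instance so as to match the one inside the translations
  -- and fields.
  have hup : ∀ (g : E → G) (x : G) (D : DecidableEq E),
      f.1 (@Function.update E (fun _ => G) D g e' x) = f.1 g := fun g x D =>
    hf _ _ fun e he => Function.update_of_ne (fun h : e = e' => he' (h ▸ he)) _ _
  rcases h with ⟨h, rfl | rfl⟩ | ⟨η, rfl | rfl⟩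
  · exact commute_compOp_mulOp I _ fun g => hup g _ _
  · exact commute_compOp_mulOp I _ fun g => hup g _ _
  · exact commute_derivOp_mulOp I _ (fun x g => hup g _ _) η
  · exact commute_derivOp_mulOp I _ (fun x g => hup g _ _) η

lemma interiorFlux_mem_interiorAlgebra [I.Boundaryless] (v : V) (ξ : GroupLieAlgebra I G) :
    interiorFlux I S v ξ ∈ interiorAlgebra I S := by
  refine sum_mem fun e _ => ?_
  split_ifs with he
  · exact flux_mem_interiorAlgebra I S he v ξ
  · exact zero_mem _

lemma centerOp_mem_interiorAlgebra [I.Boundaryless] (C : Finset V) {X : V → ι → Wave I G E}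
    (hX : IsCornerField I S τ X) : centerOp I S τ C X ∈ interiorAlgebra I S :=
  sum_mem fun v _ => sum_mem fun a _ =>
    mul_mem (mulOp_mem_interiorAlgebra I S ((hX.depends v a).mono I S.cornerEdges_subset))
      (interiorFlux_mem_interiorAlgebra I S v (τ a))

lemma dressedPair_mem_interiorAlgebra [I.Boundaryless] {v w : V} {e e' : E}
    (he : e ∈ S.interiorEdges) (he' : e' ∈ S.interiorEdges) {p : List (OrientedEdge E)}
    (hpS : PathIn S.edges p) : dressedPair I Λ τ v e p w e' ∈ interiorAlgebra I S :=
  sum_mem fun a _ => sum_mem fun b _ =>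
    mul_mem (mul_mem (flux_mem_interiorAlgebra I S he v (τ a))
      (mulOp_mem_interiorAlgebra I S (dependsOn_holEntry I (contMDiff_adHom I τ) hpS a b)))
      (flux_mem_interiorAlgebra I S he' w (τ b))

end Locality

lemma gaugeOp_commute_wilsonLoop {v : V} {p : List (OrientedEdge E)} (hp : Λ.IsPath v p v)
    (h : V → G) : Commute (wilsonLoop I ρ p) (gaugeOp I Λ h) := by
  refine (Commute.symm ?_)
  rw [Commute, SemiconjBy, wilsonLoop, gaugeOp_mul_mulOp]
  congr 2
  refine Subtype.ext (funext fun g => ?_)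
  rw [gaugeOp_val]
  change (ρ.toHom (holonomy (gaugeAct Λ h g) p) * 1).trace = (ρ.toHom (holonomy g p) * 1).trace
  rw [holonomy_gaugeAct h g hp, mul_one, mul_one, map_mul, Matrix.trace_mul_comm, ← map_mul]
  congr 2
  group

lemma gaugeOp_adjFun {v w : V} {p : List (OrientedEdge E)} (hp : Λ.IsPath v p w)
    (h : V → G) (a b : ι) :
    gaugeOp I Λ h (adjFun I τ a b p) =
      ∑ c, adHom I τ (h w)⁻¹ a c • ∑ e, adHom I τ (h v) e b • adjFun I τ c e p := by
  refine Subtype.ext (funext fun g => ?_)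
  rw [gaugeOp_val, Wave.sum_val]
  change adHom I τ (holonomy (gaugeAct Λ h g) p) a b = _
  rw [holonomy_gaugeAct h g hp, mul_assoc, map_mul, Matrix.mul_apply]
  refine Finset.sum_congr rfl fun c _ => ?_
  change _ = adHom I τ (h w)⁻¹ a c * (∑ e, adHom I τ (h v) e b • adjFun I τ c e p : Wave I G E).1 g
  rw [Wave.sum_val, map_mul, Matrix.mul_apply]
  congr 1
  exact Finset.sum_congr rfl fun e _ => mul_comm _ _

lemma gaugeOp_commute_dressedPair
    (hκ : ∀ (g : G) (ξ η : GroupLieAlgebra I G), κ' (Ad I g ξ) (Ad I g η) = κ' ξ η)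
    (hτ : ∀ a b, κ' (τ a) (τ b) = if a = b then 1 else 0)
    {v w : V} {e e' : E} {p : List (OrientedEdge E)} (hp : Λ.IsPath w p v) (h : V → G) :
    Commute (dressedPair I Λ τ v e p w e') (gaugeOp I Λ h) := by
  have hflux : ∀ v e a, gaugeOp I Λ h * flux I Λ v e (τ a) =
      (∑ b, adHom I τ (h v) b a • flux I Λ v e (τ b)) * gaugeOp I Λ h := fun v e a => by
    rw [gaugeOp_mul_flux_basis, Finset.sum_mul]
    exact Finset.sum_congr rfl fun b _ => (smul_mul_assoc _ _ _).symm
  let Q : ι → Op I G E := fun a => ∑ b, mulOp I (adjFun I τ a b p) * flux I Λ w e' (τ b)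
  have hP : dressedPair I Λ τ v e p w e' = ∑ a, flux I Λ v e (τ a) * Q a := by
    simp only [dressedPair, Q, Finset.mul_sum, mul_assoc]
  -- The indices at `w` cancel between the Wilson line and the second flux; what is left rotates
  -- like a flux at `v`, so the same cancellation can be repeated there.
  have hQ : ∀ a, gaugeOp I Λ h * Q a =
      (∑ c, adHom I τ (h v) c a • Q c) * gaugeOp I Λ h := by
    intro a
    have h1 : ∀ b, gaugeOp I Λ h * (mulOp I (adjFun I τ a b p) * flux I Λ w e' (τ b)) =
        (∑ e, adHom I τ (h w) e b •
          mulOp I (∑ c, adHom I τ (h v)⁻¹ a c • adjFun I τ c e p)) *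
          (∑ b', adHom I τ (h w) b' b • flux I Λ w e' (τ b')) * gaugeOp I Λ h := by
      intro b
      rw [← mul_assoc, gaugeOp_mul_mulOp, mul_assoc, hflux, ← mul_assoc, gaugeOp_adjFun I τ hp]
      congr 2
      simp only [mulOp_sum, mulOp_smul, Finset.smul_sum]
      rw [Finset.sum_comm]
      exact Finset.sum_congr rfl fun _ _ => Finset.sum_congr rfl fun _ _ => smul_comm _ _ _
    rw [show Q a = ∑ b, mulOp I (adjFun I τ a b p) * flux I Λ w e' (τ b) from rfl,
      Finset.mul_sum, Finset.sum_congr rfl fun b _ => h1 b, ← Finset.sum_mul]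
    congr 1
    have h2 := sum_mul_dual (adHom_mul_transpose I τ hκ hτ (h w))
      (fun f => mulOp I (∑ c, adHom I τ (h v)⁻¹ a c • adjFun I τ c f p))
      fun b => flux I Λ w e' (τ b)
    simp only [Matrix.transpose_apply] at h2
    rw [h2]
    simp only [Q, mulOp_sum, mulOp_smul, Finset.sum_mul, Finset.smul_sum, smul_mul_assoc,
      adHom_inv I τ hκ hτ]
    exact Finset.sum_comm
  have h3 := sum_mul_dual (adHom_mul_transpose I τ hκ hτ (h v))
    (fun a => flux I Λ v e (τ a)) Q
  simp only [Matrix.transpose_apply] at h3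
  refine Commute.symm ?_
  rw [hP, Commute, SemiconjBy, Finset.mul_sum]
  have h4 : ∀ a, gaugeOp I Λ h * (flux I Λ v e (τ a) * Q a) =
      (∑ b, adHom I τ (h v) b a • flux I Λ v e (τ b)) * (∑ c, adHom I τ (h v) c a • Q c) *
        gaugeOp I Λ h := fun a => by
    rw [← mul_assoc, hflux, mul_assoc, hQ, mul_assoc]
  simp only [h4]
  rw [← Finset.sum_mul, h3]

/-- Gauge invariance makes `O` preserve physical states, and `O` itself represents its restriction
relative to every tree. -/
lemma exists_restriction {O : Op I G E} (hO : O ∈ interiorAlgebra I S)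
    (hg : ∀ h, Commute O (gaugeOp I Λ h)) :
    ∃ O' ∈ magneticAlgebra I (G := G) S, IsRestriction I O' O := by
  have hpres : ∀ ψ ∈ Phys I (G := G) Λ, O ψ ∈ Phys I (G := G) Λ := fun ψ hψ h hh => by
    have h1 := LinearMap.congr_fun (hg h).eq ψ
    rw [Module.End.mul_apply, Module.End.mul_apply, hψ h hh] at h1
    exact h1.symm
  refine ⟨O.restrict hpres, ?_, fun ψ => rfl⟩
  rw [magneticAlgebra, Algebra.mem_iInf]
  exact fun T => ⟨O, mem_intrinsicKin I S hO hg T.2, fun ψ => rfl⟩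

end Generators

/-! ### Centrality on physical states -/

section Center

variable {EG : Type*} [NormedAddCommGroup EG] [NormedSpace ℝ EG]
  {H : Type*} [TopologicalSpace H] (I : ModelWithCorners ℝ EG H)
  {G : Type*} [TopologicalSpace G] [ChartedSpace H G] [Group G] [LieGroup I ∞ G]
  {V : Type*} {E : Type*} [Fintype E] {Λ : Lattice V E} (S : Region Λ)
  {ι : Type*} [Fintype ι] [DecidableEq ι] (τ : Module.Basis ι ℝ (GroupLieAlgebra I G))
  {d : ℕ} (ρ : SmoothRep I G d)

open scoped Classical in
/-- The flux into the vertex `v` through the edges outside the region. -/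
noncomputable def outerFlux (v : V) (ξ : GroupLieAlgebra I G) : Op I G E :=
  ∑ e : E, if e ∉ S.edges then flux I Λ v e ξ else 0

open scoped Classical in
/-- The flux into the vertex `v` through the edges of the corner. -/
noncomputable def cornerFlux (v : V) (ξ : GroupLieAlgebra I G) : Op I G E :=
  ∑ e : E, if e ∈ S.cornerEdges then flux I Λ v e ξ else 0

lemma gauss_law {v : V} (hv : v ∈ S.cornerVerts) {ψ : Wave I G E} (hψ : ψ ∈ Phys I Λ)
    (ξ : GroupLieAlgebra I G) :
    interiorFlux I S v ξ ψ + cornerFlux I S v ξ ψ + outerFlux I S v ξ ψ = 0 := by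
  classical
  have hb : v ∉ Λ.boundary := Set.disjoint_left.1 S.disjoint_boundary (S.cornerVerts_subset hv)
  rw [← sum_flux_eq_zero I Λ hψ hb ξ]
  simp only [interiorFlux, cornerFlux, outerFlux, LinearMap.sum_apply, ← Finset.sum_add_distrib]
  refine Finset.sum_congr rfl fun e _ => ?_
  by_cases h1 : e ∈ S.edges
  · by_cases h2 : e ∈ S.cornerEdges
    · simp [h1, h2, Region.interiorEdges]
    · simp [h1, h2, Region.interiorEdges]
  · have h2 : e ∉ S.cornerEdges := fun h => h1 (S.cornerEdges_subset h)
    simp [h1, h2, Region.interiorEdges]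

/-- The corner links do not contribute: the fluxes into their two ends cancel. -/
lemma sum_cornerFlux_eq_zero {C : Finset V} (hC : ∀ v, v ∈ C ↔ v ∈ S.cornerVerts)
    {X : V → ι → Wave I G E} (hX : IsCornerField I S τ X) (ψ : Wave I G E) :
    ∑ v ∈ C, ∑ a, X v a * cornerFlux I S v (τ a) ψ = 0 := by
  classical
  have h1 : ∑ v ∈ C, ∑ a, X v a * cornerFlux I S v (τ a) ψ =
      ∑ e : E, if e ∈ S.cornerEdges then ∑ v ∈ C, ∑ a, X v a * flux I Λ v e (τ a) ψ else 0 := by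
    have h2 : ∀ v a, X v a * cornerFlux I S v (τ a) ψ =
        ∑ e : E, if e ∈ S.cornerEdges then X v a * flux I Λ v e (τ a) ψ else 0 := fun v a => by
      rw [cornerFlux, LinearMap.sum_apply, Finset.mul_sum]
      refine Finset.sum_congr rfl fun e _ => ?_
      split_ifs
      · rfl
      · exact mul_zero _
    simp only [h2]
    have h3 : ∀ v, ∑ a, ∑ e : E,
        (if e ∈ S.cornerEdges then X v a * flux I Λ v e (τ a) ψ else 0) =
        ∑ e : E, ∑ a, if e ∈ S.cornerEdges then X v a * flux I Λ v e (τ a) ψ else 0 :=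
      fun v => Finset.sum_comm
    simp only [h3]
    rw [Finset.sum_comm]
    refine Finset.sum_congr rfl fun e _ => ?_
    split_ifs
    · rfl
    · simp
  rw [h1]
  refine Finset.sum_eq_zero fun e _ => ?_
  split_ifs with he
  swap
  · rfl
  -- For a fixed corner link only its two distinct ends contribute. There the field is transported
  -- by `Ad (g e)` and the flux by its dual with a minus sign, so the two terms cancel.
  rw [Finset.sum_eq_add_of_mem (Λ.src e) (Λ.tgt e) ((hC _).2 (S.corner_src_mem e he))
    ((hC _).2 (S.corner_tgt_mem e he)) (Λ.src_ne_tgt e)]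
  · refine Subtype.ext (funext fun g => ?_)
    change (∑ a, X (Λ.src e) a * flux I Λ (Λ.src e) e (τ a) ψ).1 g +
      (∑ a, X (Λ.tgt e) a * flux I Λ (Λ.tgt e) e (τ a) ψ).1 g = 0
    rw [Wave.sum_val, Wave.sum_val]
    have h2 := sum_mul_dual (R := ℂ)
      (show adHom I τ (g e)⁻¹ * adHom I τ (g e) = 1 by rw [← map_mul, inv_mul_cancel, map_one])
      (fun a => (flux I Λ (Λ.src e) e (τ a) ψ).1 g) fun a => (X (Λ.src e) a).1 g
    have h3 : ∀ a, (X (Λ.tgt e) a * flux I Λ (Λ.tgt e) e (τ a) ψ).1 g =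
        -((∑ b, adHom I τ (g e)⁻¹ b a • (flux I Λ (Λ.src e) e (τ b) ψ).1 g) *
          ∑ c, adHom I τ (g e) a c • (X (Λ.src e) c).1 g) := fun a => by
      change (X (Λ.tgt e) a).1 g * (flux I Λ (Λ.tgt e) e (τ a) ψ).1 g = _
      have ht := hX.transport (e, true) he a g
      change (X (Λ.tgt e) a).1 g = ∑ b, adHom I τ (g e) a b * (X (Λ.src e) b).1 g at ht
      rw [ht, flux_tgt_val I Λ τ, mul_neg, mul_comm]
      rfl
    simp only [h3, Finset.sum_neg_distrib]
    rw [h2, ← sub_eq_add_neg, sub_eq_zero]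
    exact Finset.sum_congr rfl fun a _ => mul_comm _ _
  · intro v _ hv
    refine Finset.sum_eq_zero fun a _ => ?_
    rw [flux_of_not_mem I Λ hv.2.symm hv.1.symm]
    exact mul_zero _

/-- On physical states the electric center acts through the links outside the region. -/
lemma centerOp_apply_phys {C : Finset V} (hC : ∀ v, v ∈ C ↔ v ∈ S.cornerVerts)
    {X : V → ι → Wave I G E} (hX : IsCornerField I S τ X) {ψ : Wave I G E}
    (hψ : ψ ∈ Phys I Λ) :
    centerOp I S τ C X ψ = -∑ v ∈ C, ∑ a, X v a * outerFlux I S v (τ a) ψ := by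
  have h : centerOp I S τ C X ψ + ∑ v ∈ C, ∑ a, X v a * cornerFlux I S v (τ a) ψ +
      ∑ v ∈ C, ∑ a, X v a * outerFlux I S v (τ a) ψ = 0 := by
    rw [centerOp_apply, ← Finset.sum_add_distrib, ← Finset.sum_add_distrib]
    refine Finset.sum_eq_zero fun v hv => ?_
    rw [← Finset.sum_add_distrib, ← Finset.sum_add_distrib]
    refine Finset.sum_eq_zero fun a _ => ?_
    rw [← mul_add, ← mul_add, gauss_law I S ((hC v).1 hv) hψ, mul_zero]
  rw [sum_cornerFlux_eq_zero I S τ hC hX, add_zero] at h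
  exact eq_neg_of_add_eq_zero_left h

/-- The outer flux parallel transported to the start of the path `p`. -/
noncomputable def dressedOuterFlux (p : List (OrientedEdge E)) (v : V) (b : ι) : Op I G E :=
  ∑ a, mulOp I (adjFun I τ a b p) * outerFlux I S v (τ a)

variable {κ' : LinearMap.BilinForm ℝ (GroupLieAlgebra I G)}

/-- Inserting the orthogonal matrix `Ad` of the holonomy along `p` in both factors leaves the
contraction unchanged and moves the indices from `v` to the start of `p`. By cyclicity the rotated
field is the trace of the loop prolonged by `p` and its reverse. -/
lemma sum_dressed
    (hκ : ∀ (g : G) (ξ η : GroupLieAlgebra I G), κ' (Ad I g ξ) (Ad I g η) = κ' ξ η)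
    (hτ : ∀ a b, κ' (τ a) (τ b) = if a = b then 1 else 0)
    {W : List (OrientedEdge E)} {v : V} (hv : v ∈ S.cornerVerts)
    (p : List (OrientedEdge E)) (ψ : Wave I G E) :
    ∑ a, cornerField I S τ ρ W v a * outerFlux I S v (τ a) ψ =
      ∑ b, traceFun I ρ (p ++ loopAt Λ W v ++ revPath p) (ρ.generator (τ b)) *
        dressedOuterFlux I S τ p v b ψ := by
  refine Subtype.ext (funext fun g => ?_)
  rw [Wave.sum_val, Wave.sum_val]
  have h := sum_mul_dual (R := ℂ) (adHom_mul_transpose I τ hκ hτ (holonomy g p))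
    (fun a => (cornerField I S τ ρ W v a).1 g) fun a => (outerFlux I S v (τ a) ψ).1 g
  refine h.symm.trans (Finset.sum_congr rfl fun b _ => ?_)
  change _ = (ρ.toHom (holonomy g (p ++ loopAt Λ W v ++ revPath p)) *
    ρ.generator (τ b)).trace * (dressedOuterFlux I S τ p v b ψ).1 g
  rw [holonomy_append, holonomy_append, holonomy_revPath, ← mul_assoc,
    trace_conj_generator I τ ρ, dressedOuterFlux, LinearMap.sum_apply, Wave.sum_val]
  simp only [cornerField_val I S τ ρ hv, smul_eq_mul]
  rfl

lemma outerFlux_comm_gauge (h : V → G) (v : V) (a : ι) :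
    gaugeOp I Λ h * outerFlux I S v (τ a) =
      (∑ b, adHom I τ (h v) b a • outerFlux I S v (τ b)) * gaugeOp I Λ h := by
  simp only [outerFlux, Finset.mul_sum, Finset.smul_sum]
  rw [Finset.sum_comm, Finset.sum_mul]
  refine Finset.sum_congr rfl fun e _ => ?_
  split_ifs
  · simp
  · rw [gaugeOp_mul_flux_basis, Finset.sum_mul]
    exact Finset.sum_congr rfl fun b _ => (smul_mul_assoc _ _ _).symm

/-- The index at `v` is contracted, and the free index sits at `b₀`, where the transformation is
trivial. -/
lemma gaugeOp_commute_dressedOuterFlux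
    (hκ : ∀ (g : G) (ξ η : GroupLieAlgebra I G), κ' (Ad I g ξ) (Ad I g η) = κ' ξ η)
    (hτ : ∀ a b, κ' (τ a) (τ b) = if a = b then 1 else 0)
    {b₀ v : V} {p : List (OrientedEdge E)} (hp : Λ.IsPath b₀ p v) {h : V → G} (h1 : h b₀ = 1)
    (b : ι) : Commute (dressedOuterFlux I S τ p v b) (gaugeOp I Λ h) := by
  refine Commute.symm ?_
  have h2 : ∀ a, gaugeOp I Λ h * (mulOp I (adjFun I τ a b p) * outerFlux I S v (τ a)) =
      (∑ c, adHom I τ (h v) c a • mulOp I (adjFun I τ c b p)) *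
        (∑ c, adHom I τ (h v) c a • outerFlux I S v (τ c)) * gaugeOp I Λ h := fun a => by
    have hg : gaugeOp I Λ h (adjFun I τ a b p) =
        ∑ c, adHom I τ (h v) c a • adjFun I τ c b p := by
      rw [gaugeOp_adjFun I τ hp, h1, map_one]
      simp only [Matrix.one_apply, ite_smul, one_smul, zero_smul, Finset.sum_ite_eq',
        Finset.mem_univ, if_true, adHom_inv I τ hκ hτ]
    rw [← mul_assoc, gaugeOp_mul_mulOp, mul_assoc, outerFlux_comm_gauge, ← mul_assoc, hg]
    simp only [mulOp_sum, mulOp_smul]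
  have h3 := sum_mul_dual (adHom_mul_transpose I τ hκ hτ (h v))
    (fun a => mulOp I (adjFun I τ a b p)) fun a => outerFlux I S v (τ a)
  simp only [Matrix.transpose_apply] at h3
  rw [Commute, SemiconjBy, dressedOuterFlux, Finset.mul_sum, Finset.sum_congr rfl fun a _ => h2 a,
    ← Finset.sum_mul, h3]

/-- Both ingredients, the Wilson line and the electric fields, involve outer links only and lie in
the span of operators which the algebra commutes with by definition. -/
lemma commute_dressedOuterFlux {T : Set E} {O : Op I G E} (hO : O ∈ intrinsicKin I S T)
    {p : List (OrientedEdge E)} (hp : PathIn S.edgesᶜ p) (v : V) (b : ι) :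
    Commute O (dressedOuterFlux I S τ p v b) := by
  rw [intrinsicKin, Subalgebra.mem_centralizer_iff] at hO
  refine Commute.sum_right _ _ _ fun a _ => Commute.mul_right ?_ ?_
  · refine (hO _ (Or.inl (Or.inl ⟨adjFun I τ a b p, ?_, rfl⟩))).symm
    exact dependsOn_holEntry I (contMDiff_adHom I τ)
      (hp.mono Set.subset_union_right) a b
  · refine Commute.sum_right _ _ _ fun e _ => ?_
    split_ifs with he
    · exact Commute.zero_right _
    · by_cases h1 : Λ.tgt e = v
      · subst h1
        rw [← leftField_eq_flux]
        exact (hO _ (Or.inl (Or.inr ⟨e, he, Or.inr ⟨_, Or.inl rfl⟩⟩))).symm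
      by_cases h2 : Λ.src e = v
      · subst h2
        have h3 : flux I Λ (Λ.src e) e (τ a) = (-1 : ℂ) • rightField I e (τ a) := by
          rw [rightField_eq_flux I (Λ := Λ), smul_smul]
          norm_num
        rw [h3]
        exact Commute.smul_right (hO _ (Or.inl (Or.inr ⟨e, he, Or.inr ⟨_, Or.inr rfl⟩⟩))).symm _
      · rw [flux_of_not_mem I Λ h1 h2]
        exact Commute.zero_right _

/-- The kinematical operator `B` preserves the physical states and commutes with `y` there. -/
def CommutesOnPhys (y : Module.End ℂ (Phys I (G := G) Λ)) (B : Op I G E) : Prop :=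
  ∀ ψ : Phys I (G := G) Λ, ∃ φ : Phys I (G := G) Λ, φ.1 = B ψ.1 ∧ (y φ).1 = B (y ψ).1

namespace CommutesOnPhys

variable {I} {y : Module.End ℂ (Phys I (G := G) Λ)} {A B : Op I G E}

lemma mul (hA : CommutesOnPhys I y A) (hB : CommutesOnPhys I y B) :
    CommutesOnPhys I y (A * B) := fun ψ => by
  obtain ⟨φ, h1, h2⟩ := hB ψ
  obtain ⟨χ, h3, h4⟩ := hA φ
  exact ⟨χ, by rw [h3, h1]; rfl, by rw [h4, h2]; rfl⟩

lemma add (hA : CommutesOnPhys I y A) (hB : CommutesOnPhys I y B) :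
    CommutesOnPhys I y (A + B) := fun ψ => by
  obtain ⟨φ, h1, h2⟩ := hB ψ
  obtain ⟨χ, h3, h4⟩ := hA ψ
  refine ⟨χ + φ, ?_, ?_⟩
  · rw [Submodule.coe_add, h3, h1]; rfl
  · rw [map_add, Submodule.coe_add, h4, h2]; rfl

lemma smul (c : ℂ) (hA : CommutesOnPhys I y A) : CommutesOnPhys I y (c • A) := fun ψ => by
  obtain ⟨χ, h3, h4⟩ := hA ψ
  refine ⟨c • χ, ?_, ?_⟩
  · rw [Submodule.coe_smul, h3]; rfl
  · rw [map_smul, Submodule.coe_smul, h4]; rfl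

lemma zero : CommutesOnPhys I y (0 : Op I G E) := fun ψ => ⟨0, rfl, by rw [map_zero]; rfl⟩

lemma sum {κ : Type*} (s : Finset κ) {F : κ → Op I G E}
    (hF : ∀ k ∈ s, CommutesOnPhys I y (F k)) : CommutesOnPhys I y (∑ k ∈ s, F k) :=
  Finset.sum_induction F (CommutesOnPhys I y) (fun _ _ => add) zero hF

end CommutesOnPhys

/-- One tree is enough for a given `B`. The kinematical representative of `y` depends on that tree,
and this is why the conclusion, which is meant to be composed over different trees, speaks of
physical states only. -/
lemma commutesOnPhys_of_kin {y : Module.End ℂ (Phys I (G := G) Λ)}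
    (hy : y ∈ magneticAlgebra I (G := G) S) {T : Set E} (hT : S.IsSpanningTree T) {B : Op I G E}
    (hB : ∀ O ∈ intrinsicKin I S T, Commute O B)
    (hg : ∀ h : V → G, IsSmall Λ h → Commute B (gaugeOp I Λ h)) : CommutesOnPhys I y B := by
  rw [magneticAlgebra, Algebra.mem_iInf] at hy
  obtain ⟨O, hO, hyO⟩ := hy ⟨T, hT⟩
  have hpres : ∀ ψ ∈ Phys I (G := G) Λ, B ψ ∈ Phys I (G := G) Λ := fun ψ hψ h hh => by
    have h1 := LinearMap.congr_fun (hg h hh).eq ψ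
    rw [Module.End.mul_apply, Module.End.mul_apply, hψ h hh] at h1
    exact h1.symm
  intro ψ
  refine ⟨⟨B ψ.1, hpres _ ψ.2⟩, rfl, ?_⟩
  rw [hyO, hyO]
  exact LinearMap.congr_fun (hB O hO).eq ψ.1

/-- A Wilson line with both ends on the boundary is invariant under small gauge transformations
entry by entry, without taking a trace. -/
lemma commutesOnPhys_holEntry {y : Module.End ℂ (Phys I (G := G) Λ)}
    (hy : y ∈ magneticAlgebra I (G := G) S) {T : Set E} (hT : S.IsSpanningTree T)
    {b b' : V} (hb : b ∈ Λ.boundary) (hb' : b' ∈ Λ.boundary) {p : List (OrientedEdge E)}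
    (hp : Λ.IsPath b p b') (hpT : PathIn (T ∪ S.edgesᶜ) p) (i j : Fin d) :
    CommutesOnPhys I y (mulOp I (holEntry I ρ.smooth p i j)) := by
  refine commutesOnPhys_of_kin I S hy hT (fun O hO => ?_) fun h hh => ?_
  · rw [intrinsicKin, Subalgebra.mem_centralizer_iff] at hO
    exact (hO _ (Or.inl (Or.inl ⟨_, dependsOn_holEntry I ρ.smooth hpT i j, rfl⟩))).symm
  · refine Commute.symm ?_
    rw [Commute, SemiconjBy, gaugeOp_mul_mulOp]
    congr 2
    refine Subtype.ext (funext fun g => ?_)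
    change ρ.toHom (holonomy (gaugeAct Λ h g) p) i j = ρ.toHom (holonomy g p) i j
    rw [holonomy_gaugeAct h g hp, hh b hb, hh b' hb', inv_one, one_mul, mul_one]

/-- Functions of the corner holonomy, transported to the boundary, commute with the magnetic
center algebra: the loop is cut into two pieces, each of which is a function of a spanning tree. -/
lemma commutesOnPhys_dressedLoop (hS : S.IsAnchored) {W : List (OrientedEdge E)}
    (hW : S.IsCornerCycle W) {y : Module.End ℂ (Phys I (G := G) Λ)}
    (hy : y ∈ magneticAlgebra I (G := G) S) {v b : V} (hv : v ∈ S.cornerVerts)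
    (hb : b ∈ Λ.boundary) {p : List (OrientedEdge E)} (hp : Λ.IsPath b p v)
    (hpS : PathIn S.edgesᶜ p) (A : Matrix (Fin d) (Fin d) ℂ) :
    CommutesOnPhys I y (mulOp I (traceFun I ρ (p ++ loopAt Λ W v ++ revPath p) A)) := by
  obtain ⟨k, hk, rfl⟩ := hW.mem_cornerVerts_iff.1 hv
  obtain ⟨q, hq, -, hqp, hperm⟩ := hW.exists_cons hk
  have hmem : ∀ c ∈ W[k] :: q, c.1 ∈ S.cornerEdges := fun c hc => by
    rw [hW.edges_eq]
    exact List.mem_map_of_mem (hperm.mem_iff.1 hc)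
  have hnd : ((W[k] :: q).map Prod.fst).Nodup := (hperm.map Prod.fst).nodup_iff.2 hW.nodup_edges
  rw [List.map_cons, List.nodup_cons] at hnd
  have hk' := hmem W[k] List.mem_cons_self
  obtain ⟨b', hb', p', hp', hpS'⟩ := hS _ (S.target_mem_cornerVerts hk')
  -- Without self-loops the cycle has a second edge `c`. Deleting `c` gives a tree containing the
  -- edge `W[k]`, and deleting `W[k]` gives a tree containing all of `q`.
  obtain ⟨c, hc⟩ : ∃ c, c ∈ q := by
    cases q with
    | nil => exact absurd hqp (target_ne_origin W[k])
    | cons c q => exact ⟨c, List.mem_cons_self⟩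
  have hT1 := hW.isSpanningTree_diff hk'
  have hT2 := hW.isSpanningTree_diff (hmem c (List.mem_cons_of_mem _ hc))
  have hp1 : PathIn (S.cornerEdges \ {c.1} ∪ S.edgesᶜ) [W[k]] := fun e he => by
    rw [List.mem_singleton.1 he]
    exact Or.inl ⟨hk', fun h => hnd.1 (List.mem_map.2 ⟨c, hc, Eq.symm h⟩)⟩
  have hp2 : PathIn (S.cornerEdges \ {W[k].1} ∪ S.edgesᶜ) q := fun e he =>
    Or.inl ⟨hmem e (List.mem_cons_of_mem _ he), fun h => hnd.1 (List.mem_map.2 ⟨e, he, h⟩)⟩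
  have hout : ∀ {T : Set E} {p : List (OrientedEdge E)}, PathIn S.edgesᶜ p →
      PathIn (T ∪ S.edgesᶜ) p := fun h => h.mono Set.subset_union_right
  -- The loop is cut at both ends of `W[k]`. The detour to the boundary along `p'` is traversed back
  -- and forth and cancels in the product of the two holonomies.
  let q1 := p ++ ([W[k]] ++ revPath p')
  let q2 := p' ++ (q ++ revPath p)
  have hq1 : Λ.IsPath b q1 b' := isPath_append.2 ⟨_, hp, isPath_append.2
    ⟨_, isPath_singleton.2 ⟨rfl, rfl⟩, isPath_revPath hp'⟩⟩
  have hq2 : Λ.IsPath b' q2 b := isPath_append.2 ⟨_, hp', isPath_append.2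
    ⟨_, hqp, isPath_revPath hp⟩⟩
  have h1 := commutesOnPhys_holEntry I S ρ hy hT2 hb hb' hq1
    ((hout hpS).append (hp1.append (hout hpS').revPath))
  have h2 := commutesOnPhys_holEntry I S ρ hy hT1 hb' hb hq2
    ((hout hpS').append (hp2.append (hout hpS).revPath))
  have hfac : traceFun I ρ (p ++ loopAt Λ W (Λ.origin W[k]) ++ revPath p) A =
      ∑ i, ∑ l, ∑ j, A l i • (holEntry I ρ.smooth q2 i j * holEntry I ρ.smooth q1 j l) := by
    refine Subtype.ext (funext fun g => ?_)
    have hhol : holonomy g (p ++ loopAt Λ W (Λ.origin W[k]) ++ revPath p) =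
        holonomy g q2 * holonomy g q1 := by
      simp only [q1, q2, hq, holonomy_append, holonomy_revPath, holonomy]
      group
    simp only [Wave.sum_val]
    change (ρ.toHom (holonomy g (p ++ loopAt Λ W (Λ.origin W[k]) ++ revPath p)) * A).trace =
      ∑ i, ∑ l, ∑ j, A l i * (ρ.toHom (holonomy g q2) i j * ρ.toHom (holonomy g q1) j l)
    rw [hhol, map_mul]
    simp only [Matrix.trace, Matrix.diag_apply, Matrix.mul_apply, Finset.sum_mul]
    exact Finset.sum_congr rfl fun i _ => Finset.sum_congr rfl fun l _ =>
      Finset.sum_congr rfl fun j _ => mul_comm _ _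
  rw [hfac]
  simp only [mulOp_sum, mulOp_smul, mulOp_mul]
  exact CommutesOnPhys.sum _ fun i _ => CommutesOnPhys.sum _ fun l _ =>
    CommutesOnPhys.sum _ fun j _ => ((h2 i j).mul (h1 j l)).smul _

/-- The electric center agrees on physical states with a sum of products of a dressed loop and a
dressed outer flux. Since `y` maps physical states to physical states, commuting with that sum there
suffices. -/
lemma centerOp_commutesOnPhys
    (hκ : ∀ (g : G) (ξ η : GroupLieAlgebra I G), κ' (Ad I g ξ) (Ad I g η) = κ' ξ η)
    (hτ : ∀ a b, κ' (τ a) (τ b) = if a = b then 1 else 0)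
    (hS : S.IsAnchored) {W : List (OrientedEdge E)} (hW : S.IsCornerCycle W)
    {y : Module.End ℂ (Phys I (G := G) Λ)} (hy : y ∈ magneticAlgebra I (G := G) S) :
    CommutesOnPhys I y (centerOp I S τ (cornerFinset Λ W) (cornerField I S τ ρ W)) := by
  classical
  have hC := mem_cornerFinset S hW
  have hX := isCornerField I S τ ρ hκ hτ hW
  have hanch := hS
  choose! b hb p hp hpS using hS
  let B : Op I G E := (-1 : ℂ) • ∑ v ∈ cornerFinset Λ W, ∑ a,
    mulOp I (traceFun I ρ (p v ++ loopAt Λ W v ++ revPath (p v)) (ρ.generator (τ a))) *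
      dressedOuterFlux I S τ (p v) v a
  have hB : ∀ ψ ∈ Phys I (G := G) Λ,
      centerOp I S τ (cornerFinset Λ W) (cornerField I S τ ρ W) ψ = B ψ := by
    intro ψ hψ
    rw [centerOp_apply_phys I S τ hC hX hψ]
    simp only [B]
    rw [LinearMap.smul_apply, neg_one_smul]
    simp only [LinearMap.sum_apply]
    congr 1
    exact Finset.sum_congr rfl fun v hv => sum_dressed I S τ ρ hκ hτ ((hC v).1 hv) (p v) ψ
  -- The dressed outer flux needs just some spanning tree; deleting any corner edge provides one.
  have he : ∃ e, e ∈ S.cornerEdges := by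
    obtain ⟨c, hc⟩ := List.exists_mem_of_ne_nil W hW.ne_nil
    exact ⟨c.1, by rw [hW.edges_eq]; exact List.mem_map_of_mem hc⟩
  obtain ⟨e, he⟩ := he
  have hBc : CommutesOnPhys I y B := by
    refine CommutesOnPhys.smul _ (CommutesOnPhys.sum _ fun v hv => CommutesOnPhys.sum _
      fun a _ => CommutesOnPhys.mul ?_ ?_)
    · have hv := (hC v).1 hv
      exact commutesOnPhys_dressedLoop I S ρ hanch hW hy hv (hb v hv) (hp v hv) (hpS v hv) _
    · have hv := (hC v).1 hv
      exact commutesOnPhys_of_kin I S hy (hW.isSpanningTree_diff he)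
        (fun O hO => commute_dressedOuterFlux I S τ hO (hpS v hv) v a)
        fun h hh => gaugeOp_commute_dressedOuterFlux I S τ hκ hτ (hp v hv) (hh _ (hb v hv)) a
  intro ψ
  obtain ⟨φ, h1, h2⟩ := hBc ψ
  exact ⟨φ, h1.trans (hB _ ψ.2).symm, h2.trans (hB _ (y ψ).2).symm⟩

end Center

end LGT

theorem mainTheorem8 {V E : Type*} [Fintype E]
    {EG : Type*} [NormedAddCommGroup EG] [NormedSpace ℝ EG]
    {H : Type*} [TopologicalSpace H] (I : ModelWithCorners ℝ EG H) [I.Boundaryless]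
    {G : Type*} [TopologicalSpace G] [ChartedSpace H G] [Group G] [LieGroup I ∞ G]
    [CompactSpace G] [T2Space G]
    {ι : Type*} [Fintype ι] [DecidableEq ι]
    -- an `Ad`-invariant inner product on the Lie algebra and an orthonormal basis `τ a = i T^a`
    (κ : LinearMap.BilinForm ℝ (GroupLieAlgebra I G))
    (hκ : ∀ (g : G) (ξ η : GroupLieAlgebra I G), κ (LGT.Ad I g ξ) (LGT.Ad I g η) = κ ξ η)
    (τ : Module.Basis ι ℝ (GroupLieAlgebra I G))
    (hτ : ∀ a b, κ (τ a) (τ b) = if a = b then 1 else 0)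
    {d : ℕ} (ρ : LGT.SmoothRep I G d)
    {Λ : LGT.Lattice V E} (S : LGT.Region Λ) (hS : S.IsAnchored)
    (W : List (LGT.OrientedEdge E)) (hW : S.IsCornerCycle W) :
    -- `Z_{1d}` commutes with all the generators
    (∀ O ∈ LGT.magneticGenerators I S ρ τ, Commute (LGT.electricCenter I S ρ τ W) O) ∧
    -- the generators belong to `𝒜_M`
    (∀ O ∈ LGT.magneticGenerators I S ρ τ,
      ∃ O' ∈ LGT.magneticAlgebra I (G := G) S, LGT.IsRestriction I O' O) ∧
    -- `Z_{1d}` lies in the center of `𝒜_M`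
    (∃ z : LGT.magneticAlgebra I (G := G) S,
      z ∈ Subalgebra.center ℂ (LGT.magneticAlgebra I (G := G) S) ∧
      LGT.IsRestriction I z.1 (LGT.electricCenter I S ρ τ W)) ∧
    -- the expression of `Z_{1d}` with a fixed base point on the corner
    (∀ (j : Fin W.length) (p : Fin W.length → List (LGT.OrientedEdge E)),
      (∀ i, Λ.IsPath (Λ.origin W[i]) (p i) (Λ.origin W[j]) ∧
        LGT.PathIn S.cornerEdges (p i)) →
      LGT.electricCenter I S ρ τ W = LGT.electricCenterBased I S ρ τ W j p) := by
  have hC := LGT.mem_cornerFinset S hW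
  have hX := LGT.isCornerField I S τ ρ hκ hτ hW
  have hZ := LGT.electricCenter_eq I S τ ρ hW
  refine ⟨?_, ?_, ?_, fun j p hp => LGT.electricCenter_eq_based I S τ ρ hW j p hp⟩
  · rintro O (⟨v, -, p, hp, hpS, rfl⟩ | ⟨v, -, w, -, e, he, e', he', -, -, p, hp, hpS, rfl⟩)
    · rw [hZ]
      exact LGT.centerOp_commute_wilsonLoop I S τ ρ hC hX hp hpS
    · rw [hZ]
      exact LGT.centerOp_commute_dressedPair I S τ hκ hτ hC hX he he' hp hpS
  · rintro O (⟨v, -, p, hp, hpS, rfl⟩ | ⟨v, -, w, -, e, he, e', he', -, -, p, hp, hpS, rfl⟩)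
    · exact LGT.exists_restriction I S
        (LGT.mulOp_mem_interiorAlgebra I S (LGT.dependsOn_traceFun I ρ hpS 1))
        (LGT.gaugeOp_commute_wilsonLoop I ρ hp)
    · exact LGT.exists_restriction I S (LGT.dressedPair_mem_interiorAlgebra I S τ he he' hpS)
        (LGT.gaugeOp_commute_dressedPair I τ hκ hτ hp)
  · rw [hZ]
    obtain ⟨z, hz, hzZ⟩ := LGT.exists_restriction I S
      (LGT.centerOp_mem_interiorAlgebra I S τ (LGT.cornerFinset Λ W) hX)
      (LGT.commute_gaugeOp_centerOp I S τ (LGT.cornerFinset Λ W) hX hκ hτ)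
    refine ⟨⟨z, hz⟩, ?_, hzZ⟩
    rw [Subalgebra.mem_center_iff]
    rintro ⟨y, hy⟩
    refine Subtype.ext (LinearMap.ext fun ψ => Subtype.ext ?_)
    -- The state `φ` is the image of `ψ` under `Z`, hence equal to `z ψ`; this turns the statement
    -- about the kinematical operator into one about its restriction.
    obtain ⟨φ, h1, h2⟩ := LGT.centerOp_commutesOnPhys I S τ ρ hκ hτ hS hW hy ψ
    have hφ : z ψ = φ := Subtype.ext ((hzZ ψ).trans h1.symm)
    change (y (z ψ)).1 = (z (y ψ)).1
    rw [hφ, h2]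
    exact (hzZ (y ψ)).symm
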